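/- **Setting.** Agents $i\in\mathcal V=\{1,\dots,N\}$ with states $x_i\in\mathbb R^{n_i}$ and controls $u_i\in\mathbb R^{m_i}$ are coupled by a directed graph $\mathcal E$. Let $\mathcal N_i^{\leftarrow}=\{j\ne i:(j,i)\in\mathcal E\}$ and $\mathcal N_i^{\rightarrow}=\{j\neq i:(i,j)\in\mathcal E\}$, and let $$\dot x_i=f_i:=f_{ii}(x_i,u_i)+\sum_{j\in\mathcal N_i^{\leftarrow}}f_{ij}(x_i,x_j),\qquad l_i:=l_{ii}(x_i,u_i)+\sum_{j\in\mathcal N_i^{\leftarrow}}l_{ij}(x_i,x_j).$$ Write $x=[x_i]$, $u=[u_i]$, $f=[f_i]$, $l=\sum_i l_i$, $V(x)=\sum_iV_i(x_i)$, $\mathbb U=\prod_i\mathbb U_i$. All functions are $C^2$, $f(0,0)=0$, the sets $\mathbb U_i$ are compact and convex with $0$ in their interior, and $m_l(\|x\|^2+\|u\|^2)\le l(x,u)\le M_l(\|x\|^2+\|u\|^2)$, $m_V\|x\|^2\le V(x)\le M_V\|x\|^2$ with $M_l\ge m_l>0$, $M_V\ge m_V>0$. Norms are Euclidean and $\|w\|_{L_\infty}=\sup_{[0,T]}\|w(\tau)\|$.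 *Central problem.* For a horizon $T$ and a sampling time $0<\Delta t<T$, minimize $J(u;\bar x)=V(x(T))+\int_0^Tl(x,u)\,d\tau$ subject to $\dot x=f(x,u)$, $x(0)=\bar x$, over measurable $u:[0,T]\to\mathbb U$. The state equation has a solution on $[0,T]$ for all initial states and all admissible controls. There is an open set $\Gamma\ni0$ on which the minimizer $(x^*(\cdot;\bar x),u^*(\cdot;\bar x))$ exists and is unique. $J^*$ is the optimal cost, $\lambda^*$ the adjoint state ($\dot\lambda^*=-\partial_xH$, $\lambda^*(T)=\partial_xV(x^*(T))$, $H=l+\lambda^{\mathsf T}f$), and $\Gamma_s=\{x\in\Gamma:J^*(x)\le s\}$. *Algorithm.* At a system state $\bar x$, iteration $q$ computes from $(x^{q-1},\lambda^{q-1})$ for all $i$ a triple $(u_i^q,x_i^q,\lambda_i^q)$ solving, in the sense of the first-order optimality conditions (state equation, adjoint equation with terminal value $\partial V_i(x_i(T))$, pointwise minimization of the Hamiltonian over $\mathbb U_i$), the local problem of minimizing $$V_i(x_i(T))+\int_0^T l_i(x_i,u_i,(x_j^{q-1})_{j\in\mathcal N_i^{\leftarrow}})+\sum_{j\in\mathcal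 N_i^{\rightarrow}}(g_{ji}^{q-1})^{\mathsf T}(x_i-x_i^{q-1})\,d\tau$$ subject to $\dot x_i=f_i(x_i,u_i,(x_j^{q-1})_{j\in\mathcal N_i^{\leftarrow}})$, $x_i(0)=\bar x_i$, $u_i(\tau)\in\mathbb U_i$, where $g_{ji}^{q-1}=\partial_{x_i}l_{ji}(x_j^{q-1},x_i^{q-1})+\partial_{x_i}f_{ji}(x_j^{q-1},x_i^{q-1})^{\mathsf T}\lambda_j^{q-1}$. *Closed loop.* In MPC step $k=0,1,\dots$ exactly $q_{\max}\ge1$ iterations are performed at the state $\bar x_k$. Let $x_c(\cdot;\bar x_k)$ solve $\dot x_c=f(x_c,u^{q_{\max}}(\cdot;\bar x_k))$, $x_c(0)=\bar x_k$. Then $\bar x_{k+1}=x_c(\Delta t;\bar x_k)$, the closed-loop state is $x(k\Delta t+\tau)=x_c(\tau;\bar x_k)$ for $\tau\in[0,\Delta t)$, and step $k+1$ is started with the last iterates $(x^{q_{\max}},\lambda^{q_{\max}})$ of step $k$. Put $\Delta x_c(\cdot;\bar x_k)=x_c(\cdot;\bar x_k)-x^*(\cdot;\bar x_k)$. *Assumptions.*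 Fix $\beta,\rho,L>0$ and let $\alpha=\beta(1+\frac{m_l}{m_V}T)$. (i) $\Omega_\beta=\{x\in\Gamma:V(x)\le\beta\}$ is compact, and there is a feedback $r_i(x_i,(x_j)_{j\in\mathcal N_i^{\leftarrow}\cup\mathcal N_i^{\rightarrow}})\in\mathbb U_i$ with $\nabla V(x)^{\mathsf T}f(x,r(x))+l(x,r(x))\le0$ on $\Omega_\beta$. (ii) $\Gamma_\alpha$ is compact and $J^*$ is $C^2$ on $\Gamma$. (iii) Let $\Gamma_\alpha^\rho$ be the closed $\rho$-neighborhood of $\Gamma_\alpha$, and let $\mathcal I$ be the set of pairs of continuous trajectories on $[0,T]$ with values in $\Gamma_\alpha^\rho$ and in the closed $\rho$-neighborhood of $\partial_xV(\Gamma_\alpha^\rho)$, respectively. There are feedback laws $u^*(\tau;\bar x)=\kappa^*(\tau,x^*(\tau;\bar x);\bar x)$ with $\kappa^*(\tau,0;\bar x)=0$, continuous in $\tau$ and Lipschitz in the other arguments on $\Gamma_\alpha^\rho\times\Gamma_\alpha$, and $u^q(\tau;\bar x)=\kappa(\tau,x^q(\tau;\bar x);x^{q-1},\lambda^{q-1},\bar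 x)$ for all $\bar x\in\Gamma_\alpha$, $(x^{q-1},\lambda^{q-1})\in\mathcal I$ and all solutions of the local problems, where $\kappa$ is Lipschitz with constant $L$ in the state in $\Gamma_\alpha^\rho$ and in the trajectories in $\mathcal I$ ($L_\infty$-norm). **Theorem.** There is $T_{\max}>0$, depending only on the agents' data and constants and on $\beta,\rho,L$, such that for all $T<T_{\max}$ for which the above holds there are constants $p\in(0,1)$, $m_J,M_J,D,b,c>0$, $a\in(0,1]$ and $\bar\alpha\in(0,\alpha)$ with the following properties. * For all $\bar x\in\Gamma_\alpha$: $m_J\|\bar x\|^2\le J^*(\bar x)\le M_J\|\bar x\|^2$; and every iteration from a pair in $\mathcal I$ yields a pair in $\mathcal I$ and reduces the error $\|(x^*-x^q,\lambda^*-\lambda^q)\|_{L_\infty}$ at least by the factor $p$. * For all $d>0$ and $\bar x\in\Gamma_\alpha$: if an iteration from a pair in $\mathcal I$ satisfies $\|(x^q-x^{q-1},\lambda^q-\lambda^{q-1})\|_{L_\infty}\le d\|\bar x\|$, then $\|\Delta x_c(\cdot;\bar x)\|_{L_\infty}\le Dd\|\bar x\|$, where $x_c$ is driven by $u^q$. If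 moreover $\bar x\in\Gamma_{\bar\alpha}$ and $d<\frac{\sqrt{m_J}}{2cD}(\sqrt{b^2+4ac}-b)$, then $x_c(\Delta t;\bar x)\in\Gamma_\alpha$ and $J^*(x_c(\Delta t;\bar x))\le(1-a)J^*(\bar x)+b\sqrt{J^*(\bar x)}\,\|\Delta x_c\|_{L_\infty}+c\|\Delta x_c\|_{L_\infty}^2$. * Let $0<d<\frac{\sqrt{m_J}}{2cD}(\sqrt{b^2+4ac}-b)$. Then $p_J:=(1-a)+\frac{bDd}{\sqrt{m_J}}+\frac{cD^2d^2}{m_J}<1$, and for every $M>0$ there are constants $e,\gamma_1,\gamma_2>0$ such that the following holds for every closed loop with $\bar x_0\in\Gamma_{\bar\alpha}$ and initialization $(x^0,\lambda^0)\in\mathcal I$ in step $0$ for which $$q_{\max}>1+\log_p\Big(\frac d{e(1+p)}\Big),\qquad \big\|(x^1-x^0,\lambda^1-\lambda^0)(\cdot;\bar x_0)\big\|_{L_\infty}\le dN\sqrt{\frac{\bar\alpha}{m_J}}\;p^{\,1-q_{\max}} .$$ 1. For all $k$: $\bar x_k\in\Gamma_{\bar\alpha}$, $J^*(\bar x_k)\le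 p_J^k\bar\alpha$ and $\|\Delta x_c(\cdot;\bar x_k)\|_{L_\infty}\le\frac{Dd}{\sqrt{m_J}}\sqrt{p_J^k\bar\alpha}$; and $\|x(t)\|\le\gamma_1e^{-\gamma_2t}$ for all $t\ge0$. 2. If in addition $\|(x^1-x^0,\lambda^1-\lambda^0)(\cdot;\bar x_0)\|_{L_\infty}\le M\|\bar x_0\|$, then the stopping criterion $\|(x^{q_{\max}}-x^{q_{\max}-1},\lambda^{q_{\max}}-\lambda^{q_{\max}-1})(\cdot;\bar x_k)\|_{L_\infty}\le d\|\bar x_k\|$ holds in every step $k$, and $\|x(t)\|\le\gamma_1\|\bar x_0\|e^{-\gamma_2t}$ for all $t\ge0$. -/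

import Mathlib

open Set MeasureTheory

noncomputable section

namespace DMPC

/-- The Euclidean space `ℝ^k`. -/
abbrev E (k : ℕ) : Type := EuclideanSpace ℝ (Fin k)

/-- Stacked vectors `[v_i]` of all agents, `v_i ∈ ℝ^(k i)`, with the Euclidean norm. -/
abbrev Vec {N : ℕ} (k : Fin N → ℕ) : Type := PiLp 2 (fun i : Fin N => E (k i))

/-- The `L_∞`-norm on `[0, T]` of a vector-valued time function. -/
def supNorm {F : Type*} [Norm F] (T : ℝ) (w : ℝ → F) : ℝ :=
  ⨆ τ : Icc (0 : ℝ) T, ‖w τ‖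

/-- The `L_∞`-norm on `[0, T]` of the stacked difference `(x - x', lam - lam')`. -/
def pairDist {F : Type*} [NormedAddCommGroup F] (T : ℝ) (x lam x' lam' : ℝ → F) : ℝ :=
  ⨆ τ : Icc (0 : ℝ) T, Real.sqrt (‖x τ - x' τ‖ ^ 2 + ‖lam τ - lam' τ‖ ^ 2)

/-! ### The network of agents -/

/-- The data of a network of `N` agents with neighbor-affine dynamics and costs.
`edge j i` means that the ordered pair `(j, i)` is an edge: agent `j` influences agent `i`. -/
structure Network (N : ℕ) where
  /-- state dimensions -/
  n : Fin N → ℕ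
  /-- control dimensions -/
  m : Fin N → ℕ
  /-- the directed coupling graph -/
  edge : Fin N → Fin N → Prop
  /-- local dynamics `f_ii` -/
  f₀ : ∀ i, E (n i) → E (m i) → E (n i)
  /-- coupling dynamics `f_ij` -/
  fc : ∀ i j, E (n i) → E (n j) → E (n i)
  /-- local integral cost `l_ii` -/
  l₀ : ∀ i, E (n i) → E (m i) → ℝ
  /-- coupling integral cost `l_ij` -/
  lc : ∀ i j, E (n i) → E (n j) → ℝ
  /-- terminal cost `V_i` -/
  V : ∀ i, E (n i) → ℝ
  /-- control constraint set of agent `i` -/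
  U : ∀ i, Set (E (m i))

namespace Network

variable {N : ℕ} (P : Network N)

open scoped Classical in
/-- The sending neighbors of `i`: the agents that influence `i`. -/
def sending (i : Fin N) : Finset (Fin N) := {j | P.edge j i ∧ j ≠ i}

open scoped Classical in
/-- The receiving neighbors of `i`: the agents that are influenced by `i`. -/
def receiving (i : Fin N) : Finset (Fin N) := {j | P.edge i j ∧ j ≠ i}

/-- Stacked states. -/
abbrev X : Type := Vec P.n

/-- Stacked controls. -/
abbrev C : Type := Vec P.m

/-- Dynamics `f_i(ξ, v, x_N)` of agent `i`; the neighbors' states are read off from `x`. -/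
def agentDyn (i : Fin N) (ξ : E (P.n i)) (v : E (P.m i)) (x : P.X) : E (P.n i) :=
  P.f₀ i ξ v + ∑ j ∈ P.sending i, P.fc i j ξ (x j)

/-- Integral cost `l_i(ξ, v, x_N)` of agent `i`. -/
def agentCost (i : Fin N) (ξ : E (P.n i)) (v : E (P.m i)) (x : P.X) : ℝ :=
  P.l₀ i ξ v + ∑ j ∈ P.sending i, P.lc i j ξ (x j)

/-- Stacked dynamics in which the neighbors' states are taken from `x'`. -/
def dynHat (x : P.X) (u : P.C) (x' : P.X) : P.X :=
  WithLp.toLp 2 (fun i => P.agentDyn i (x i) (u i) x')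

/-- Central dynamics `f(x, u)`. -/
def dyn (x : P.X) (u : P.C) : P.X := P.dynHat x u x

/-- Central integral cost `l(x, u)`. -/
def stageCost (x : P.X) (u : P.C) : ℝ := ∑ i, P.agentCost i (x i) (u i) x

/-- Central terminal cost `V(x)`. -/
def termCost (x : P.X) : ℝ := ∑ i, P.V i (x i)

/-- Regularity of the network: twice continuously differentiable dynamics and costs, compact
convex control sets with the origin in their interior, and an equilibrium at the origin. -/
structure Regular : Prop where
  f₀_smooth : ∀ i, ContDiff ℝ 2 (fun z : E (P.n i) × E (P.m i) => P.f₀ i z.1 z.2)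
  fc_smooth : ∀ i j, ContDiff ℝ 2 (fun z : E (P.n i) × E (P.n j) => P.fc i j z.1 z.2)
  l₀_smooth : ∀ i, ContDiff ℝ 2 (fun z : E (P.n i) × E (P.m i) => P.l₀ i z.1 z.2)
  lc_smooth : ∀ i j, ContDiff ℝ 2 (fun z : E (P.n i) × E (P.n j) => P.lc i j z.1 z.2)
  V_smooth : ∀ i, ContDiff ℝ 2 (P.V i)
  U_compact : ∀ i, IsCompact (P.U i)
  U_convex : ∀ i, Convex ℝ (P.U i)
  U_zero : ∀ i, (0 : E (P.m i)) ∈ interior (P.U i)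
  equilibrium : ∀ i, P.agentDyn i 0 0 0 = 0

/-- The quadratic bounds on the integral and terminal cost. -/
structure QuadBounds (ml Ml mV MV : ℝ) : Prop where
  ml_pos : 0 < ml
  ml_le : ml ≤ Ml
  mV_pos : 0 < mV
  mV_le : mV ≤ MV
  stage_lower : ∀ x u, ml * (‖x‖ ^ 2 + ‖u‖ ^ 2) ≤ P.stageCost x u
  stage_upper : ∀ x u, P.stageCost x u ≤ Ml * (‖x‖ ^ 2 + ‖u‖ ^ 2)
  term_lower : ∀ x, mV * ‖x‖ ^ 2 ≤ P.termCost x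
  term_upper : ∀ x, P.termCost x ≤ MV * ‖x‖ ^ 2

/-! ### The central optimal control problem -/

/-- The admissible controls on `[0, T]`: measurable, with values in `U = ∏ U_i`. -/
def Admissible (T : ℝ) (u : ℝ → P.C) : Prop :=
  AEStronglyMeasurable u (volume.restrict (Icc 0 T)) ∧ ∀ τ ∈ Icc 0 T, ∀ i, u τ i ∈ P.U i

/-- `x` solves `ẋ = f(x, u)`, `x(0) = x₀` on `[0, T]` (in integral form). -/
def IsTraj (T : ℝ) (x₀ : P.X) (u : ℝ → P.C) (x : ℝ → P.X) : Prop :=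
  ContinuousOn x (Icc 0 T) ∧ ∀ τ ∈ Icc 0 T, x τ = x₀ + ∫ s in (0 : ℝ)..τ, P.dyn (x s) (u s)

/-- The system has a solution on `[0, T]`, continuous and therefore bounded, for every initial
condition and every admissible control. -/
def WellPosed (T : ℝ) : Prop :=
  ∀ x₀ u, P.Admissible T u → ∃ x, P.IsTraj T x₀ u x

/-- The cost functional of the central problem along `(x, u)`. -/
def cost (T : ℝ) (x : ℝ → P.X) (u : ℝ → P.C) : ℝ :=
  P.termCost (x T) + ∫ τ in (0 : ℝ)..T, P.stageCost (x τ) (u τ)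

/-- `(x, u)` is a minimizing solution of the central problem with initial state `x₀`. -/
def IsOptimal (T : ℝ) (x₀ : P.X) (x : ℝ → P.X) (u : ℝ → P.C) : Prop :=
  P.Admissible T u ∧ P.IsTraj T x₀ u x ∧
    ∀ x' u', P.Admissible T u' → P.IsTraj T x₀ u' x' → P.cost T x u ≤ P.cost T x' u'

/-- On the open set `Γ ∋ 0`, the central problem has the minimizing solution `(xs x₀, us x₀)`
for every `x₀ ∈ Γ`, and this solution is unique (controls up to null sets). -/
structure OptimalOn (T : ℝ) (Γ : Set P.X) (xs : P.X → ℝ → P.X) (us : P.X → ℝ → P.C) :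
    Prop where
  isOpen : IsOpen Γ
  zero_mem : (0 : P.X) ∈ Γ
  optimal : ∀ x₀ ∈ Γ, P.IsOptimal T x₀ (xs x₀) (us x₀)
  unique : ∀ x₀ ∈ Γ, ∀ x u, P.IsOptimal T x₀ x u →
    EqOn x (xs x₀) (Icc 0 T) ∧ u =ᵐ[volume.restrict (Icc 0 T)] us x₀

/-- The optimal cost `J*`. -/
def optCost (T : ℝ) (xs : P.X → ℝ → P.X) (us : P.X → ℝ → P.C) (x₀ : P.X) : ℝ :=
  P.cost T (xs x₀) (us x₀)

/-- The level set `{x ∈ Γ | J*(x) ≤ α}` of the optimal cost. -/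
def levelSet (T : ℝ) (Γ : Set P.X) (xs : P.X → ℝ → P.X) (us : P.X → ℝ → P.C) (α : ℝ) :
    Set P.X :=
  {x | x ∈ Γ ∧ P.optCost T xs us x ≤ α}

/-- The central Hamiltonian. -/
def ham (x : P.X) (u : P.C) (lam : P.X) : ℝ := P.stageCost x u + inner ℝ lam (P.dyn x u)

/-- `lam` solves the central adjoint equation along `(x, u)`:
`d/dτ lam = - ∂_x H(x, u, lam)`, `lam(T) = ∂_x V(x(T))` (in integral form). -/
def IsAdjoint (T : ℝ) (x : ℝ → P.X) (u : ℝ → P.C) (lam : ℝ → P.X) : Prop :=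
  ContinuousOn lam (Icc 0 T) ∧ ∀ τ ∈ Icc 0 T,
    lam τ = gradient P.termCost (x T) +
      ∫ s in τ..T, gradient (fun ξ => P.ham ξ (u s) (lam s)) (x s)

/-- The structured control-Lyapunov condition: `Ω_β = {x ∈ Γ | V(x) ≤ β}` is compact and there is
a feedback `r_i(x_i, (x_j)_{j ∈ N_i})` with values in `U_i` such that `V̇ + l ≤ 0` on `Ω_β`. -/
def StructuredCLF (Γ : Set P.X) (β : ℝ) : Prop :=
  IsCompact {x | x ∈ Γ ∧ P.termCost x ≤ β} ∧
    ∃ r : P.X → P.C,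
      (∀ i x y, x i = y i → (∀ j ∈ P.sending i ∪ P.receiving i, x j = y j) → r x i = r y i) ∧
      ∀ x ∈ Γ, P.termCost x ≤ β →
        (∀ i, r x i ∈ P.U i) ∧
        fderiv ℝ P.termCost x (P.dyn x (r x)) + P.stageCost x (r x) ≤ 0

/-! ### The sensitivity-based distributed algorithm -/

/-- The gradient `g_ji` of the cost of the receiving neighbor `j` with respect to the state of
agent `i`, at the previous iterates `(x', lam')`. -/
def sens (x' lam' : P.X) (i j : Fin N) : E (P.n i) :=
  gradient (fun ξ => P.lc j i (x' j) ξ + inner ℝ (lam' j) (P.fc j i (x' j) ξ)) (x' i)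

/-- The Hamiltonian `H_i` of the local problem of agent `i`, extended by the sensitivities. -/
def localHam (x' lam' : P.X) (i : Fin N) (ξ : E (P.n i)) (v : E (P.m i)) (μ : E (P.n i)) : ℝ :=
  P.agentCost i ξ v x' + inner ℝ μ (P.agentDyn i ξ v x') +
    ∑ j ∈ P.receiving i, inner ℝ (P.sens x' lam' i j) (ξ - x' i)

/-- The stacked right-hand side `[∂_{x_i} H_i]` of the local adjoint equations. -/
def localGrad (x' lam' x : P.X) (u : P.C) (lam : P.X) : P.X :=
  WithLp.toLp 2 (fun i => gradient (fun ξ => P.localHam x' lam' i ξ (u i) (lam i)) (x i))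

/-- One iteration of the algorithm at the system state `xk`, from the previous iterates
`(x', lam')`: for every agent `i`, the triple `(u_i, x_i, lam_i)` solves the local optimal control
problem, in the sense of its first-order optimality conditions (state equation, adjoint
equation, minimization of the local Hamiltonian). -/
structure IsLocalSol (T : ℝ) (xk : P.X) (x' lam' : ℝ → P.X)
    (x : ℝ → P.X) (u : ℝ → P.C) (lam : ℝ → P.X) : Prop where
  adm : P.Admissible T u
  x_cont : ContinuousOn x (Icc 0 T)
  x_eq : ∀ τ ∈ Icc 0 T, x τ = xk + ∫ s in (0 : ℝ)..τ, P.dynHat (x s) (u s) (x' s)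
  lam_cont : ContinuousOn lam (Icc 0 T)
  lam_eq : ∀ τ ∈ Icc 0 T, lam τ = gradient P.termCost (x T) +
    ∫ s in τ..T, P.localGrad (x' s) (lam' s) (x s) (u s) (lam s)
  ham_min : ∀ᵐ τ ∂(volume.restrict (Icc 0 T)), ∀ i, ∀ v ∈ P.U i,
    P.localHam (x' τ) (lam' τ) i (x τ i) (u τ i) (lam τ i) ≤
      P.localHam (x' τ) (lam' τ) i (x τ i) v (lam τ i)

/-- The admissible previous iterates and initializations: continuous state trajectories in the
closed `ρ`-neighborhood of `K` and continuous adjoint trajectories in the closed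
`ρ`-neighborhood of the image of that set under `∂_x V`. -/
structure Iterates (T ρ : ℝ) (K : Set P.X) (x lam : ℝ → P.X) : Prop where
  x_cont : ContinuousOn x (Icc 0 T)
  lam_cont : ContinuousOn lam (Icc 0 T)
  x_mem : ∀ τ ∈ Icc 0 T, x τ ∈ Metric.cthickening ρ K
  lam_mem : ∀ τ ∈ Icc 0 T,
    lam τ ∈ Metric.cthickening ρ (gradient P.termCost '' Metric.cthickening ρ K)

/-- Regularity of the optimal cost and of the feedback laws. The optimal cost is `C²` on `Γ`.
The central law `u*(τ; x_k) = κ*(x*(τ; x_k); x_k)`, `κ*(0; x_k) = 0`, and the law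
`u^q(τ; x_k) = κ(x^q(τ; x_k); x^{q-1}, lam^{q-1}, x_k)` of the algorithm, which is parameterized
by the trajectories of the previous iteration, are Lipschitz on the sets in which the
trajectories evolve. Both laws may depend on the time `τ`. -/
structure RegularFeedback (T ρ L : ℝ) (Γ : Set P.X) (K : Set P.X)
    (xs : P.X → ℝ → P.X) (us : P.X → ℝ → P.C) (κs : ℝ → P.X → P.X → P.C)
    (κ : ℝ → P.X → (ℝ → P.X) → (ℝ → P.X) → P.X → P.C) : Prop where
  cost_smooth : ContDiffOn ℝ 2 (P.optCost T xs us) Γ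
  opt_law : ∀ xk ∈ Γ, ∀ τ ∈ Icc 0 T, us xk τ = κs τ (xs xk τ) xk
  opt_zero : ∀ xk ∈ Γ, ∀ τ ∈ Icc 0 T, κs τ 0 xk = 0
  opt_cont : ∀ xk ∈ K, ∀ x ∈ Metric.cthickening ρ K,
    ContinuousOn (fun τ => κs τ x xk) (Icc 0 T)
  opt_lip : ∃ Ls : ℝ, ∀ τ ∈ Icc 0 T, ∀ x ∈ Metric.cthickening ρ K, ∀ y ∈ Metric.cthickening ρ K,
    ∀ a ∈ K, ∀ b ∈ K, ‖κs τ x a - κs τ y b‖ ≤ Ls * (‖x - y‖ + ‖a - b‖)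
  law : ∀ xk ∈ K, ∀ x' lam', P.Iterates T ρ K x' lam' →
    ∀ x u lam, P.IsLocalSol T xk x' lam' x u lam →
      ∀ᵐ τ ∂(volume.restrict (Icc 0 T)), u τ = κ τ (x τ) x' lam' xk
  lip : ∀ xk ∈ K, ∀ τ ∈ Icc 0 T, ∀ x ∈ Metric.cthickening ρ K, ∀ y ∈ Metric.cthickening ρ K,
    ∀ x' lam' y' mu', P.Iterates T ρ K x' lam' → P.Iterates T ρ K y' mu' →
      ‖κ τ x x' lam' xk - κ τ y y' mu' xk‖ ≤
        L * (‖x - y‖ + supNorm T (fun s => x' s - y' s) + supNorm T (fun s => lam' s - mu' s))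

/-- All standing hypotheses for the horizon `T`, the sampling time `Δ` and the level `α`. -/
structure Standing (T Δ ρ L β α : ℝ) (Γ : Set P.X)
    (xs : P.X → ℝ → P.X) (us : P.X → ℝ → P.C) (κs : ℝ → P.X → P.X → P.C)
    (κ : ℝ → P.X → (ℝ → P.X) → (ℝ → P.X) → P.X → P.C) : Prop where
  sampling_pos : 0 < Δ
  sampling_lt : Δ < T
  wellPosed : P.WellPosed T
  optimalOn : P.OptimalOn T Γ xs us
  clf : P.StructuredCLF Γ β
  level_compact : IsCompact (P.levelSet T Γ xs us α)
  feedback : P.RegularFeedback T ρ L Γ (P.levelSet T Γ xs us α) xs us κs κ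

/-! ### The closed loop -/

/-- A run of the closed loop in which exactly `q` iterations of the algorithm are performed in
every MPC step. `xb k` is the system state at the sampling time `k Δ`; `x k j`, `u k j`, `lam k j`
are the iterates number `j` in MPC step `k`; `xc k` is the actual state trajectory under the
control `u k q` started at `xb k`. -/
structure IsRun (T Δ : ℝ) (q : ℕ) (xb : ℕ → P.X) (x : ℕ → ℕ → ℝ → P.X) (u : ℕ → ℕ → ℝ → P.C)
    (lam : ℕ → ℕ → ℝ → P.X) (xc : ℕ → ℝ → P.X) : Prop where
  iterate : ∀ k, ∀ j < q,
    P.IsLocalSol T (xb k) (x k j) (lam k j) (x k (j + 1)) (u k (j + 1)) (lam k (j + 1))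
  warm_x : ∀ k, x (k + 1) 0 = x k q
  warm_lam : ∀ k, lam (k + 1) 0 = lam k q
  actual : ∀ k, P.IsTraj T (xb k) (u k q) (xc k)
  next : ∀ k, xb (k + 1) = xc k Δ

end Network

/-- The continuous-time closed-loop state `x(kΔ + τ) = xc k τ`, `τ ∈ [0, Δ)`. -/
def closedLoop {F : Type*} (Δ : ℝ) (xc : ℕ → ℝ → F) (t : ℝ) : F :=
  xc ⌊t / Δ⌋₊ (t - ⌊t / Δ⌋₊ * Δ)

/-- The bound on the stopping constant `d` that ensures stability. -/
def dBound (mJ a b c D : ℝ) : ℝ :=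
  Real.sqrt mJ / (2 * c * D) * (Real.sqrt (b ^ 2 + 4 * a * c) - b)

/-- The contraction rate `p_J` of the optimal cost. -/
def rateJ (mJ a b c D d : ℝ) : ℝ :=
  (1 - a) + b * D * d / Real.sqrt mJ + c * D ^ 2 * d ^ 2 / mJ

namespace Network

variable {N : ℕ} (P : Network N)

/-- Linear convergence of the algorithm with rate `p` towards the optimal state and adjoint
trajectories, for all system states in `K`. -/
def LinearConvergence (T ρ p : ℝ) (K : Set P.X)
    (xs : P.X → ℝ → P.X) (us : P.X → ℝ → P.C) : Prop :=
  ∀ xk ∈ K, ∃ lams : ℝ → P.X, P.IsAdjoint T (xs xk) (us xk) lams ∧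
    ∀ x' lam', P.Iterates T ρ K x' lam' → ∀ x u lam, P.IsLocalSol T xk x' lam' x u lam →
      P.Iterates T ρ K x lam ∧
      pairDist T (xs xk) lams x lam ≤ p * pairDist T (xs xk) lams x' lam'

/-- The bound `D d ‖x_k‖` on the difference between the actual and the optimal trajectory if the
stopping criterion with constant `d` is met. -/
def ErrorBound (T ρ D : ℝ) (K : Set P.X) (xs : P.X → ℝ → P.X) : Prop :=
  ∀ d, 0 < d → ∀ xk ∈ K, ∀ x' lam', P.Iterates T ρ K x' lam' →
    ∀ x u lam xc, P.IsLocalSol T xk x' lam' x u lam → P.IsTraj T xk u xc →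
      pairDist T x lam x' lam' ≤ d * ‖xk‖ →
      supNorm T (fun τ => xc τ - xs xk τ) ≤ D * d * ‖xk‖

/-- The bound on the optimal cost at the next sampling point, for states in the smaller set `K'`
and iterates that meet the stopping criterion with constant `d`. -/
def CostBound (T Δ ρ a b c d : ℝ) (K K' : Set P.X)
    (xs : P.X → ℝ → P.X) (us : P.X → ℝ → P.C) : Prop :=
  ∀ xk ∈ K', ∀ x' lam', P.Iterates T ρ K x' lam' →
    ∀ x u lam xc, P.IsLocalSol T xk x' lam' x u lam → P.IsTraj T xk u xc →
      pairDist T x lam x' lam' ≤ d * ‖xk‖ →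
      xc Δ ∈ K ∧
      P.optCost T xs us (xc Δ) ≤ (1 - a) * P.optCost T xs us xk +
        b * Real.sqrt (P.optCost T xs us xk) * supNorm T (fun τ => xc τ - xs xk τ) +
        c * supNorm T (fun τ => xc τ - xs xk τ) ^ 2

end Network

end DMPC

end

/-! The horizon is chosen small against one constant `C` that bounds the dynamics and the adjoint
right-hand side, together with their Lipschitz constants, on a fixed ball of states, a fixed ball of
adjoints and the compact control set. If `C * T < ρ`, no trajectory moves farther than `ρ` and no
adjoint farther than `ρ` from its terminal value. A state of the level set satisfies `mV * ‖x*(T)‖²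
≤ V(x*(T)) ≤ J* ≤ α`, so integrating backward confines the optimal trajectory, and with it the level
set, to a ball that does not depend on `T` (`Setting.norm_xs_le`).

Contraction: the optimal triple is a fixed point of the iteration. This is Pontryagin's principle
(`ham_le_ham`, by needle variations) together with two structural facts: the central Hamiltonian
separates in the controls, and its state gradient is the stacked local gradient with all iterates
equal (`gradient_ham`). Hence `u*` obeys the same Lipschitz law `κ` as `u^q`, and the state and
adjoint equations, perturbed over a short horizon, halve the error (`err_le`). Consequently the step
size and the error before the step bound each other, and the actual trajectory is as close to the
optimal one as the penultimate iterates (`actual_sub_le`).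

Decrease: since `κ*` vanishes at the zero state, Gronwall's inequality in both directions makes all
optimal quantities comparable with `‖x_k‖`, which gives the quadratic bounds on `J*`. Near the
origin, the shifted optimal control continued by a sampled version of the control-Lyapunov feedback
is a competitor, and refining the sampling shows that `J*` drops along the optimal trajectory by the
cost spent (`exists_J_decrease`). A second-order expansion of `J*` at its minimum `0` transfers this
to the actual next state, with terms linear and quadratic in the error. With an error of relative
size `θ = D d / √mJ` the rate is `1 - a + b θ + c θ² < 1`, which is the meaning of the bound on `d`.

Closed loop: `J*` and the error of the penultimate iterates are carried through one induction
(`run_decay`). Re-initialization at the next state costs an error proportional to the two states,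
which the fixed number of iterations contracts again. For the stopping criterion the error must be
compared with the new state; this works because a step cannot shrink the state by more than a
constant factor (`run_stopping`). -/

noncomputable section

namespace DMPC

/-! ### Barrier, Gronwall and Taylor estimates for integral equations. -/

section Analysis

variable {F : Type*} [NormedAddCommGroup F]

/-- A continuous path that starts at `x₀` and cannot reach distance `r` from `x₀` as long as it
has stayed within distance `r`, stays within distance `r`. -/
theorem norm_sub_lt_of_forall_Icc {T r : ℝ} {x : ℝ → F} {x₀ : F} (hx : ContinuousOn x (Icc 0 T))
    (h : ∀ τ ∈ Icc 0 T, (∀ s ∈ Icc 0 τ, ‖x s - x₀‖ ≤ r) → ‖x τ - x₀‖ < r) (hr : ‖x 0 - x₀‖ < r) :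
    ∀ τ ∈ Icc 0 T, ‖x τ - x₀‖ < r := by
  by_contra! hcon
  obtain ⟨τ, hτ, hτr⟩ := hcon
  have hφ : ContinuousOn (fun s => ‖x s - x₀‖) (Icc 0 T) := (hx.sub continuousOn_const).norm
  have hcomp : IsCompact (Icc 0 T ∩ (fun s => ‖x s - x₀‖) ⁻¹' Ici r) :=
    (isCompact_Icc).of_isClosed_subset (hφ.preimage_isClosed_of_isClosed isClosed_Icc isClosed_Ici)
      inter_subset_left
  -- `t` is the first time at which the distance is at least `r`. A larger distance at some `s ≤ t`
  -- would, by the intermediate value theorem, make the value `r` occur before `s`, against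
  -- minimality.
  obtain ⟨t, ⟨htI, htr⟩, hmin⟩ := hcomp.exists_isLeast ⟨τ, hτ, hτr⟩
  have hsub : Icc 0 t ⊆ Icc 0 T := Icc_subset_Icc_right htI.2
  refine absurd (h t htI ?_) (not_lt.2 htr)
  intro s hs
  by_contra! hgt
  obtain ⟨s', hs', hs'r⟩ := intermediate_value_Icc hs.1 (hφ.mono
    ((Icc_subset_Icc_right hs.2).trans hsub)) ⟨hr.le, hgt.le⟩
  have h1 := hmin ⟨hsub ⟨hs'.1, hs'.2.trans hs.2⟩, ge_of_eq hs'r⟩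
  have : s' = s := le_antisymm hs'.2 (hs.2.trans h1)
  simp only [this] at hs'r
  linarith

variable [NormedSpace ℝ F]

/-- As long as the path stays in the ball, its displacement is at most `G * T < r`, so it never
reaches the boundary. The bound on `g` is needed only inside the ball, which is all that local
estimates provide. -/
theorem norm_sub_lt_of_eq_integral {T r G : ℝ} {x g : ℝ → F} {x₀ : F}
    (hx : ContinuousOn x (Icc 0 T)) (hr : 0 < r) (hG : 0 ≤ G) (hGT : G * T < r)
    (heq : ∀ τ ∈ Icc 0 T, x τ = x₀ + ∫ s in (0 : ℝ)..τ, g s)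
    (hg : ∀ s ∈ Icc 0 T, ‖x s - x₀‖ ≤ r → ‖g s‖ ≤ G) :
    ∀ τ ∈ Icc 0 T, ‖x τ - x₀‖ < r := by
  intro τ hτ
  have hT : 0 ≤ T := hτ.1.trans hτ.2
  refine norm_sub_lt_of_forall_Icc hx ?_ ?_ τ hτ
  · intro t ht hb
    rw [heq t ht, add_sub_cancel_left]
    have := intervalIntegral.norm_integral_le_of_norm_le_const (f := g) (C := G) (a := 0) (b := t)
      (fun s hs => by
        rw [uIoc_of_le ht.1] at hs
        exact hg s ⟨hs.1.le, hs.2.trans ht.2⟩ (hb s ⟨hs.1.le, hs.2⟩))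
    rw [sub_zero, abs_of_nonneg ht.1] at this
    exact lt_of_le_of_lt (this.trans (mul_le_mul_of_nonneg_left ht.2 hG)) hGT
  · rw [heq 0 ⟨le_rfl, hT⟩]; simpa using hr

theorem norm_sub_lt_of_eq_integral_backward {T r G : ℝ} {x g : ℝ → F} {xT : F}
    (hx : ContinuousOn x (Icc 0 T)) (hr : 0 < r) (hG : 0 ≤ G) (hGT : G * T < r)
    (heq : ∀ τ ∈ Icc 0 T, x τ = xT + ∫ s in τ..T, g s)
    (hg : ∀ s ∈ Icc 0 T, ‖x s - xT‖ ≤ r → ‖g s‖ ≤ G) :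
    ∀ τ ∈ Icc 0 T, ‖x τ - xT‖ < r := by
  intro τ hτ
  have hmem : ∀ s ∈ Icc 0 T, T - s ∈ Icc 0 T := fun s hs => ⟨by linarith [hs.2], by linarith [hs.1]⟩
  have := norm_sub_lt_of_eq_integral (T := T) (r := r) (G := G) (x := fun s => x (T - s))
    (g := fun s => g (T - s)) (x₀ := xT) (hx.comp (by fun_prop) hmem) hr hG hGT
    (fun s hs => by
      rw [intervalIntegral.integral_comp_sub_left (fun s => g s) T, heq _ (hmem s hs), sub_zero])
    (fun s hs h => hg _ (hmem s hs) h) (T - τ) (hmem τ hτ)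
  simpa using this

/-- A path all of whose uniform bounds `M` improve to `A + M / 2` is bounded by `2 A`. -/
theorem norm_le_of_forall_bound {F : Type*} [NormedAddCommGroup F]
    {T A : ℝ} {w : ℝ → F} (hw : ContinuousOn w (Icc 0 T))
    (h : ∀ M, 0 ≤ M → (∀ s ∈ Icc 0 T, ‖w s‖ ≤ M) → ∀ s ∈ Icc 0 T, ‖w s‖ ≤ A + M / 2) :
    ∀ s ∈ Icc 0 T, ‖w s‖ ≤ 2 * A := by
  intro s hs
  -- The attained maximum `M` is itself a uniform bound, hence `M ≤ A + M / 2`.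
  obtain ⟨t, ht, hmax⟩ := isCompact_Icc.exists_isMaxOn ⟨s, hs⟩ hw.norm
  have h1 := h ‖w t‖ (norm_nonneg _) (fun s hs => hmax hs) t ht
  have h2 : ‖w s‖ ≤ ‖w t‖ := hmax hs
  linarith

theorem norm_le_exp_mul_of_norm_deriv_le {T K : ℝ} {x g : ℝ → F} (hK : 0 ≤ K)
    (hx : ∀ τ ∈ Icc 0 T, HasDerivWithinAt x (g τ) (Icc 0 T) τ)
    (hg : ∀ τ ∈ Icc 0 T, ‖g τ‖ ≤ K * ‖x τ‖) :
    ∀ τ ∈ Icc 0 T, ‖x τ‖ ≤ Real.exp (K * T) * ‖x 0‖ := by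
  intro τ hτ
  have := norm_le_gronwallBound_of_norm_deriv_right_le (f := x) (f' := g) (δ := ‖x 0‖) (K := K)
    (ε := 0) (a := 0) (b := T) (fun s hs => (hx s hs).continuousWithinAt)
    (fun s hs => (hx s ⟨hs.1, hs.2.le⟩).mono_of_mem_nhdsWithin (Icc_mem_nhdsGE_of_mem hs)) le_rfl
    (fun s hs => by simpa using hg s ⟨hs.1, hs.2.le⟩) τ hτ
  rw [gronwallBound_ε0, sub_zero, mul_comm] at this
  exact this.trans (by gcongr; exact hτ.2)

/-- The reversed path satisfies the same differential inequality: a state cannot decay faster than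
exponentially. The lower bounds on `J*` rest on this. -/
theorem norm_zero_le_exp_mul_of_norm_deriv_le {T K : ℝ} {x g : ℝ → F} (hK : 0 ≤ K)
    (hx : ∀ τ ∈ Icc 0 T, HasDerivWithinAt x (g τ) (Icc 0 T) τ)
    (hg : ∀ τ ∈ Icc 0 T, ‖g τ‖ ≤ K * ‖x τ‖) :
    ∀ τ ∈ Icc 0 T, ‖x 0‖ ≤ Real.exp (K * T) * ‖x τ‖ := by
  intro τ hτ
  have hmem : ∀ s ∈ Icc 0 τ, τ - s ∈ Icc 0 T :=
    fun s hs => ⟨by linarith [hs.2], by linarith [hs.1, hτ.2]⟩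
  have := norm_le_exp_mul_of_norm_deriv_le (T := τ) (K := K) (x := fun s => x (τ - s))
    (g := fun s => - g (τ - s)) hK (fun s hs => by
      have h1 : HasDerivWithinAt (fun s : ℝ => τ - s) (-1) (Icc 0 τ) s := by
        simpa using (hasDerivWithinAt_id s (Icc 0 τ)).const_sub τ
      have := (hx _ (hmem s hs)).scomp s h1 hmem
      simpa [Function.comp_def] using this)
    (fun s hs => by simpa using hg _ (hmem s hs)) τ ⟨hτ.1, le_rfl⟩
  simp only [sub_self, sub_zero] at this
  exact this.trans (by gcongr; exact hτ.2)

theorem exists_lipschitz_of_contDiff {Z : Type*} [NormedAddCommGroup Z] [NormedSpace ℝ Z]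
    {f : Z → F} (hf : ContDiff ℝ 1 f) {S : Set Z} (hS : IsCompact S) (hconv : Convex ℝ S) :
    ∃ C : ℝ, 0 ≤ C ∧ ∀ x ∈ S, ∀ y ∈ S, ‖f x - f y‖ ≤ C * ‖x - y‖ := by
  obtain ⟨C, hC⟩ := hS.exists_bound_of_continuousOn (hf.continuous_fderiv one_ne_zero).continuousOn
  refine ⟨max C 0, le_max_right _ _, fun x hx y hy => ?_⟩
  exact hconv.norm_image_sub_le_of_norm_fderiv_le (𝕜 := ℝ)
    (fun z _ => (hf.differentiable one_ne_zero) z)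
    (fun z hz => (hC z hz).trans (le_max_left _ _)) hy hx

/-- First-order Taylor estimate for a function with Lipschitz derivative. -/
theorem norm_sub_sub_fderiv_le {Z : Type*} [NormedAddCommGroup Z] [NormedSpace ℝ Z]
    {f : Z → F} {S : Set Z} (hf : ∀ z ∈ S, DifferentiableAt ℝ f z) (hS : Convex ℝ S) {C : ℝ}
    {x y : Z} (hC : ∀ z ∈ S, ‖fderiv ℝ f z - fderiv ℝ f x‖ ≤ C * ‖z - x‖)
    (hC0 : 0 ≤ C) (hx : x ∈ S) (hy : y ∈ S) :
    ‖f y - f x - fderiv ℝ f x (y - x)‖ ≤ C * ‖y - x‖ ^ 2 := by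
  have hseg : segment ℝ x y ⊆ S := hS.segment_subset hx hy
  have := (convex_segment x y).norm_image_sub_le_of_norm_fderiv_le' (𝕜 := ℝ) (f := f)
    (φ := fderiv ℝ f x) (C := C * ‖y - x‖) (fun z hz => hf z (hseg hz))
    (fun z hz => (hC z (hseg hz)).trans (by
      gcongr
      simpa [dist_eq_norm] using norm_sub_le_of_mem_segment hz))
    (left_mem_segment ℝ x y) (right_mem_segment ℝ x y)
  rw [pow_two, ← mul_assoc]; exact this

theorem integrableOn_comp_of_mem_compact {F : Type*} [NormedAddCommGroup F]
    {Z : Type*} [TopologicalSpace Z] {G : Z → F}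
    (hG : Continuous G) {z : ℝ → Z} {S : Set Z} (hS : IsCompact S) {T : ℝ}
    (hz : AEStronglyMeasurable z (volume.restrict (Icc 0 T))) (hzS : ∀ τ ∈ Icc 0 T, z τ ∈ S) :
    IntegrableOn (fun τ => G (z τ)) (Icc 0 T) := by
  obtain ⟨C, hC⟩ := hS.exists_bound_of_continuousOn hG.continuousOn
  refine IntegrableOn.of_bound (by simp) (hG.comp_aestronglyMeasurable hz) C ?_
  filter_upwards [ae_restrict_mem measurableSet_Icc] with τ hτ using hC _ (hzS τ hτ)

theorem intervalIntegrable_of_integrableOn_Icc {F : Type*} [NormedAddCommGroup F]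
    {T a b : ℝ} {g : ℝ → F}
    (hg : IntegrableOn g (Icc 0 T)) (ha : a ∈ Icc 0 T) (hb : b ∈ Icc 0 T) :
    IntervalIntegrable g volume a b := by
  rw [intervalIntegrable_iff]
  exact hg.mono_set (uIoc_subset_uIcc.trans (uIcc_subset_Icc ha hb))

theorem norm_integral_le_of_ae_Icc {T a b C : ℝ} {g : ℝ → F}
    (hg : ∀ᵐ s ∂(volume.restrict (Icc 0 T)), ‖g s‖ ≤ C) (ha : a ∈ Icc 0 T) (hb : b ∈ Icc 0 T)
    (hab : a ≤ b) : ‖∫ s in a..b, g s‖ ≤ C * (b - a) := by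
  have := intervalIntegral.norm_integral_le_of_norm_le_const_ae (f := g) (C := C) (a := a) (b := b)
    (by
      rw [ae_restrict_iff' measurableSet_Icc] at hg
      filter_upwards [hg] with s hs hsI
      rw [uIoc_of_le hab] at hsI
      exact hs ⟨ha.1.trans hsI.1.le, hsI.2.trans hb.2⟩)
  rwa [abs_of_nonneg (sub_nonneg.2 hab)] at this

theorem hasDerivWithinAt_of_eq_integral [CompleteSpace F] {T : ℝ} {x g : ℝ → F} {x₀ : F}
    (hg : ContinuousOn g (Icc 0 T)) (heq : ∀ τ ∈ Icc 0 T, x τ = x₀ + ∫ s in (0 : ℝ)..τ, g s) :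
    ∀ τ ∈ Icc 0 T, HasDerivWithinAt x (g τ) (Icc 0 T) τ := by
  intro τ hτ
  have hT : 0 ≤ T := hτ.1.trans hτ.2
  have : Fact (τ ∈ Icc 0 T) := ⟨hτ⟩
  have h1 : HasDerivWithinAt (fun u => ∫ s in (0 : ℝ)..u, g s) (g τ) (Icc 0 T) τ :=
    intervalIntegral.integral_hasDerivWithinAt_right
      (intervalIntegrable_of_integrableOn_Icc (hg.integrableOn_Icc) ⟨le_rfl, hT⟩ hτ)
      (hg.stronglyMeasurableAtFilter_nhdsWithin measurableSet_Icc τ) (hg τ hτ)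
  exact (h1.const_add x₀).congr heq (heq τ hτ)

end Analysis

/-! ### The uniform distances of trajectories. -/

section LInfinity

variable {F : Type*} [NormedAddCommGroup F] {T : ℝ}

theorem norm_le_supNorm {w : ℝ → F} (hw : ContinuousOn w (Icc 0 T)) {τ : ℝ} (hτ : τ ∈ Icc 0 T) :
    ‖w τ‖ ≤ supNorm T w := by
  obtain ⟨C, hC⟩ := isCompact_Icc.exists_bound_of_continuousOn hw
  exact le_ciSup (f := fun τ : Icc (0 : ℝ) T => ‖w τ‖)
    ⟨C, by rintro _ ⟨s, rfl⟩; exact hC s s.2⟩ ⟨τ, hτ⟩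

theorem supNorm_le {w : ℝ → F} (hT : 0 ≤ T) {C : ℝ} (h : ∀ τ ∈ Icc 0 T, ‖w τ‖ ≤ C) :
    supNorm T w ≤ C :=
  have : Nonempty (Icc (0 : ℝ) T) := ⟨⟨0, le_rfl, hT⟩⟩
  ciSup_le fun τ => h τ τ.2

theorem pairDist_nonneg (x lam x' lam' : ℝ → F) : 0 ≤ pairDist T x lam x' lam' :=
  Real.iSup_nonneg fun _ => Real.sqrt_nonneg _

theorem pairDist_comm (x lam x' lam' : ℝ → F) :
    pairDist T x lam x' lam' = pairDist T x' lam' x lam := by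
  simp only [pairDist, norm_sub_rev]

theorem sqrt_le_pairDist {x lam x' lam' : ℝ → F} (hx : ContinuousOn x (Icc 0 T))
    (hlam : ContinuousOn lam (Icc 0 T)) (hx' : ContinuousOn x' (Icc 0 T))
    (hlam' : ContinuousOn lam' (Icc 0 T)) {τ : ℝ} (hτ : τ ∈ Icc 0 T) :
    Real.sqrt (‖x τ - x' τ‖ ^ 2 + ‖lam τ - lam' τ‖ ^ 2) ≤ pairDist T x lam x' lam' := by
  have hc : ContinuousOn (fun τ => Real.sqrt (‖x τ - x' τ‖ ^ 2 + ‖lam τ - lam' τ‖ ^ 2))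
      (Icc 0 T) := (((hx.sub hx').norm.pow 2).add ((hlam.sub hlam').norm.pow 2)).sqrt
  obtain ⟨C, hC⟩ := isCompact_Icc.exists_bound_of_continuousOn hc
  exact le_ciSup (f := fun τ : Icc (0 : ℝ) T =>
      Real.sqrt (‖x τ - x' τ‖ ^ 2 + ‖lam τ - lam' τ‖ ^ 2))
    ⟨C, by rintro _ ⟨s, rfl⟩; exact (le_abs_self _).trans (hC s s.2)⟩ ⟨τ, hτ⟩

theorem norm_left_le_pairDist {x lam x' lam' : ℝ → F} (hx : ContinuousOn x (Icc 0 T))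
    (hlam : ContinuousOn lam (Icc 0 T)) (hx' : ContinuousOn x' (Icc 0 T))
    (hlam' : ContinuousOn lam' (Icc 0 T)) {τ : ℝ} (hτ : τ ∈ Icc 0 T) :
    ‖x τ - x' τ‖ ≤ pairDist T x lam x' lam' :=
  (Real.le_sqrt_of_sq_le (by nlinarith [sq_nonneg ‖lam τ - lam' τ‖])).trans
    (sqrt_le_pairDist hx hlam hx' hlam' hτ)

theorem norm_right_le_pairDist {x lam x' lam' : ℝ → F} (hx : ContinuousOn x (Icc 0 T))
    (hlam : ContinuousOn lam (Icc 0 T)) (hx' : ContinuousOn x' (Icc 0 T))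
    (hlam' : ContinuousOn lam' (Icc 0 T)) {τ : ℝ} (hτ : τ ∈ Icc 0 T) :
    ‖lam τ - lam' τ‖ ≤ pairDist T x lam x' lam' :=
  (Real.le_sqrt_of_sq_le (by nlinarith [sq_nonneg ‖x τ - x' τ‖])).trans
    (sqrt_le_pairDist hx hlam hx' hlam' hτ)

theorem pairDist_le {x lam x' lam' : ℝ → F} (hT : 0 ≤ T) {A B : ℝ}
    (hA : ∀ τ ∈ Icc 0 T, ‖x τ - x' τ‖ ≤ A) (hB : ∀ τ ∈ Icc 0 T, ‖lam τ - lam' τ‖ ≤ B) :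
    pairDist T x lam x' lam' ≤ A + B := by
  have : Nonempty (Icc (0 : ℝ) T) := ⟨⟨0, le_rfl, hT⟩⟩
  refine ciSup_le fun τ => ?_
  have h1 := hA τ τ.2
  have h2 := hB τ τ.2
  have h3 := norm_nonneg (x τ - x' τ)
  have h4 := norm_nonneg (lam τ - lam' τ)
  exact Real.sqrt_le_iff.2 ⟨by linarith, by nlinarith⟩

theorem pairDist_triangle {x lam x' lam' x'' lam'' : ℝ → F} (hT : 0 ≤ T)
    (hx : ContinuousOn x (Icc 0 T)) (hlam : ContinuousOn lam (Icc 0 T))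
    (hx' : ContinuousOn x' (Icc 0 T)) (hlam' : ContinuousOn lam' (Icc 0 T))
    (hx'' : ContinuousOn x'' (Icc 0 T)) (hlam'' : ContinuousOn lam'' (Icc 0 T)) :
    pairDist T x lam x'' lam'' ≤ pairDist T x lam x' lam' + pairDist T x' lam' x'' lam'' := by
  have : Nonempty (Icc (0 : ℝ) T) := ⟨⟨0, le_rfl, hT⟩⟩
  refine ciSup_le fun τ => ?_
  have h1 := sqrt_le_pairDist hx hlam hx' hlam' τ.2
  have h2 := sqrt_le_pairDist hx' hlam' hx'' hlam'' τ.2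
  refine le_trans ?_ (add_le_add h1 h2)
  have key : ∀ a b c d : ℝ, Real.sqrt ((a + b) ^ 2 + (c + d) ^ 2) ≤
      Real.sqrt (a ^ 2 + c ^ 2) + Real.sqrt (b ^ 2 + d ^ 2) := by
    intro a b c d
    have e1 := Real.sq_sqrt (show 0 ≤ a ^ 2 + c ^ 2 by positivity)
    have e2 := Real.sq_sqrt (show 0 ≤ b ^ 2 + d ^ 2 by positivity)
    have p1 := Real.sqrt_nonneg (a ^ 2 + c ^ 2)
    have p2 := Real.sqrt_nonneg (b ^ 2 + d ^ 2)
    have h3 : a * b + c * d ≤ Real.sqrt (a ^ 2 + c ^ 2) * Real.sqrt (b ^ 2 + d ^ 2) := by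
      rw [← Real.sqrt_mul (by positivity)]
      exact Real.le_sqrt_of_sq_le (by nlinarith [sq_nonneg (a * d - b * c)])
    exact Real.sqrt_le_iff.2 ⟨by positivity, by nlinarith⟩
  refine le_trans (Real.sqrt_le_sqrt ?_) (key _ _ _ _)
  gcongr <;> exact norm_sub_le_norm_sub_add_norm_sub _ _ _

end LInfinity

/-! ### Gradients and integration by parts. -/

section Gradient

variable {Y : Type*} [NormedAddCommGroup Y] [InnerProductSpace ℝ Y] [CompleteSpace Y]

theorem contDiff_gradient_comp {A : Type*} [NormedAddCommGroup A] [NormedSpace ℝ A]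
    {Φ : A → Y → ℝ} (hΦ : ContDiff ℝ 2 (fun z : A × Y => Φ z.1 z.2)) {g : A → Y}
    (hg : ContDiff ℝ 1 g) : ContDiff ℝ 1 (fun a => gradient (Φ a) (g a)) := by
  have h1 : ContDiff ℝ 1 (fun a => fderiv ℝ (Φ a) (g a)) :=
    ContDiff.fderiv (f := Φ) (m := 2) (n := 1) hΦ hg (by norm_num)
  exact (InnerProductSpace.toDual ℝ Y).symm.contDiff.comp h1

theorem inner_gradient {f : Y → ℝ} {x : Y} (v : Y) :
    inner ℝ (gradient f x) v = fderiv ℝ f x v := by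
  simp [gradient]

theorem norm_gradient_sub (f g : Y → ℝ) (x y : Y) :
    ‖fderiv ℝ f x - fderiv ℝ g y‖ = ‖gradient f x - gradient g y‖ := by
  simp only [gradient, ← map_sub, LinearIsometryEquiv.norm_map]

/-- Integration by parts for primitives of functions that are continuous off a countable set. -/
theorem inner_sub_inner_eq_integral {Y : Type*} [NormedAddCommGroup Y] [InnerProductSpace ℝ Y] {T : ℝ} (hT : 0 ≤ T) {s : Set ℝ} (hs : s.Countable)
    {x y g h : ℝ → Y} (hx : ContinuousOn x (Icc 0 T)) (hy : ContinuousOn y (Icc 0 T))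
    (hx' : ∀ τ ∈ Ioo 0 T \ s, HasDerivAt x (g τ) τ) (hy' : ∀ τ ∈ Ioo 0 T \ s, HasDerivAt y (h τ) τ)
    (hg : IntegrableOn g (Icc 0 T)) (hh : IntegrableOn h (Icc 0 T)) :
    inner ℝ (x T) (y T) - inner ℝ (x 0) (y 0) =
      ∫ τ in (0 : ℝ)..T, (inner ℝ (x τ) (h τ) + inner ℝ (g τ) (y τ)) := by
  symm
  have bdd : ∀ {z w : ℝ → Y}, ContinuousOn z (Icc 0 T) → IntegrableOn w (Icc 0 T) →
      IntegrableOn (fun τ => inner ℝ (z τ) (w τ)) (Icc 0 T) := by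
    intro z w hz hw
    obtain ⟨C, hC⟩ := isCompact_Icc.exists_bound_of_continuousOn hz
    refine Integrable.mono' (hw.norm.const_mul C)
      ((hz.aestronglyMeasurable measurableSet_Icc).inner hw.aestronglyMeasurable) ?_
    filter_upwards [ae_restrict_mem measurableSet_Icc] with τ hτ
    exact (norm_inner_le_norm _ _).trans (by gcongr; exact hC τ hτ)
  refine integral_eq_of_hasDerivAt_off_countable_of_le (fun τ => inner ℝ (x τ) (y τ)) _ hT hs
    (hx.inner hy) (fun τ hτ => (hx' τ hτ).inner ℝ (hy' τ hτ)) ?_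
  refine intervalIntegrable_of_integrableOn_Icc (T := T) ?_ ⟨le_rfl, hT⟩ ⟨hT, le_rfl⟩
  refine (bdd hx hh).add ?_
  simpa only [real_inner_comm] using bdd hy hg

end Gradient

/-! ### Smoothness of the network data and the structure of the Hamiltonian gradient. -/

namespace Network

variable {N : ℕ} {P : Network N}

section Smoothness

variable {A : Type*} [NormedAddCommGroup A] [NormedSpace ℝ A]

theorem contDiff_coord {k : Fin N → ℕ} {n : WithTop ℕ∞} {g : A → Vec k} (hg : ContDiff ℝ n g)
    (i : Fin N) : ContDiff ℝ n (fun a => g a i) :=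
  (PiLp.proj (𝕜 := ℝ) 2 (fun i => E (k i)) i).contDiff.comp hg

theorem Regular.contDiff_agentDyn (hP : P.Regular) (i : Fin N) {ξ : A → E (P.n i)}
    {v : A → E (P.m i)} {x : A → P.X} (hξ : ContDiff ℝ 2 ξ) (hv : ContDiff ℝ 2 v)
    (hx : ContDiff ℝ 2 x) : ContDiff ℝ 2 (fun a => P.agentDyn i (ξ a) (v a) (x a)) :=
  ((hP.f₀_smooth i).comp (hξ.prodMk hv)).add
    (ContDiff.sum fun j _ => (hP.fc_smooth i j).comp (hξ.prodMk (contDiff_coord hx j)))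

theorem Regular.contDiff_agentCost (hP : P.Regular) (i : Fin N) {ξ : A → E (P.n i)}
    {v : A → E (P.m i)} {x : A → P.X} (hξ : ContDiff ℝ 2 ξ) (hv : ContDiff ℝ 2 v)
    (hx : ContDiff ℝ 2 x) : ContDiff ℝ 2 (fun a => P.agentCost i (ξ a) (v a) (x a)) :=
  ((hP.l₀_smooth i).comp (hξ.prodMk hv)).add
    (ContDiff.sum fun j _ => (hP.lc_smooth i j).comp (hξ.prodMk (contDiff_coord hx j)))

theorem Regular.contDiff_dynHat (hP : P.Regular) {x x' : A → P.X} {u : A → P.C}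
    (hx : ContDiff ℝ 2 x) (hu : ContDiff ℝ 2 u) (hx' : ContDiff ℝ 2 x') :
    ContDiff ℝ 2 (fun a => P.dynHat (x a) (u a) (x' a)) :=
  (PiLp.contDiff_toLp).comp (contDiff_pi.2 fun i =>
    hP.contDiff_agentDyn i (contDiff_coord hx i) (contDiff_coord hu i) hx')

theorem Regular.contDiff_stageCost (hP : P.Regular) {x : A → P.X} {u : A → P.C}
    (hx : ContDiff ℝ 2 x) (hu : ContDiff ℝ 2 u) :
    ContDiff ℝ 2 (fun a => P.stageCost (x a) (u a)) :=
  ContDiff.sum fun i _ => hP.contDiff_agentCost i (contDiff_coord hx i) (contDiff_coord hu i) hx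

theorem Regular.contDiff_termCost (hP : P.Regular) : ContDiff ℝ 2 P.termCost :=
  ContDiff.sum fun i _ => (hP.V_smooth i).comp (contDiff_coord contDiff_id i)

theorem Regular.contDiff_ham (hP : P.Regular) {x lam : A → P.X} {u : A → P.C}
    (hx : ContDiff ℝ 2 x) (hu : ContDiff ℝ 2 u) (hlam : ContDiff ℝ 2 lam) :
    ContDiff ℝ 2 (fun a => P.ham (x a) (u a) (lam a)) :=
  (hP.contDiff_stageCost hx hu).add (hlam.inner ℝ (hP.contDiff_dynHat hx hu hx))

theorem Regular.contDiff_gradient_termCost (hP : P.Regular) :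
    ContDiff ℝ 1 (gradient P.termCost) :=
  contDiff_gradient_comp (Φ := fun _ : P.X => P.termCost)
    (hP.contDiff_termCost.comp contDiff_snd) contDiff_id

end Smoothness

section LocalGradient

/-- The part of the local Hamiltonian that does not depend on the sensitivities. -/
def hamOwn (P : Network N) (i : Fin N) (v : E (P.m i)) (μ : E (P.n i)) (x' : P.X)
    (ξ : E (P.n i)) : ℝ :=
  P.agentCost i ξ v x' + inner ℝ μ (P.agentDyn i ξ v x')

/-- The contribution of the edge from `j` to `i` to the central Hamiltonian. -/
def hamEdge (P : Network N) (i j : Fin N) (μ : E (P.n i)) (ξ : E (P.n i)) (η : E (P.n j)) : ℝ :=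
  P.lc i j ξ η + inner ℝ μ (P.fc i j ξ η)

theorem Regular.contDiff_hamOwn (hP : P.Regular) (i : Fin N) :
    ContDiff ℝ 2 (fun z : (P.C × P.X × P.X) × E (P.n i) =>
      P.hamOwn i (z.1.1 i) (z.1.2.1 i) z.1.2.2 z.2) := by
  have h1 : ContDiff ℝ 2 (fun z : (P.C × P.X × P.X) × E (P.n i) => z.1.1) := by fun_prop
  have h2 : ContDiff ℝ 2 (fun z : (P.C × P.X × P.X) × E (P.n i) => z.1.2.1) := by fun_prop
  have h3 : ContDiff ℝ 2 (fun z : (P.C × P.X × P.X) × E (P.n i) => z.1.2.2) := by fun_prop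
  exact (hP.contDiff_agentCost i contDiff_snd (contDiff_coord h1 i) h3).add
    ((contDiff_coord h2 i).inner ℝ
      (hP.contDiff_agentDyn i contDiff_snd (contDiff_coord h1 i) h3))

theorem Regular.contDiff_hamEdge (hP : P.Regular) (i j : Fin N) :
    ContDiff ℝ 2 (fun z : (E (P.n i) × E (P.n i)) × E (P.n j) =>
      P.hamEdge i j z.1.1 z.1.2 z.2) := by
  have h1 : ContDiff ℝ 2 (fun z : (E (P.n i) × E (P.n i)) × E (P.n j) => z.1.1) := by fun_prop
  have h2 : ContDiff ℝ 2 (fun z : (E (P.n i) × E (P.n i)) × E (P.n j) => z.1.2) := by fun_prop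
  exact ((hP.lc_smooth i j).comp (h2.prodMk contDiff_snd)).add
    (h1.inner ℝ ((hP.fc_smooth i j).comp (h2.prodMk contDiff_snd)))

theorem sens_eq (x' lam' : P.X) (i j : Fin N) :
    P.sens x' lam' i j = gradient (P.hamEdge j i (lam' j) (x' j)) (x' i) := rfl

theorem Regular.contDiff_hamOwn_right (hP : P.Regular) (i : Fin N) (u : P.C) (lam x' : P.X) :
    ContDiff ℝ 2 (P.hamOwn i (u i) (lam i) x') :=
  (hP.contDiff_hamOwn i).comp
    (g := fun z => P.hamOwn i (z.1.1 i) (z.1.2.1 i) z.1.2.2 z.2)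
    (contDiff_prodMk_right (𝕜 := ℝ) ((u, lam, x') : P.C × P.X × P.X))

/-- The sensitivity terms are affine in the own state, so they contribute constants and the shift by
`x' i` disappears. -/
theorem Regular.gradient_localHam (hP : P.Regular) (x' lam' : P.X) (i : Fin N) (u : P.C)
    (lam : P.X) (ξ : E (P.n i)) :
    gradient (fun ξ => P.localHam x' lam' i ξ (u i) (lam i)) ξ =
      gradient (P.hamOwn i (u i) (lam i) x') ξ + ∑ j ∈ P.receiving i, P.sens x' lam' i j := by
  refine ext_inner_right ℝ fun v => ?_
  rw [inner_add_left, inner_gradient, inner_gradient, sum_inner]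
  have h1 : HasFDerivAt (P.hamOwn i (u i) (lam i) x')
      (fderiv ℝ (P.hamOwn i (u i) (lam i) x') ξ) ξ :=
    ((hP.contDiff_hamOwn_right i u lam x').differentiable two_ne_zero ξ).hasFDerivAt
  have h2 : HasFDerivAt (fun ξ => ∑ j ∈ P.receiving i, inner ℝ (P.sens x' lam' i j) (ξ - x' i))
      (∑ j ∈ P.receiving i, innerSL ℝ (P.sens x' lam' i j)) ξ := by
    refine HasFDerivAt.fun_sum fun j _ => ?_
    exact (innerSL ℝ (P.sens x' lam' i j)).hasFDerivAt.comp ξ ((hasFDerivAt_id ξ).sub_const _)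
  have h3 := (h1.add h2).fderiv
  have h4 : (fun ξ => P.localHam x' lam' i ξ (u i) (lam i)) = (P.hamOwn i (u i) (lam i) x') +
    (fun ξ => ∑ j ∈ P.receiving i, inner ℝ (P.sens x' lam' i j) (ξ - x' i)) := rfl
  rw [h4, h3]
  simp

theorem Regular.contDiff_localGrad (hP : P.Regular) :
    ContDiff ℝ 1 (fun z : (P.X × P.X) × P.X × P.C × P.X =>
      P.localGrad z.1.1 z.1.2 z.2.1 z.2.2.1 z.2.2.2) := by
  refine (PiLp.contDiff_toLp).comp (contDiff_pi.2 fun i => ?_)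
  simp only [hP.gradient_localHam]
  have hz1 : ContDiff ℝ 2 (fun z : (P.X × P.X) × P.X × P.C × P.X => z.1.1) := by fun_prop
  have hz2 : ContDiff ℝ 2 (fun z : (P.X × P.X) × P.X × P.C × P.X => z.1.2) := by fun_prop
  have hz3 : ContDiff ℝ 2 (fun z : (P.X × P.X) × P.X × P.C × P.X => z.2.1) := by fun_prop
  refine ContDiff.add ?_ (ContDiff.sum fun j _ => ?_)
  · refine contDiff_gradient_comp (A := (P.X × P.X) × P.X × P.C × P.X)
      (Φ := fun z => P.hamOwn i (z.2.2.1 i) (z.2.2.2 i) z.1.1) ?_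
      ((contDiff_coord hz3 i).of_le one_le_two)
    have hg : ContDiff ℝ 2 (fun z : ((P.X × P.X) × P.X × P.C × P.X) × E (P.n i) =>
      (((z.1.2.2.1, z.1.2.2.2, z.1.1.1), z.2) : (P.C × P.X × P.X) × E (P.n i))) := by fun_prop
    exact (hP.contDiff_hamOwn i).comp hg
  · simp only [sens_eq]
    refine contDiff_gradient_comp (A := (P.X × P.X) × P.X × P.C × P.X)
      (Φ := fun z => P.hamEdge j i (z.1.2 j) (z.1.1 j)) ?_
      ((contDiff_coord hz1 i).of_le one_le_two)
    have hg : ContDiff ℝ 2 (fun z : ((P.X × P.X) × P.X × P.C × P.X) × E (P.n i) =>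
      (((z.1.1.2 j, z.1.1.1 j), z.2) : (E (P.n j) × E (P.n j)) × E (P.n i))) :=
      ((contDiff_coord (hz2.comp contDiff_fst) j).prodMk
        (contDiff_coord (hz1.comp contDiff_fst) j)).prodMk contDiff_snd
    exact (hP.contDiff_hamEdge j i).comp hg

theorem mem_sending_iff_mem_receiving (i j : Fin N) : j ∈ P.sending i ↔ i ∈ P.receiving j := by
  simp [sending, receiving, ne_comm]

/-- The stacked local gradient, with all previous iterates equal to the current ones, is the
gradient of the central Hamiltonian. -/
theorem Regular.gradient_ham (hP : P.Regular) (x : P.X) (u : P.C) (lam : P.X) :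
    gradient (fun ξ => P.ham ξ u lam) x = P.localGrad x lam x u lam := by
  refine ext_inner_right ℝ fun v => ?_
  rw [inner_gradient]
  have hcoord : ∀ i, HasFDerivAt (fun y : P.X => y i)
      (PiLp.proj (𝕜 := ℝ) 2 (fun i => E (P.n i)) i) x := fun i =>
    (PiLp.proj (𝕜 := ℝ) 2 (fun i => E (P.n i)) i).hasFDerivAt
  have hedge : ∀ i j, ContDiff ℝ 2 (fun z : E (P.n i) × E (P.n j) =>
      P.hamEdge i j (lam i) z.1 z.2) := fun i j => by
    have hg : ContDiff ℝ 2 (fun z : E (P.n i) × E (P.n j) =>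
      (((lam i, z.1), z.2) : (E (P.n i) × E (P.n i)) × E (P.n j))) := by fun_prop
    exact (hP.contDiff_hamEdge i j).comp hg
  set own : ∀ i, E (P.n i) → ℝ := fun i ξ => P.l₀ i ξ (u i) + inner ℝ (lam i) (P.f₀ i ξ (u i))
    with hown
  have hownC : ∀ i, Differentiable ℝ (own i) := fun i => by
    have hg : ContDiff ℝ 2 (fun ξ : E (P.n i) => ((ξ, u i) : E (P.n i) × E (P.m i))) := by fun_prop
    exact (((hP.l₀_smooth i).comp hg).add
      (contDiff_const.inner ℝ ((hP.f₀_smooth i).comp hg))).differentiable two_ne_zero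
  have hpart1 : ∀ i j, HasFDerivAt (fun ξ => P.hamEdge i j (lam i) ξ (x j))
      ((fderiv ℝ (fun z : E (P.n i) × E (P.n j) => P.hamEdge i j (lam i) z.1 z.2) (x i, x j)).comp
        (ContinuousLinearMap.inl ℝ _ _)) (x i) := fun i j =>
    HasFDerivAt.comp (𝕜 := ℝ) (E := E (P.n i)) (F := E (P.n i) × E (P.n j)) (x i)
      (g := fun z : E (P.n i) × E (P.n j) => P.hamEdge i j (lam i) z.1 z.2)
      (((hedge i j).differentiable two_ne_zero (x i, x j)).hasFDerivAt)
      (hasFDerivAt_prodMk_left (𝕜 := ℝ) (E := E (P.n i)) (F := E (P.n j)) (x i) (x j))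
  have hpart2 : ∀ i j, HasFDerivAt (fun η => P.hamEdge i j (lam i) (x i) η)
      ((fderiv ℝ (fun z : E (P.n i) × E (P.n j) => P.hamEdge i j (lam i) z.1 z.2) (x i, x j)).comp
        (ContinuousLinearMap.inr ℝ _ _)) (x j) := fun i j =>
    HasFDerivAt.comp (𝕜 := ℝ) (E := E (P.n j)) (F := E (P.n i) × E (P.n j)) (x j)
      (g := fun z : E (P.n i) × E (P.n j) => P.hamEdge i j (lam i) z.1 z.2)
      (((hedge i j).differentiable two_ne_zero (x i, x j)).hasFDerivAt)
      (hasFDerivAt_prodMk_right (𝕜 := ℝ) (E := E (P.n i)) (F := E (P.n j)) (x i) (x j))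
  -- Grouped by edges, each coupling term depends on two states. Its partial derivative in the
  -- receiver's state belongs to the receiver's own Hamiltonian, the one in the sender's state is
  -- the sensitivity communicated to the sender.
  have hham : (fun ξ => P.ham ξ u lam) = fun ξ : P.X => ∑ i, (own i (ξ i) +
      ∑ j ∈ P.sending i, P.hamEdge i j (lam i) (ξ i) (ξ j)) := by
    funext ξ
    simp only [ham, stageCost]
    rw [PiLp.inner_apply, ← Finset.sum_add_distrib]
    refine Finset.sum_congr rfl fun i _ => ?_
    simp only [agentCost, dyn, dynHat, agentDyn, hamEdge, hown, inner_add_right, inner_sum,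
      Finset.sum_add_distrib]
    ring
  have hder : HasFDerivAt (fun ξ => P.ham ξ u lam)
      (∑ i, ((fderiv ℝ (own i) (x i)).comp (PiLp.proj (𝕜 := ℝ) 2 (fun i => E (P.n i)) i) +
        ∑ j ∈ P.sending i,
          (fderiv ℝ (fun z : E (P.n i) × E (P.n j) => P.hamEdge i j (lam i) z.1 z.2)
            (x i, x j)).comp ((PiLp.proj (𝕜 := ℝ) 2 (fun i => E (P.n i)) i).prod
              (PiLp.proj (𝕜 := ℝ) 2 (fun i => E (P.n i)) j)))) x := by
    rw [hham]
    refine HasFDerivAt.fun_sum fun i _ => HasFDerivAt.add ?_ (HasFDerivAt.fun_sum fun j _ => ?_)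
    · exact (hownC i (x i)).hasFDerivAt.comp x (hcoord i)
    · exact (((hedge i j).differentiable two_ne_zero (x i, x j)).hasFDerivAt).comp x
        ((hcoord i).prodMk (hcoord j))
  have hO : ∀ i, fderiv ℝ (P.hamOwn i (u i) (lam i) x) (x i) = fderiv ℝ (own i) (x i) +
      ∑ j ∈ P.sending i, (fderiv ℝ (fun z : E (P.n i) × E (P.n j) =>
        P.hamEdge i j (lam i) z.1 z.2) (x i, x j)).comp (ContinuousLinearMap.inl ℝ _ _) := by
    intro i
    have : P.hamOwn i (u i) (lam i) x = fun ξ => own i ξ +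
        ∑ j ∈ P.sending i, P.hamEdge i j (lam i) ξ (x j) := by
      funext ξ
      simp only [hamOwn, agentCost, agentDyn, hamEdge, hown, inner_add_right, inner_sum,
        Finset.sum_add_distrib]
      ring
    rw [this]
    exact ((hownC i (x i)).hasFDerivAt.add (HasFDerivAt.fun_sum fun j _ => hpart1 i j)).fderiv
  have hS : ∀ i j, fderiv ℝ (P.hamEdge i j (lam i) (x i)) (x j) =
      (fderiv ℝ (fun z : E (P.n i) × E (P.n j) => P.hamEdge i j (lam i) z.1 z.2) (x i, x j)).comp
        (ContinuousLinearMap.inr ℝ _ _) := fun i j => (hpart2 i j).fderiv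
  rw [hder.fderiv, PiLp.inner_apply]
  simp only [localGrad, hP.gradient_localHam, inner_add_left, inner_gradient, sum_inner, sens_eq,
    hO, hS]
  simp only [sum_apply, add_apply,
    ContinuousLinearMap.comp_apply, ContinuousLinearMap.prod_apply, PiLp.proj_apply,
    ContinuousLinearMap.inl_apply, ContinuousLinearMap.inr_apply, Finset.sum_add_distrib, add_assoc]
  congr 1
  have hsplit : ∀ i j, (fderiv ℝ (fun z : E (P.n i) × E (P.n j) =>
      P.hamEdge i j (lam i) z.1 z.2) (x i, x j)) (v i, v j) =
      (fderiv ℝ (fun z : E (P.n i) × E (P.n j) =>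
      P.hamEdge i j (lam i) z.1 z.2) (x i, x j)) (v i, 0) + (fderiv ℝ (fun z : E (P.n i) × E (P.n j)
      => P.hamEdge i j (lam i) z.1 z.2) (x i, x j)) (0, v j) := by
    intro i j
    rw [← map_add]; simp
  simp only [hsplit, Finset.sum_add_distrib]
  congr 1
  -- The sender partials, summed over the receiver `i` and its sending neighbors `j`, are resummed
  -- over the sender and its receiving neighbors.
  refine Finset.sum_comm' fun i j => ?_
  simpa using mem_sending_iff_mem_receiving i j

end LocalGradient

end Network

/-! ### Perturbation of integral equations on short horizons. -/

section Perturbation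

variable {F : Type*} [NormedAddCommGroup F] [NormedSpace ℝ F]

theorem eq_add_integral_sub {T : ℝ} {x g : ℝ → F} {x₀ : F} (hg : IntegrableOn g (Icc 0 T))
    (hx : ∀ τ ∈ Icc 0 T, x τ = x₀ + ∫ s in (0 : ℝ)..τ, g s) {a b : ℝ} (ha : a ∈ Icc 0 T)
    (hb : b ∈ Icc 0 T) : x b = x a + ∫ s in a..b, g s := by
  have h0 : (0 : ℝ) ∈ Icc 0 T := ⟨le_rfl, ha.1.trans ha.2⟩
  rw [hx b hb, hx a ha, add_assoc, intervalIntegral.integral_add_adjacent_intervals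
    (intervalIntegrable_of_integrableOn_Icc hg h0 ha)
    (intervalIntegrable_of_integrableOn_Icc hg ha hb)]

/-- Since `k * T ≤ 1 / 2`, the feedback term absorbs at most half of the maximal difference, which
explains the factor `2`. The perturbation `φ` is kept as a function so that it can be concentrated
on a short interval. -/
theorem norm_sub_le_of_eq_integral {T k : ℝ} {x y g h : ℝ → F} {φ : ℝ → ℝ} {x₀ y₀ : F}
    (hT : 0 ≤ T) (hk : 0 ≤ k) (hkT : k * T ≤ 1 / 2)
    (hxc : ContinuousOn x (Icc 0 T)) (hyc : ContinuousOn y (Icc 0 T))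
    (hx : ∀ τ ∈ Icc 0 T, x τ = x₀ + ∫ s in (0 : ℝ)..τ, g s)
    (hy : ∀ τ ∈ Icc 0 T, y τ = y₀ + ∫ s in (0 : ℝ)..τ, h s)
    (hg : IntegrableOn g (Icc 0 T)) (hh : IntegrableOn h (Icc 0 T))
    (hφ : IntegrableOn φ (Icc 0 T)) (hφ0 : ∀ s, 0 ≤ φ s)
    (hgh : ∀ᵐ s ∂(volume.restrict (Icc 0 T)), ‖g s - h s‖ ≤ φ s + k * ‖x s - y s‖) :
    ∀ τ ∈ Icc 0 T, ‖x τ - y τ‖ ≤ 2 * (‖x₀ - y₀‖ + ∫ s in (0 : ℝ)..T, φ s) := by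
  have h0 : (0 : ℝ) ∈ Icc 0 T := ⟨le_rfl, hT⟩
  refine norm_le_of_forall_bound (hxc.sub hyc) fun M hM hMb τ hτ => ?_
  have e : x τ - y τ = (x₀ - y₀) + ∫ s in (0 : ℝ)..τ, (g s - h s) := by
    rw [hx τ hτ, hy τ hτ, intervalIntegral.integral_sub
      (intervalIntegrable_of_integrableOn_Icc hg h0 hτ)
      (intervalIntegrable_of_integrableOn_Icc hh h0 hτ)]
    abel
  have hφi := intervalIntegrable_of_integrableOn_Icc hφ h0 hτ
  have h1 : ‖∫ s in (0 : ℝ)..τ, (g s - h s)‖ ≤ ∫ s in (0 : ℝ)..τ, (φ s + k * M) := by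
    refine intervalIntegral.norm_integral_le_of_norm_le hτ.1 ?_
      (hφi.add intervalIntegrable_const)
    rw [ae_restrict_iff' measurableSet_Icc] at hgh
    filter_upwards [hgh] with s hs hsI
    have hs' : s ∈ Icc 0 T := ⟨hsI.1.le, hsI.2.trans hτ.2⟩
    exact (hs hs').trans (by gcongr; exact hMb s hs')
  rw [intervalIntegral.integral_add hφi intervalIntegrable_const,
    intervalIntegral.integral_const, smul_eq_mul, sub_zero] at h1
  have h2 : ∫ s in (0 : ℝ)..τ, φ s ≤ ∫ s in (0 : ℝ)..T, φ s :=
    intervalIntegral.integral_mono_interval le_rfl hτ.1 hτ.2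
      (Filter.Eventually.of_forall hφ0)
      (intervalIntegrable_of_integrableOn_Icc hφ h0 ⟨hT, le_rfl⟩)
  have h3 : τ * (k * M) ≤ M / 2 := by
    have : τ * (k * M) ≤ T * (k * M) := by gcongr; exact hτ.2
    nlinarith
  rw [e]
  exact (norm_add_le _ _).trans (by linarith)

theorem norm_sub_le_of_eq_integral_backward {T k : ℝ} {x y g h : ℝ → F} {φ : ℝ → ℝ} {xT yT : F}
    (hT : 0 ≤ T) (hk : 0 ≤ k) (hkT : k * T ≤ 1 / 2)
    (hxc : ContinuousOn x (Icc 0 T)) (hyc : ContinuousOn y (Icc 0 T))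
    (hx : ∀ τ ∈ Icc 0 T, x τ = xT + ∫ s in τ..T, g s)
    (hy : ∀ τ ∈ Icc 0 T, y τ = yT + ∫ s in τ..T, h s)
    (hg : IntegrableOn g (Icc 0 T)) (hh : IntegrableOn h (Icc 0 T))
    (hφ : IntegrableOn φ (Icc 0 T)) (hφ0 : ∀ s, 0 ≤ φ s)
    (hgh : ∀ᵐ s ∂(volume.restrict (Icc 0 T)), ‖g s - h s‖ ≤ φ s + k * ‖x s - y s‖) :
    ∀ τ ∈ Icc 0 T, ‖x τ - y τ‖ ≤ 2 * (‖xT - yT‖ + ∫ s in (0 : ℝ)..T, φ s) := by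
  intro τ hτ
  have hmem : ∀ s ∈ Icc 0 T, T - s ∈ Icc 0 T := fun s hs => ⟨by linarith [hs.2], by linarith [hs.1]⟩
  have hpre : (fun s => T - s) ⁻¹' Icc 0 T = Icc 0 T := by simp
  have hmp : MeasurePreserving (fun s : ℝ => T - s) (volume.restrict (Icc 0 T))
      (volume.restrict (Icc 0 T)) := by
    have := (Measure.measurePreserving_sub_left (volume : Measure ℝ) T).restrict_preimage
      (s := Icc 0 T) measurableSet_Icc
    rwa [hpre] at this
  have hemb : MeasurableEmbedding (fun s : ℝ => T - s) :=
    (MeasurableEquiv.subLeft T).measurableEmbedding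
  have := norm_sub_le_of_eq_integral (T := T) (k := k) (x := fun s => x (T - s))
    (y := fun s => y (T - s)) (g := fun s => g (T - s)) (h := fun s => h (T - s))
    (φ := fun s => φ (T - s)) (x₀ := xT) (y₀ := yT) hT hk hkT
    (hxc.comp (by fun_prop) hmem) (hyc.comp (by fun_prop) hmem)
    (fun s hs => by
      rw [intervalIntegral.integral_comp_sub_left (fun s => g s) T, hx _ (hmem s hs), sub_zero])
    (fun s hs => by
      rw [intervalIntegral.integral_comp_sub_left (fun s => h s) T, hy _ (hmem s hs), sub_zero])
    ((hmp.integrable_comp_emb hemb).2 hg) ((hmp.integrable_comp_emb hemb).2 hh)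
    ((hmp.integrable_comp_emb hemb).2 hφ) (fun s => hφ0 _) (hmp.quasiMeasurePreserving.ae hgh)
    (T - τ) (hmem τ hτ)
  simpa using this

end Perturbation

/-! ### Uniform constants and trajectories on short horizons. -/

namespace Network

variable {N : ℕ} {P : Network N}

/-- The product of the control constraint sets. -/
def ctrl (P : Network N) : Set P.C := {u | ∀ i, u i ∈ P.U i}

theorem Regular.isCompact_ctrl (hP : P.Regular) : IsCompact P.ctrl := by
  have h := (isCompact_univ_pi hP.U_compact).image (PiLp.continuous_toLp 2 (fun i => E (P.m i)))
  convert h using 1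
  ext u
  constructor
  · intro hu
    exact ⟨WithLp.ofLp u, fun i _ => hu i, rfl⟩
  · rintro ⟨v, hv, rfl⟩ i
    exact hv i (mem_univ i)

theorem Regular.convex_ctrl (hP : P.Regular) : Convex ℝ P.ctrl :=
  fun _ hu _ hv _ _ ha hb hab i => hP.U_convex i (hu i) (hv i) ha hb hab

theorem Regular.zero_mem_ctrl (hP : P.Regular) : (0 : P.C) ∈ P.ctrl :=
  fun i => interior_subset (hP.U_zero i)

/-- Uniform bounds and Lipschitz constants of the network on states of norm at most `R` and
adjoint states of norm at most `Q`. -/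
structure Bounds (P : Network N) (R Q C : ℝ) : Prop where
  pos : 0 < C
  dyn_le : ∀ x u x', ‖x‖ ≤ R → u ∈ P.ctrl → ‖x'‖ ≤ R → ‖P.dynHat x u x'‖ ≤ C
  dyn_lip : ∀ x u x' y v y', ‖x‖ ≤ R → u ∈ P.ctrl → ‖x'‖ ≤ R → ‖y‖ ≤ R → v ∈ P.ctrl →
    ‖y'‖ ≤ R → ‖P.dynHat x u x' - P.dynHat y v y'‖ ≤ C * (‖x - y‖ + ‖u - v‖ + ‖x' - y'‖)
  grad_le : ∀ x' lam' x u lam, ‖x'‖ ≤ R → ‖lam'‖ ≤ Q → ‖x‖ ≤ R → u ∈ P.ctrl → ‖lam‖ ≤ Q →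
    ‖P.localGrad x' lam' x u lam‖ ≤ C
  grad_lip : ∀ x' lam' x u lam y' mu' y v mu, ‖x'‖ ≤ R → ‖lam'‖ ≤ Q → ‖x‖ ≤ R → u ∈ P.ctrl →
    ‖lam‖ ≤ Q → ‖y'‖ ≤ R → ‖mu'‖ ≤ Q → ‖y‖ ≤ R → v ∈ P.ctrl → ‖mu‖ ≤ Q →
    ‖P.localGrad x' lam' x u lam - P.localGrad y' mu' y v mu‖ ≤
      C * (‖x' - y'‖ + ‖lam' - mu'‖ + ‖x - y‖ + ‖u - v‖ + ‖lam - mu‖)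
  ham_lip : ∀ x u lam y, ‖x‖ ≤ R → u ∈ P.ctrl → ‖lam‖ ≤ Q → ‖y‖ ≤ R →
    |P.ham x u lam - P.ham y u lam| ≤ C * ‖x - y‖
  term_lip : ∀ x y, ‖x‖ ≤ R → ‖y‖ ≤ R →
    ‖gradient P.termCost x - gradient P.termCost y‖ ≤ C * ‖x - y‖
  decay_lip : ∀ x u y, ‖x‖ ≤ R → u ∈ P.ctrl → ‖y‖ ≤ R →
    |(inner ℝ (gradient P.termCost x) (P.dyn x u) + P.stageCost x u) -
      (inner ℝ (gradient P.termCost y) (P.dyn y u) + P.stageCost y u)| ≤ C * ‖x - y‖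

/-- The maps involved are at least `C¹`, also those containing a gradient of `C²` data, and the
domains are products of balls and the control set, hence compact and convex. One sum dominates all
constants. -/
theorem Regular.exists_bounds (hP : P.Regular) (R Q : ℝ) : ∃ C, P.Bounds R Q C := by
  have hX : ∀ r, IsCompact (Metric.closedBall (0 : P.X) r) := fun r => isCompact_closedBall _ _
  have vX : ∀ r, Convex ℝ (Metric.closedBall (0 : P.X) r) := fun r => convex_closedBall _ _
  have cU := hP.isCompact_ctrl
  have vU := hP.convex_ctrl
  have d1 : ContDiff ℝ 1 (fun z : P.X × P.C × P.X => P.dynHat z.1 z.2.1 z.2.2) :=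
    (hP.contDiff_dynHat contDiff_fst (contDiff_fst.comp contDiff_snd)
      (contDiff_snd.comp contDiff_snd)).of_le one_le_two
  have d2 := hP.contDiff_localGrad
  have d3 : ContDiff ℝ 1 (fun z : P.X × P.C × P.X => P.ham z.1 z.2.1 z.2.2) :=
    (hP.contDiff_ham contDiff_fst (contDiff_fst.comp contDiff_snd)
      (contDiff_snd.comp contDiff_snd)).of_le one_le_two
  have d4 := hP.contDiff_gradient_termCost
  have d5 : ContDiff ℝ 1 (fun z : P.X × P.C =>
      inner ℝ (gradient P.termCost z.1) (P.dyn z.1 z.2) + P.stageCost z.1 z.2) :=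
    ((d4.comp contDiff_fst).inner ℝ ((hP.contDiff_dynHat contDiff_fst contDiff_snd
      contDiff_fst).of_le one_le_two)).add
      ((hP.contDiff_stageCost contDiff_fst contDiff_snd).of_le one_le_two)
  have k1 := (hX R).prod (cU.prod (hX R))
  have k2 := ((hX R).prod (hX Q)).prod ((hX R).prod (cU.prod (hX Q)))
  have k3 := (hX R).prod (cU.prod (hX Q))
  have k5 := (hX R).prod cU
  obtain ⟨C1, hC1⟩ := k1.exists_bound_of_continuousOn d1.continuous.continuousOn
  obtain ⟨C2, hC2⟩ := k2.exists_bound_of_continuousOn d2.continuous.continuousOn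
  obtain ⟨L1, hL1, h1⟩ := exists_lipschitz_of_contDiff d1 k1 ((vX R).prod (vU.prod (vX R)))
  obtain ⟨L2, hL2, h2⟩ := exists_lipschitz_of_contDiff d2 k2
    (((vX R).prod (vX Q)).prod ((vX R).prod (vU.prod (vX Q))))
  obtain ⟨L3, hL3, h3⟩ := exists_lipschitz_of_contDiff d3 k3 ((vX R).prod (vU.prod (vX Q)))
  obtain ⟨L4, hL4, h4⟩ := exists_lipschitz_of_contDiff d4 (hX R) (vX R)
  obtain ⟨L5, hL5, h5⟩ := exists_lipschitz_of_contDiff d5 k5 ((vX R).prod vU)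
  have mb : ∀ {r : ℝ} {x : P.X}, ‖x‖ ≤ r → x ∈ Metric.closedBall (0 : P.X) r :=
    fun h => mem_closedBall_zero_iff.2 h
  set C := 1 + |C1| + |C2| + L1 + L2 + L3 + L4 + L5 with hC
  have a1 := abs_nonneg C1
  have a2 := abs_nonneg C2
  have b1 := le_abs_self C1
  have b2 := le_abs_self C2
  have n3 : ∀ {A B D : Type _} [NormedAddCommGroup A] [NormedAddCommGroup B]
      [NormedAddCommGroup D] (a : A) (b : B) (d : D), ‖(a, b, d)‖ ≤ ‖a‖ + ‖b‖ + ‖d‖ := by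
    intro A B D _ _ _ a b d
    have := norm_nonneg a
    have := norm_nonneg b
    have := norm_nonneg d
    simp only [Prod.norm_mk]
    exact max_le (by linarith) (max_le (by linarith) (by linarith))
  have n2 : ∀ {A B : Type _} [NormedAddCommGroup A] [NormedAddCommGroup B]
      (a : A) (b : B), ‖(a, b)‖ ≤ ‖a‖ + ‖b‖ := by
    intro A B _ _ a b
    have := norm_nonneg a
    have := norm_nonneg b
    simp only [Prod.norm_mk]
    exact max_le (by linarith) (by linarith)
  refine ⟨C, by positivity, ?_, ?_, ?_, ?_, ?_, ?_, ?_⟩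
  · intro x u x' hx hu hx'
    exact (hC1 (x, u, x') ⟨mb hx, hu, mb hx'⟩).trans (by linarith)
  · intro x u x' y v y' hx hu hx' hy hv hy'
    refine (h1 (x, u, x') ⟨mb hx, hu, mb hx'⟩ (y, v, y') ⟨mb hy, hv, mb hy'⟩).trans ?_
    refine mul_le_mul (by linarith) ?_ (norm_nonneg _) (by positivity)
    exact n3 (x - y) (u - v) (x' - y')
  · intro x' lam' x u lam hx' hlam' hx hu hlam
    exact (hC2 ((x', lam'), x, u, lam) ⟨⟨mb hx', mb hlam'⟩, mb hx, hu, mb hlam⟩).trans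
      (by linarith)
  · intro x' lam' x u lam y' mu' y v mu hx' hlam' hx hu hlam hy' hmu' hy hv hmu
    refine (h2 ((x', lam'), x, u, lam) ⟨⟨mb hx', mb hlam'⟩, mb hx, hu, mb hlam⟩
      ((y', mu'), y, v, mu) ⟨⟨mb hy', mb hmu'⟩, mb hy, hv, mb hmu⟩).trans ?_
    refine mul_le_mul (by linarith) ?_ (norm_nonneg _) (by positivity)
    have e1 := n2 (x' - y', lam' - mu') (x - y, u - v, lam - mu)
    have e2 := n2 (x' - y') (lam' - mu')
    have e3 := n3 (x - y) (u - v) (lam - mu)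
    simp only [Prod.mk_sub_mk]
    linarith
  · intro x u lam y hx hu hlam hy
    refine (h3 (x, u, lam) ⟨mb hx, hu, mb hlam⟩ (y, u, lam) ⟨mb hy, hu, mb hlam⟩).trans ?_
    refine mul_le_mul (by linarith) ?_ (norm_nonneg _) (by positivity)
    simp
  · intro x y hx hy
    refine (h4 x (mb hx) y (mb hy)).trans ?_
    gcongr
    linarith
  · intro x u y hx hu hy
    refine (h5 (x, u) ⟨mb hx, hu⟩ (y, u) ⟨mb hy, hu⟩).trans ?_
    refine mul_le_mul (by linarith) ?_ (norm_nonneg _) (by positivity)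
    simp

/-- A horizon `T` that is short compared with the bounds of the network, for initial states of
norm at most `R₁`. -/
structure ShortHorizon (P : Network N) (T ρ L R₁ R Q C : ℝ) : Prop where
  bounds : P.Bounds R Q C
  T_pos : 0 < T
  ρ_pos : 0 < ρ
  L_pos : 0 < L
  radius : R₁ + ρ ≤ R
  lt_ρ : C * T < ρ
  small : C * T * (1 + L) * (24 + 16 * C) ≤ 1
  adjoint : ∀ x, ‖x‖ ≤ R → ‖gradient P.termCost x‖ + ρ ≤ Q

section Trajectories

variable {T ρ L R₁ R Q C : ℝ}

theorem ShortHorizon.le_one (h : P.ShortHorizon T ρ L R₁ R Q C) : 24 * (C * T * (1 + L)) ≤ 1 := by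
  have := h.small
  have hC := h.bounds.pos
  have hT := h.T_pos
  have hL := h.L_pos
  have : 0 ≤ C * T * (1 + L) * (16 * C) := by positivity
  nlinarith

theorem ShortHorizon.CT_le (h : P.ShortHorizon T ρ L R₁ R Q C) : 24 * (C * T) ≤ 1 := by
  have := h.le_one
  have hC := h.bounds.pos
  have hT := h.T_pos
  have hL := h.L_pos
  have : 0 ≤ C * T * L := by positivity
  nlinarith

theorem Regular.integrableOn_comp (hP : P.Regular) {W F : Type*} [PseudoMetricSpace W]
    [NormedAddCommGroup F] {G : W → P.C → F}
    (hG : Continuous (fun z : W × P.C => G z.1 z.2)) {w : ℝ → W} {u : ℝ → P.C}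
    (hw : ContinuousOn w (Icc 0 T)) (hu : P.Admissible T u) :
    IntegrableOn (fun s => G (w s) (u s)) (Icc 0 T) :=
  integrableOn_comp_of_mem_compact (G := fun z : W × P.C => G z.1 z.2) hG
    ((isCompact_Icc.image_of_continuousOn hw).prod hP.isCompact_ctrl)
    ((hw.aestronglyMeasurable_of_isCompact isCompact_Icc measurableSet_Icc).prodMk hu.1)
    fun τ hτ => ⟨mem_image_of_mem _ hτ, fun i => hu.2 τ hτ i⟩

theorem Regular.continuous_dynHat (hP : P.Regular) :
    Continuous (fun z : (P.X × P.X) × P.C => P.dynHat z.1.1 z.2 z.1.2) :=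
  (hP.contDiff_dynHat (contDiff_fst.comp contDiff_fst) contDiff_snd
    (contDiff_snd.comp contDiff_fst)).continuous

theorem Regular.continuous_stageCost (hP : P.Regular) :
    Continuous (fun z : P.X × P.C => P.stageCost z.1 z.2) :=
  (hP.contDiff_stageCost contDiff_fst contDiff_snd).continuous

theorem Regular.integrableOn_dynHat (hP : P.Regular) {x x' : ℝ → P.X} {u : ℝ → P.C}
    (hx : ContinuousOn x (Icc 0 T)) (hu : P.Admissible T u) (hx' : ContinuousOn x' (Icc 0 T)) :
    IntegrableOn (fun s => P.dynHat (x s) (u s) (x' s)) (Icc 0 T) :=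
  hP.integrableOn_comp (G := fun (w : P.X × P.X) u => P.dynHat w.1 u w.2)
    hP.continuous_dynHat (hx.prodMk hx') hu

theorem Regular.integrableOn_dyn (hP : P.Regular) {x : ℝ → P.X} {u : ℝ → P.C}
    (hx : ContinuousOn x (Icc 0 T)) (hu : P.Admissible T u) :
    IntegrableOn (fun s => P.dyn (x s) (u s)) (Icc 0 T) :=
  hP.integrableOn_dynHat hx hu hx

theorem Regular.integrableOn_stageCost (hP : P.Regular) {x : ℝ → P.X} {u : ℝ → P.C}
    (hx : ContinuousOn x (Icc 0 T)) (hu : P.Admissible T u) :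
    IntegrableOn (fun s => P.stageCost (x s) (u s)) (Icc 0 T) :=
  hP.integrableOn_comp hP.continuous_stageCost hx hu

theorem Regular.integrableOn_localGrad (hP : P.Regular) {x' lam' x lam : ℝ → P.X} {u : ℝ → P.C}
    (hx' : ContinuousOn x' (Icc 0 T)) (hlam' : ContinuousOn lam' (Icc 0 T))
    (hx : ContinuousOn x (Icc 0 T)) (hu : P.Admissible T u) (hlam : ContinuousOn lam (Icc 0 T)) :
    IntegrableOn (fun s => P.localGrad (x' s) (lam' s) (x s) (u s) (lam s)) (Icc 0 T) := by
  have hG : Continuous (fun z : (P.X × P.X × P.X × P.X) × P.C =>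
      P.localGrad z.1.1 z.1.2.1 z.1.2.2.1 z.2 z.1.2.2.2) := by
    have hf : Continuous (fun z : (P.X × P.X × P.X × P.X) × P.C =>
      (((z.1.1, z.1.2.1), z.1.2.2.1, z.2, z.1.2.2.2) : (P.X × P.X) × P.X × P.C × P.X)) := by
      fun_prop
    exact hP.contDiff_localGrad.continuous.comp hf
  exact hP.integrableOn_comp
    (G := fun (w : P.X × P.X × P.X × P.X) u => P.localGrad w.1 w.2.1 w.2.2.1 u w.2.2.2) hG
    (w := fun s => (x' s, lam' s, x s, lam s)) (hx'.prodMk (hlam'.prodMk (hx.prodMk hlam))) hu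

theorem QuadBounds.stageCost_nonneg {ml Ml mV MV : ℝ} (hQ : P.QuadBounds ml Ml mV MV) (x : P.X)
    (u : P.C) : 0 ≤ P.stageCost x u :=
  le_trans (by have := hQ.ml_pos; positivity) (hQ.stage_lower x u)

theorem QuadBounds.termCost_nonneg {ml Ml mV MV : ℝ} (hQ : P.QuadBounds ml Ml mV MV) (x : P.X) :
    0 ≤ P.termCost x :=
  le_trans (by have := hQ.mV_pos; positivity) (hQ.term_lower x)

theorem QuadBounds.termCost_le_cost {ml Ml mV MV : ℝ} (hQ : P.QuadBounds ml Ml mV MV)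
    (hT : 0 ≤ T) (x : ℝ → P.X) (u : ℝ → P.C) : P.termCost (x T) ≤ P.cost T x u :=
  le_add_of_nonneg_right (intervalIntegral.integral_nonneg hT fun _ _ => hQ.stageCost_nonneg _ _)

theorem norm_le_of_near {x₀ y : P.X} (h₀ : ‖x₀‖ ≤ R₁) (hR : R₁ + ρ ≤ R)
    (hy : ‖y - x₀‖ ≤ ρ) : ‖y‖ ≤ R := by
  have := norm_add_le x₀ (y - x₀)
  rw [add_sub_cancel] at this
  linarith

theorem ShortHorizon.traj_near (h : P.ShortHorizon T ρ L R₁ R Q C) {x₀ : P.X} {u : ℝ → P.C}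
    {x : ℝ → P.X} (hx₀ : ‖x₀‖ ≤ R₁) (hu : P.Admissible T u) (hx : P.IsTraj T x₀ u x) :
    ∀ τ ∈ Icc 0 T, ‖x τ - x₀‖ < ρ :=
  norm_sub_lt_of_eq_integral hx.1 h.ρ_pos h.bounds.pos.le h.lt_ρ hx.2 fun s hs hxs =>
    have := norm_le_of_near hx₀ h.radius hxs
    h.bounds.dyn_le _ _ _ this (hu.2 s hs) this

theorem ShortHorizon.traj_norm_le (h : P.ShortHorizon T ρ L R₁ R Q C) {x₀ : P.X} {u : ℝ → P.C}
    {x : ℝ → P.X} (hx₀ : ‖x₀‖ ≤ R₁) (hu : P.Admissible T u) (hx : P.IsTraj T x₀ u x) :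
    ∀ τ ∈ Icc 0 T, ‖x τ‖ ≤ R := fun τ hτ =>
  norm_le_of_near hx₀ h.radius (h.traj_near hx₀ hu hx τ hτ).le

/-- Two trajectories with the same initial state differ at most by the integral of the difference
of their controls, up to a constant factor. -/
theorem ShortHorizon.traj_sub_le (h : P.ShortHorizon T ρ L R₁ R Q C) (hP : P.Regular) {x₀ : P.X}
    {u v : ℝ → P.C} {x y : ℝ → P.X} (hx₀ : ‖x₀‖ ≤ R₁) (hu : P.Admissible T u)
    (hv : P.Admissible T v) (hx : P.IsTraj T x₀ u x) (hy : P.IsTraj T x₀ v y) {φ : ℝ → ℝ}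
    {t : ℝ} (ht : t ∈ Icc 0 T) (hφ : IntegrableOn φ (Icc 0 t)) (hφ0 : ∀ s, 0 ≤ φ s)
    (huv : ∀ᵐ s ∂(volume.restrict (Icc 0 t)), C * ‖u s - v s‖ ≤ φ s) :
    ∀ τ ∈ Icc 0 t, ‖x τ - y τ‖ ≤ 2 * ∫ s in (0 : ℝ)..t, φ s := by
  have hsub : Icc 0 t ⊆ Icc 0 T := Icc_subset_Icc_right ht.2
  have hC := h.bounds.pos
  -- The constant is `2 * C` because the state enters `dynHat` twice, as own state and as neighbors'
  -- state.
  have hk : 2 * C * t ≤ 1 / 2 := by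
    have := h.CT_le
    have : C * t ≤ C * T := by gcongr; exact ht.2
    nlinarith
  have := norm_sub_le_of_eq_integral (T := t) (k := 2 * C) (x₀ := x₀) (y₀ := x₀) ht.1
    (by positivity) hk (hx.1.mono hsub) (hy.1.mono hsub) (fun τ hτ => hx.2 τ (hsub hτ))
    (fun τ hτ => hy.2 τ (hsub hτ)) ((hP.integrableOn_dyn hx.1 hu).mono_set hsub)
    ((hP.integrableOn_dyn hy.1 hv).mono_set hsub) hφ hφ0 (by
      filter_upwards [huv, ae_restrict_mem measurableSet_Icc] with s hs hsI
      have hs' := hsub hsI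
      have ex := h.traj_norm_le hx₀ hu hx s hs'
      have ey := h.traj_norm_le hx₀ hv hy s hs'
      have := h.bounds.dyn_lip (x s) (u s) (x s) (y s) (v s) (y s) ex (hu.2 s hs') ex ey
        (hv.2 s hs') ey
      change ‖P.dyn (x s) (u s) - P.dyn (y s) (v s)‖ ≤ _ at this
      nlinarith)
  simpa using this

theorem ShortHorizon.traj_eqOn (h : P.ShortHorizon T ρ L R₁ R Q C) (hP : P.Regular) {x₀ : P.X}
    {u v : ℝ → P.C} {x y : ℝ → P.X} (hx₀ : ‖x₀‖ ≤ R₁) (hu : P.Admissible T u)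
    (hv : P.Admissible T v) (hx : P.IsTraj T x₀ u x) (hy : P.IsTraj T x₀ v y)
    {t : ℝ} (ht : t ∈ Icc 0 T) (huv : ∀ᵐ s ∂(volume.restrict (Icc 0 t)), u s = v s) :
    EqOn x y (Icc 0 t) := by
  intro τ hτ
  have := h.traj_sub_le hP hx₀ hu hv hx hy ht (φ := fun _ => 0) integrableOn_zero
    (fun _ => le_rfl) (by filter_upwards [huv] with s hs; simp [hs]) τ hτ
  simpa [sub_eq_zero] using this

/-- Backward barrier argument. The optimal cost controls the terminal state directly, through `V`;
this lemma spreads that control over the whole trajectory, including the initial state. -/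
theorem ShortHorizon.traj_norm_lt_of_terminal (h : P.ShortHorizon T ρ L R₁ R Q C)
    (hP : P.Regular) {x₀ : P.X} {u : ℝ → P.C} {x : ℝ → P.X} (hu : P.Admissible T u)
    (hx : P.IsTraj T x₀ u x) (hxT : ‖x T‖ + ρ ≤ R₁) : ∀ τ ∈ Icc 0 T, ‖x τ‖ ≤ R₁ := by
  have hT := h.T_pos.le
  have hR : R₁ ≤ R := by linarith [h.radius, h.ρ_pos]
  intro τ hτ
  refine norm_le_of_near (ρ := ρ) le_rfl hxT ?_
  refine (norm_sub_lt_of_eq_integral_backward (g := fun s => - P.dyn (x s) (u s)) hx.1 h.ρ_pos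
    h.bounds.pos.le h.lt_ρ (fun t ht => ?_) (fun s hs hxs => ?_) τ hτ).le
  · rw [eq_add_integral_sub (hP.integrableOn_dyn hx.1 hu) hx.2 ht ⟨hT, le_rfl⟩,
      intervalIntegral.integral_neg]
    abel
  · have := (norm_le_of_near le_rfl hxT hxs).trans hR
    rw [norm_neg]
    exact h.bounds.dyn_le _ _ _ this (hu.2 s hs) this

end Trajectories

end Network

theorem intervalIntegral_indicator_Ioc {F : Type*} [NormedAddCommGroup F] [NormedSpace ℝ F]
    {T a b : ℝ} (ha : 0 ≤ a) (hab : a ≤ b) (hb : b ≤ T) (w : ℝ → F) :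
    ∫ s in (0 : ℝ)..T, (Ioc a b).indicator w s = ∫ s in a..b, w s := by
  rw [intervalIntegral.integral_of_le (ha.trans (hab.trans hb)), intervalIntegral.integral_of_le hab,
    integral_indicator measurableSet_Ioc, Measure.restrict_restrict measurableSet_Ioc,
    inter_eq_left.2 (Ioc_subset_Ioc ha hb)]

/-! ### Optimal trajectories and the optimal adjoint. -/

namespace Network

variable {N : ℕ}

/-- The standing hypotheses on a horizon that is short compared with the bounds of the network. -/
structure Setting (P : Network N) where
  (ml Ml mV MV T Δ ρ L β α R₁ R Q C : ℝ)
  Γ : Set P.X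
  xs : P.X → ℝ → P.X
  us : P.X → ℝ → P.C
  κs : ℝ → P.X → P.X → P.C
  κ : ℝ → P.X → (ℝ → P.X) → (ℝ → P.X) → P.X → P.C
  regular : P.Regular
  quad : P.QuadBounds ml Ml mV MV
  short : P.ShortHorizon T ρ L R₁ R Q C
  standing : P.Standing T Δ ρ L β α Γ xs us κs κ
  β_pos : 0 < β
  α_pos : 0 < α
  level_radius : ∀ x : P.X, mV * ‖x‖ ^ 2 ≤ α → ‖x‖ + ρ ≤ R₁

namespace Setting

variable {P : Network N} (S : P.Setting)

/-- The level set of the optimal cost. -/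
abbrev K : Set P.X := P.levelSet S.T S.Γ S.xs S.us S.α

/-- The optimal cost. -/
abbrev J : P.X → ℝ := P.optCost S.T S.xs S.us

theorem T_nonneg : 0 ≤ S.T := S.short.T_pos.le

theorem isOptimal {xk : P.X} (hxk : xk ∈ S.K) : P.IsOptimal S.T xk (S.xs xk) (S.us xk) :=
  S.standing.optimalOn.optimal xk hxk.1

theorem xs_zero {xk : P.X} (hxk : xk ∈ S.K) : S.xs xk 0 = xk := by
  simpa using (S.isOptimal hxk).2.1.2 0 ⟨le_rfl, S.T_nonneg⟩

theorem norm_xs_le {xk : P.X} (hxk : xk ∈ S.K) : ∀ τ ∈ Icc 0 S.T, ‖S.xs xk τ‖ ≤ S.R₁ := by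
  have hopt := S.isOptimal hxk
  refine S.short.traj_norm_lt_of_terminal S.regular hopt.1 hopt.2.1 (S.level_radius _ ?_)
  exact (S.quad.term_lower _).trans
    ((S.quad.termCost_le_cost S.T_nonneg (S.xs xk) (S.us xk)).trans hxk.2)

theorem norm_le {xk : P.X} (hxk : xk ∈ S.K) : ‖xk‖ ≤ S.R₁ := by
  simpa [S.xs_zero hxk] using S.norm_xs_le hxk 0 ⟨le_rfl, S.T_nonneg⟩

theorem mem_thickening {xk y : P.X} (hxk : xk ∈ S.K) (hy : ‖y - xk‖ ≤ S.ρ) :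
    y ∈ Metric.cthickening S.ρ S.K :=
  Metric.closedBall_subset_cthickening hxk S.ρ (mem_closedBall_iff_norm.2 hy)

theorem norm_le_of_mem_thickening {y : P.X} (hy : y ∈ Metric.cthickening S.ρ S.K) :
    ‖y‖ ≤ S.R := by
  obtain hR | hR := le_or_gt 0 S.R₁
  · have h1 : S.K ⊆ Metric.closedBall 0 S.R₁ := fun x hx => mem_closedBall_zero_iff.2 (S.norm_le hx)
    have h2 := Metric.cthickening_subset_of_subset S.ρ h1 hy
    rw [cthickening_closedBall S.short.ρ_pos.le hR, mem_closedBall_zero_iff] at h2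
    linarith [S.short.radius]
  -- A negative radius would leave the level set, and hence its thickening, empty.
  · have h1 : S.K = ∅ := eq_empty_of_forall_notMem fun x hx =>
      absurd ((norm_nonneg x).trans (S.norm_le hx)) (not_le.2 hR)
    rw [h1, Metric.cthickening_empty] at hy
    exact absurd hy (notMem_empty y)

theorem xs_mem_thickening {xk : P.X} (hxk : xk ∈ S.K) {τ : ℝ} (hτ : τ ∈ Icc 0 S.T) :
    S.xs xk τ ∈ Metric.cthickening S.ρ S.K :=
  S.mem_thickening hxk
    (S.short.traj_near (S.norm_le hxk) (S.isOptimal hxk).1 (S.isOptimal hxk).2.1 τ hτ).le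

theorem continuousOn_xs {xk : P.X} (hxk : xk ∈ S.K) : ContinuousOn (S.xs xk) (Icc 0 S.T) :=
  (S.isOptimal hxk).2.1.1

/-- Along the optimal trajectory `u* = κ*(τ, x*(τ))`; freezing the state leaves a function
continuous in `τ`, and the remainder is Lipschitz in the state uniformly in `τ`. Continuity of `u*`
makes the adjoint differentiable and Pontryagin's principle pointwise. -/
theorem continuousOn_us {xk : P.X} (hxk : xk ∈ S.K) : ContinuousOn (S.us xk) (Icc 0 S.T) := by
  obtain ⟨Ls, hLs⟩ := S.standing.feedback.opt_lip
  intro t ht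
  have h1 : ContinuousOn (fun τ => S.κs τ (S.xs xk t) xk) (Icc 0 S.T) :=
    S.standing.feedback.opt_cont xk hxk _ (S.xs_mem_thickening hxk ht)
  have h2 : Filter.Tendsto (fun τ => S.us xk τ - S.κs τ (S.xs xk t) xk)
      (nhdsWithin t (Icc 0 S.T)) (nhds 0) := by
    have hx : Filter.Tendsto (fun τ => Ls * ‖S.xs xk τ - S.xs xk t‖)
        (nhdsWithin t (Icc 0 S.T)) (nhds 0) := by
      have := (((S.continuousOn_xs hxk t ht).tendsto.sub_const (S.xs xk t)).norm).const_mul Ls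
      simpa using this
    refine squeeze_zero_norm' ?_ hx
    filter_upwards [self_mem_nhdsWithin] with τ hτ
    rw [S.standing.feedback.opt_law xk hxk.1 τ hτ]
    simpa using hLs τ hτ _ (S.xs_mem_thickening hxk hτ) _ (S.xs_mem_thickening hxk ht)
      xk hxk xk hxk
  have h3 := h2.add (h1 t ht).tendsto
  rw [← S.standing.feedback.opt_law xk hxk.1 t ht, zero_add] at h3
  exact h3.congr fun τ => by simp

theorem continuousOn_localGrad {x lam : ℝ → P.X} {u : ℝ → P.C} (hx : ContinuousOn x (Icc 0 S.T))
    (hu : ContinuousOn u (Icc 0 S.T)) (hlam : ContinuousOn lam (Icc 0 S.T)) :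
    ContinuousOn (fun s => P.localGrad (x s) (lam s) (x s) (u s) (lam s)) (Icc 0 S.T) := by
  have hcomp : ∀ G : (P.X × P.X) × P.X × P.C × P.X → P.X, Continuous G →
      ContinuousOn (fun s => G ((x s, lam s), x s, u s, lam s)) (Icc 0 S.T) := fun G hG =>
    hG.comp_continuousOn ((hx.prodMk hlam).prodMk (hx.prodMk (hu.prodMk hlam)))
  have hG : Continuous (fun z : (P.X × P.X) × P.X × P.C × P.X =>
      P.localGrad z.1.1 z.1.2 z.2.1 z.2.2.1 z.2.2.2) := S.regular.contDiff_localGrad.continuous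
  have := hcomp _ hG
  exact this

theorem xs_norm_le_R {xk : P.X} (hxk : xk ∈ S.K) {τ : ℝ} (hτ : τ ∈ Icc 0 S.T) :
    ‖S.xs xk τ‖ ≤ S.R :=
  (S.norm_xs_le hxk τ hτ).trans (by linarith [S.short.radius, S.short.ρ_pos])

theorem us_mem {xk : P.X} (hxk : xk ∈ S.K) {τ : ℝ} (hτ : τ ∈ Icc 0 S.T) : S.us xk τ ∈ P.ctrl :=
  (S.isOptimal hxk).1.2 τ hτ

/-- Picard–Lindelöf started at time `T` on the ball of radius `ρ` around the terminal value. The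
field is bounded by `C` and Lipschitz with constant `2 * C`, since the adjoint enters both the own
part and the sensitivities; `C * T < ρ` makes the solution reach back to time `0`. -/
theorem exists_adjoint {xk : P.X} (hxk : xk ∈ S.K) :
    ∃ lam : ℝ → P.X, P.IsAdjoint S.T (S.xs xk) (S.us xk) lam ∧
      ∀ τ ∈ Icc 0 S.T, ‖lam τ - gradient P.termCost (S.xs xk S.T)‖ ≤ S.ρ := by
  have hT := S.T_nonneg
  have hTm : S.T ∈ Icc 0 S.T := ⟨hT, le_rfl⟩
  have hC := S.short.bounds.pos
  set lamT := gradient P.termCost (S.xs xk S.T) with hlamT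
  have hQb : ∀ μ ∈ Metric.closedBall lamT S.ρ, ‖μ‖ ≤ S.Q := fun μ hμ =>
    norm_le_of_near (R₁ := ‖lamT‖) le_rfl (S.short.adjoint _ (S.xs_norm_le_R hxk hTm))
      (mem_closedBall_iff_norm.1 hμ)
  let v : ℝ → P.X → P.X := fun s μ =>
    - P.localGrad (S.xs xk s) μ (S.xs xk s) (S.us xk s) μ
  have hv : IsPicardLindelof v (⟨S.T, hTm⟩ : Icc 0 S.T) lamT ⟨S.ρ, S.short.ρ_pos.le⟩ 0
      ⟨S.C, hC.le⟩ ⟨2 * S.C, by positivity⟩ := by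
    refine ⟨fun t ht => ?_, fun μ hμ => ?_, fun t ht μ hμ => ?_, ?_⟩
    · refine LipschitzOnWith.of_dist_le_mul fun μ hμ ν hν => ?_
      have h1 := S.short.bounds.grad_lip (S.xs xk t) ν (S.xs xk t) (S.us xk t) ν
        (S.xs xk t) μ (S.xs xk t) (S.us xk t) μ (S.xs_norm_le_R hxk ht) (hQb _ hν)
        (S.xs_norm_le_R hxk ht) (S.us_mem hxk ht) (hQb _ hν) (S.xs_norm_le_R hxk ht) (hQb _ hμ)
        (S.xs_norm_le_R hxk ht) (S.us_mem hxk ht) (hQb _ hμ)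
      simp only [sub_self, norm_zero, zero_add, add_zero] at h1
      simp only [v, dist_eq_norm, neg_sub_neg]
      rw [norm_sub_rev μ ν]
      change _ ≤ 2 * S.C * ‖ν - μ‖
      linarith
    · exact (S.continuousOn_localGrad (lam := fun _ => μ) (S.continuousOn_xs hxk)
        (S.continuousOn_us hxk) continuousOn_const).neg
    · simp only [v, norm_neg]
      exact S.short.bounds.grad_le _ _ _ _ _ (S.xs_norm_le_R hxk ht) (hQb _ hμ)
        (S.xs_norm_le_R hxk ht) (S.us_mem hxk ht) (hQb _ hμ)
    · have := S.short.lt_ρ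
      simp only [sub_self, sub_zero, NNReal.coe_zero, max_eq_right hT]
      exact this.le
  obtain ⟨lam, hlam0, hlam⟩ := hv.exists_eq_forall_mem_Icc_hasDerivWithinAt₀
  have hcont : ContinuousOn lam (Icc 0 S.T) := fun s hs => (hlam s hs).continuousWithinAt
  have hgc := S.continuousOn_localGrad (S.continuousOn_xs hxk) (S.continuousOn_us hxk) hcont
  have heq : ∀ τ ∈ Icc 0 S.T, lam τ = lamT + ∫ s in τ..S.T,
      P.localGrad (S.xs xk s) (lam s) (S.xs xk s) (S.us xk s) (lam s) := by
    intro τ hτ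
    have hsub : Icc τ S.T ⊆ Icc 0 S.T := Icc_subset_Icc_left hτ.1
    have h1 := intervalIntegral.integral_eq_sub_of_hasDeriv_right_of_le hτ.2 (hcont.mono hsub)
      (f' := fun s => v s (lam s)) (fun s hs => by
        have hs' : s ∈ Icc 0 S.T := ⟨hτ.1.trans hs.1.le, hs.2.le⟩
        refine (hlam s hs').mono_of_mem_nhdsWithin ?_
        exact mem_nhdsWithin_of_mem_nhds (Icc_mem_nhds (hτ.1.trans_lt hs.1) hs.2))
      (intervalIntegrable_of_integrableOn_Icc hgc.neg.integrableOn_Icc hτ hTm)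
    simp only [v, intervalIntegral.integral_neg] at h1
    have h2 : lam S.T = lamT := hlam0
    rw [h2] at h1
    rw [neg_eq_iff_eq_neg] at h1
    rw [h1]
    abel
  have hnear : ∀ τ ∈ Icc 0 S.T, ‖lam τ - lamT‖ < S.ρ :=
    norm_sub_lt_of_eq_integral_backward hcont S.short.ρ_pos hC.le S.short.lt_ρ heq
      fun s hs hsl => S.short.bounds.grad_le _ _ _ _ _ (S.xs_norm_le_R hxk hs)
        (hQb _ (mem_closedBall_iff_norm.2 hsl)) (S.xs_norm_le_R hxk hs) (S.us_mem hxk hs)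
        (hQb _ (mem_closedBall_iff_norm.2 hsl))
  refine ⟨lam, ⟨hcont, fun τ hτ => ?_⟩, fun τ hτ => (hnear τ hτ).le⟩
  simp only [S.regular.gradient_ham]
  exact heq τ hτ

end Setting

end Network

/-! ### Pontryagin's principle and the fixed point of the iteration. -/

namespace Network

namespace Setting

variable {N : ℕ} {P : Network N} (S : P.Setting)

open scoped Classical in
/-- The optimal adjoint trajectory. -/
def lams (xk : P.X) : ℝ → P.X :=
  if h : xk ∈ S.K then Classical.choose (S.exists_adjoint h) else 0

variable {S} {xk : P.X}

theorem isAdjoint_lams (hxk : xk ∈ S.K) :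
    P.IsAdjoint S.T (S.xs xk) (S.us xk) (S.lams xk) := by
  rw [lams, dif_pos hxk]
  exact (Classical.choose_spec (S.exists_adjoint hxk)).1

theorem lams_near (hxk : xk ∈ S.K) {τ : ℝ} (hτ : τ ∈ Icc 0 S.T) :
    ‖S.lams xk τ - gradient P.termCost (S.xs xk S.T)‖ ≤ S.ρ := by
  rw [lams, dif_pos hxk]
  exact (Classical.choose_spec (S.exists_adjoint hxk)).2 τ hτ

theorem continuousOn_lams (hxk : xk ∈ S.K) : ContinuousOn (S.lams xk) (Icc 0 S.T) :=
  (isAdjoint_lams hxk).1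

theorem lams_eq (hxk : xk ∈ S.K) : ∀ τ ∈ Icc 0 S.T, S.lams xk τ =
    gradient P.termCost (S.xs xk S.T) + ∫ s in τ..S.T,
      P.localGrad (S.xs xk s) (S.lams xk s) (S.xs xk s) (S.us xk s) (S.lams xk s) := by
  have := (isAdjoint_lams hxk).2
  simpa only [S.regular.gradient_ham] using this

theorem norm_lams_le (hxk : xk ∈ S.K) {τ : ℝ} (hτ : τ ∈ Icc 0 S.T) : ‖S.lams xk τ‖ ≤ S.Q :=
  norm_le_of_near (R₁ := ‖gradient P.termCost (S.xs xk S.T)‖) le_rfl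
    (S.short.adjoint _ (S.xs_norm_le_R hxk ⟨S.T_nonneg, le_rfl⟩)) (lams_near hxk hτ)

theorem iterates_optimal (hxk : xk ∈ S.K) :
    P.Iterates S.T S.ρ S.K (S.xs xk) (S.lams xk) where
  x_cont := S.continuousOn_xs hxk
  lam_cont := continuousOn_lams hxk
  x_mem _ hτ := S.xs_mem_thickening hxk hτ
  lam_mem _ hτ := Metric.closedBall_subset_cthickening
    (mem_image_of_mem _ (S.xs_mem_thickening hxk ⟨S.T_nonneg, le_rfl⟩)) S.ρ
    (mem_closedBall_iff_norm.2 (lams_near hxk hτ))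

theorem hasDerivAt_lams (hxk : xk ∈ S.K) {τ : ℝ} (hτ : τ ∈ Ioo 0 S.T) :
    HasDerivAt (S.lams xk) (-P.localGrad (S.xs xk τ) (S.lams xk τ) (S.xs xk τ) (S.us xk τ)
      (S.lams xk τ)) τ := by
  have hTm : S.T ∈ Icc 0 S.T := ⟨S.T_nonneg, le_rfl⟩
  have h0m : (0 : ℝ) ∈ Icc 0 S.T := ⟨le_rfl, S.T_nonneg⟩
  have hg := S.continuousOn_localGrad (S.continuousOn_xs hxk) (S.continuousOn_us hxk)
    (continuousOn_lams hxk)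
  refine (hasDerivWithinAt_of_eq_integral (x₀ := S.lams xk 0) hg.neg (fun t ht => ?_) τ
    ⟨hτ.1.le, hτ.2.le⟩).hasDerivAt (Icc_mem_nhds hτ.1 hτ.2)
  simp only [Pi.neg_apply]
  rw [intervalIntegral.integral_neg, lams_eq hxk t ht, lams_eq hxk 0 h0m,
    ← intervalIntegral.integral_add_adjacent_intervals
      (intervalIntegrable_of_integrableOn_Icc hg.integrableOn_Icc h0m ht)
      (intervalIntegrable_of_integrableOn_Icc hg.integrableOn_Icc ht hTm)]
  abel

/-- A trajectory is differentiable wherever its control is continuous. -/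
theorem hasDerivAt_traj (S : P.Setting) {x₀ : P.X} {u : ℝ → P.C} {x : ℝ → P.X}
    (hu : P.Admissible S.T u) (hx : P.IsTraj S.T x₀ u x) {τ : ℝ} (hτ : τ ∈ Ioo 0 S.T)
    (hc : ContinuousAt u τ) : HasDerivAt x (P.dyn (x τ) (u τ)) τ := by
  have h0m : (0 : ℝ) ∈ Icc 0 S.T := ⟨le_rfl, S.T_nonneg⟩
  have hi := S.regular.integrableOn_dyn hx.1 hu
  have hn := Icc_mem_nhds hτ.1 hτ.2
  have hG : ContinuousAt (fun s => P.dyn (x s) (u s)) τ := by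
    have hcx : ContinuousAt x τ := hx.1.continuousAt hn
    have hz : ContinuousAt (fun s => (((x s, x s), u s) : (P.X × P.X) × P.C)) τ :=
      (hcx.prodMk hcx).prodMk hc
    have hcomp : ∀ G : (P.X × P.X) × P.C → P.X, Continuous G →
      ContinuousAt (fun s => G ((x s, x s), u s)) τ := fun G hG =>
        hG.continuousAt.comp (f := fun s => (((x s, x s), u s) : (P.X × P.X) × P.C)) hz
    have := hcomp _ S.regular.continuous_dynHat
    exact this
  have h1 : HasDerivAt (fun t => ∫ s in (0 : ℝ)..t, P.dyn (x s) (u s)) (P.dyn (x τ) (u τ)) τ :=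
    intervalIntegral.integral_hasDerivAt_right
      (intervalIntegrable_of_integrableOn_Icc hi h0m ⟨hτ.1.le, hτ.2.le⟩)
      ⟨Icc 0 S.T, hn, hi.aestronglyMeasurable⟩ hG
  refine (h1.const_add x₀).congr_of_eventuallyEq ?_
  filter_upwards [hn] with t ht using hx.2 t ht

theorem continuous_ham (hP : P.Regular) :
    Continuous (fun z : (P.X × P.X) × P.C => P.ham z.1.1 z.2 z.1.2) :=
  (hP.contDiff_ham (contDiff_fst.comp contDiff_fst) contDiff_snd
    (contDiff_snd.comp contDiff_fst)).continuous

/-- The central gradient is `localGrad` with the state in two slots, hence Lipschitz with constant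
`2 * C`; the Taylor remainder is quadratic. -/
theorem ham_sub_sub_le (S : P.Setting) {x y lam : P.X} {u : P.C} (hx : ‖x‖ ≤ S.R) (hy : ‖y‖ ≤ S.R)
    (hu : u ∈ P.ctrl) (hlam : ‖lam‖ ≤ S.Q) :
    P.ham y u lam - P.ham x u lam - inner ℝ (P.localGrad x lam x u lam) (y - x) ≤
      2 * S.C * ‖y - x‖ ^ 2 := by
  have hC := S.short.bounds.pos
  have hd : Differentiable ℝ (fun ξ => P.ham ξ u lam) :=
    (S.regular.contDiff_ham contDiff_id contDiff_const contDiff_const).differentiable two_ne_zero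
  have := norm_sub_sub_fderiv_le (fun z _ => hd z) (convex_closedBall (0 : P.X) S.R) (C := 2 * S.C) (x := x)
    (y := y) (fun z hz => by
      rw [norm_gradient_sub, S.regular.gradient_ham, S.regular.gradient_ham]
      have hz' := mem_closedBall_zero_iff.1 hz
      refine (S.short.bounds.grad_lip z lam z u lam x lam x u lam hz' hlam hz' hu hlam hx hlam hx
        hu hlam).trans (le_of_eq ?_)
      simp only [sub_self, norm_zero]
      ring) (by positivity)
    (mem_closedBall_zero_iff.2 hx) (mem_closedBall_zero_iff.2 hy)
  rw [← inner_gradient, S.regular.gradient_ham] at this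
  exact (Real.le_norm_self _).trans this

theorem termCost_sub_sub_le (S : P.Setting) {x y : P.X} (hx : ‖x‖ ≤ S.R) (hy : ‖y‖ ≤ S.R) :
    P.termCost y - P.termCost x - inner ℝ (gradient P.termCost x) (y - x) ≤
      S.C * ‖y - x‖ ^ 2 := by
  have hC := S.short.bounds.pos
  have := norm_sub_sub_fderiv_le
    (fun z _ => S.regular.contDiff_termCost.differentiable two_ne_zero z)
    (convex_closedBall (0 : P.X) S.R) (C := S.C) (x := x) (y := y) (fun z hz => by
      rw [norm_gradient_sub]
      exact S.short.bounds.term_lip z x (mem_closedBall_zero_iff.1 hz) hx) hC.le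
    (mem_closedBall_zero_iff.2 hx) (mem_closedBall_zero_iff.2 hy)
  rw [← inner_gradient] at this
  exact (Real.le_norm_self _).trans this

/-- First-order effect on the cost of a constant control on a short time interval. -/
theorem exists_needle_bound (hxk : xk ∈ S.K) {v : P.C} (hv : v ∈ P.ctrl) :
    ∃ B : ℝ, ∀ a b, 0 ≤ a → a < b → b ≤ S.T →
      0 ≤ (∫ s in a..b, (P.ham (S.xs xk s) v (S.lams xk s) -
        P.ham (S.xs xk s) (S.us xk s) (S.lams xk s))) + B * (b - a) ^ 2 := by
  classical
  obtain ⟨D₀, hD₀⟩ := S.regular.isCompact_ctrl.exists_bound_of_continuousOn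
    (f := fun u : P.C => u) continuousOn_id
  set C := S.C with hCdef
  have hC : 0 < C := S.short.bounds.pos
  have hT := S.T_nonneg
  have hD0 : 0 ≤ D₀ := (norm_nonneg _).trans (hD₀ v hv)
  obtain ⟨hu, hx, hmin⟩ := S.isOptimal hxk
  have hxk1 := S.norm_le hxk
  -- Controls differ by at most `2 * D₀` on the needle, and the perturbation lemma contributes
  -- another factor `2`.
  set D := 4 * C * D₀ with hD
  -- The three terms come from the remainder of the terminal cost, the displaced state inside the
  -- needle, and the remainder of the Hamiltonian outside it.
  refine ⟨C * D ^ 2 + 2 * C * D + 2 * C * D ^ 2 * S.T, fun a b ha hab hb => ?_⟩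
  set x := S.xs xk
  set u := S.us xk
  set lam := S.lams xk
  have hIoc : Ioc a b ⊆ Icc 0 S.T := fun s hs => ⟨ha.trans hs.1.le, hs.2.trans hb⟩
  have h0m : (0 : ℝ) ∈ Icc 0 S.T := ⟨le_rfl, hT⟩
  have hTm : S.T ∈ Icc 0 S.T := ⟨hT, le_rfl⟩
  set w : ℝ → P.C := (Ioc a b).piecewise (fun _ => v) u with hw
  have hwin : ∀ s ∈ Ioc a b, w s = v := fun s hs => piecewise_eq_of_mem _ _ _ hs
  have hwout : ∀ s, s ∉ Ioc a b → w s = u s := fun s hs => piecewise_eq_of_notMem _ _ _ hs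
  have hwadm : P.Admissible S.T w := by
    refine ⟨AEStronglyMeasurable.piecewise measurableSet_Ioc aestronglyMeasurable_const
      (hu.1.mono_measure Measure.restrict_le_self), fun τ hτ => ?_⟩
    by_cases h : τ ∈ Ioc a b
    · rw [hwin τ h]; exact hv
    · rw [hwout τ h]; exact hu.2 τ hτ
  obtain ⟨y, hy⟩ := S.standing.wellPosed xk w hwadm
  have hcost := hmin y w hwadm hy
  have hxR : ∀ τ ∈ Icc 0 S.T, ‖x τ‖ ≤ S.R := fun τ hτ => S.xs_norm_le_R hxk hτ
  have hyR : ∀ τ ∈ Icc 0 S.T, ‖y τ‖ ≤ S.R := S.short.traj_norm_le hxk1 hwadm hy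
  have hlamQ : ∀ τ ∈ Icc 0 S.T, ‖lam τ‖ ≤ S.Q := fun τ hτ => norm_lams_le hxk hτ
  -- the trajectories differ by a multiple of the length of the interval
  have hδ : ∀ τ ∈ Icc 0 S.T, ‖y τ - x τ‖ ≤ D * (b - a) := by
    intro τ hτ
    have hφi : IntegrableOn ((Ioc a b).indicator (fun _ => C * (2 * D₀))) (Icc 0 S.T) :=
      continuousOn_const.integrableOn_Icc.indicator measurableSet_Ioc
    have := S.short.traj_sub_le S.regular hxk1 hwadm hu hy hx hTm hφi
      (fun s => indicator_nonneg (fun _ _ => by positivity) s) (by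
        filter_upwards [ae_restrict_mem measurableSet_Icc] with s hs
        by_cases h : s ∈ Ioc a b
        · rw [indicator_of_mem h, hwin s h]
          have e1 := hD₀ v hv
          have e2 := hD₀ _ (hu.2 s hs)
          have e3 := norm_sub_le v (u s)
          refine mul_le_mul_of_nonneg_left ?_ hC.le
          linarith
        · rw [indicator_of_notMem h, hwout s h]
          simp) τ hτ
    rw [intervalIntegral_indicator_Ioc ha hab.le hb, intervalIntegral.integral_const,
      smul_eq_mul] at this
    rw [hD]
    linarith
  have hxc := hx.1
  have hyc := hy.1
  have hlamc : ContinuousOn lam (Icc 0 S.T) := continuousOn_lams hxk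
  have huc : ContinuousOn u (Icc 0 S.T) := S.continuousOn_us hxk
  set G : ℝ → P.X := fun s => P.localGrad (x s) (lam s) (x s) (u s) (lam s) with hG
  have hGc : ContinuousOn G (Icc 0 S.T) := S.continuousOn_localGrad hxc huc hlamc
  have hfy := S.regular.integrableOn_dyn hyc hwadm
  have hfx := S.regular.integrableOn_dyn hxc hu
  have hly := S.regular.integrableOn_stageCost hyc hwadm
  have hlx := S.regular.integrableOn_stageCost hxc hu
  -- integration by parts
  have hparts := inner_sub_inner_eq_integral (s := {a, b}) hT (Set.toFinite {a, b}).countable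
    (x := lam) (y := fun s => y s - x s) (g := fun s => - G s)
    (h := fun s => P.dyn (y s) (w s) - P.dyn (x s) (u s)) hlamc (hyc.sub hxc)
    (fun τ hτ => hasDerivAt_lams hxk hτ.1)
    (fun τ hτ => by
      have hn := Icc_mem_nhds hτ.1.1 hτ.1.2
      have huτ : ContinuousAt u τ := huc.continuousAt hn
      have hwτ : ContinuousAt w τ := by
        have hne : τ ≠ a ∧ τ ≠ b := by simpa [not_or] using hτ.2
        by_cases h : τ ∈ Ioc a b
        · have hlt : τ < b := lt_of_le_of_ne h.2 hne.2
          refine (continuousAt_const (y := v)).congr ?_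
          filter_upwards [Ioo_mem_nhds h.1 hlt] with s hs
          exact (hwin s ⟨hs.1, hs.2.le⟩).symm
        · refine huτ.congr ?_
          rcases lt_or_gt_of_ne hne.1 with h1 | h1
          · filter_upwards [Iio_mem_nhds h1] with s hs
            exact (hwout s fun h' => absurd h'.1 (not_lt.2 hs.le)).symm
          · have h2 : b < τ := by
              by_contra! h2
              exact h ⟨h1, h2⟩
            filter_upwards [Ioi_mem_nhds h2] with s hs
            exact (hwout s fun h' => absurd h'.2 (not_le.2 hs)).symm
      exact (S.hasDerivAt_traj hwadm hy hτ.1 hwτ).sub (S.hasDerivAt_traj hu hx hτ.1 huτ))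
    hGc.neg.integrableOn_Icc (hfy.sub hfx)
  have hy0 : y 0 - x 0 = 0 := by
    rw [hy.2 0 h0m, hx.2 0 h0m]; simp
  rw [hy0, inner_zero_right, sub_zero] at hparts
  have hlamT : lam S.T = gradient P.termCost (x S.T) := by
    have := lams_eq hxk S.T hTm
    simpa using this
  have hVT := S.termCost_sub_sub_le (hxR _ hTm) (hyR _ hTm)
  rw [← hlamT, hparts] at hVT
  -- the integrand of the variation
  set ψ : ℝ → ℝ := fun s => P.ham (x s) v (lam s) - P.ham (x s) (u s) (lam s) with hψ
  have hpint : IntegrableOn (fun s => inner ℝ (lam s) (P.dyn (y s) (w s) - P.dyn (x s) (u s)) +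
      inner ℝ (- G s) (y s - x s)) (Icc 0 S.T) := by
    obtain ⟨B, hB⟩ := isCompact_Icc.exists_bound_of_continuousOn hlamc
    refine Integrable.add (Integrable.mono' ((hfy.sub hfx).norm.const_mul B)
      ((hlamc.aestronglyMeasurable measurableSet_Icc).inner
        (hfy.sub hfx).aestronglyMeasurable) ?_)
      (ContinuousOn.integrableOn_Icc (hGc.neg.inner (hyc.sub hxc)))
    filter_upwards [ae_restrict_mem measurableSet_Icc] with s hs
    exact (norm_inner_le_norm _ _).trans
      (mul_le_mul_of_nonneg_right (hB s hs) (norm_nonneg _))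
  have hψc : ContinuousOn ψ (Icc 0 S.T) := by
    have hcomp : ∀ H : (P.X × P.X) × P.C → ℝ, Continuous H →
        ContinuousOn (fun s => H ((x s, lam s), v) - H ((x s, lam s), u s)) (Icc 0 S.T) :=
      fun H hH => (hH.comp_continuousOn ((hxc.prodMk hlamc).prodMk continuousOn_const)).sub
        (hH.comp_continuousOn ((hxc.prodMk hlamc).prodMk huc))
    have := hcomp _ (continuous_ham S.regular)
    exact this
  have hψi : IntegrableOn (fun s => ψ s + 2 * C * D * (b - a)) (Icc 0 S.T) :=
    (hψc.add continuousOn_const).integrableOn_Icc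
  have hbound : ∀ s ∈ Icc 0 S.T,
      (P.stageCost (y s) (w s) - P.stageCost (x s) (u s)) +
        (inner ℝ (lam s) (P.dyn (y s) (w s) - P.dyn (x s) (u s)) + inner ℝ (- G s) (y s - x s)) ≤
      (Ioc a b).indicator (fun s => ψ s + 2 * C * D * (b - a)) s +
        2 * C * D ^ 2 * (b - a) ^ 2 := by
    intro s hs
    have hba : 0 < b - a := sub_pos.2 hab
    have e0 := hδ s hs
    have e00 := norm_nonneg (y s - x s)
    have e1 : (P.stageCost (y s) (w s) - P.stageCost (x s) (u s)) +
        (inner ℝ (lam s) (P.dyn (y s) (w s) - P.dyn (x s) (u s)) + inner ℝ (- G s) (y s - x s)) =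
        P.ham (y s) (w s) (lam s) - P.ham (x s) (u s) (lam s) - inner ℝ (G s) (y s - x s) := by
      simp only [ham, inner_sub_right, inner_neg_left]
      ring
    rw [e1]
    -- Inside the needle a first-order bound in the displacement suffices, because the length of the
    -- interval supplies a second factor `b - a`. Outside, the linear term cancels against the
    -- adjoint equation and only a quadratic remainder is left.
    by_cases h : s ∈ Ioc a b
    · rw [indicator_of_mem h, hwin s h]
      have e2 := (le_abs_self _).trans
        (S.short.bounds.ham_lip (y s) v (lam s) (x s) (hyR s hs) hv (hlamQ s hs) (hxR s hs))
      have e3 : - inner ℝ (G s) (y s - x s) ≤ C * ‖y s - x s‖ := by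
        have := (neg_le_abs _).trans (abs_real_inner_le_norm (G s) (y s - x s))
        refine this.trans ?_
        gcongr
        exact S.short.bounds.grad_le _ _ _ _ _ (hxR s hs) (hlamQ s hs) (hxR s hs) (hu.2 s hs)
          (hlamQ s hs)
      have e4 : C * ‖y s - x s‖ ≤ C * (D * (b - a)) := by gcongr
      have e5 : 0 ≤ 2 * C * D ^ 2 * (b - a) ^ 2 := by positivity
      simp only [hψ]
      linarith
    · rw [indicator_of_notMem h, hwout s h]
      have e2 := S.ham_sub_sub_le (hxR s hs) (hyR s hs) (hu.2 s hs) (hlamQ s hs)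
      have e3 : ‖y s - x s‖ ^ 2 ≤ (D * (b - a)) ^ 2 := by gcongr
      have e4 : 2 * C * ‖y s - x s‖ ^ 2 ≤ 2 * C * (D * (b - a)) ^ 2 := by gcongr
      rw [zero_add]
      linarith
  have hI : ∀ {g : ℝ → ℝ}, IntegrableOn g (Icc 0 S.T) → IntervalIntegrable g volume 0 S.T :=
    fun hg => intervalIntegrable_of_integrableOn_Icc hg h0m hTm
  have hl : IntegrableOn (fun s => P.stageCost (y s) (w s) - P.stageCost (x s) (u s))
    (Icc 0 S.T) := hly.sub hlx
  have hmono := intervalIntegral.integral_mono_on hT (hI (hl.add hpint))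
    (hI ((hψi.indicator measurableSet_Ioc).add
      (continuousOn_const (c := 2 * C * D ^ 2 * (b - a) ^ 2)).integrableOn_Icc)) hbound
  simp only [Pi.add_apply] at hmono
  rw [intervalIntegral.integral_add (hI hl) (hI hpint),
    intervalIntegral.integral_sub (hI hly) (hI hlx),
    intervalIntegral.integral_add (hI (hψi.indicator measurableSet_Ioc)) intervalIntegrable_const,
    intervalIntegral_indicator_Ioc ha hab.le hb,
    intervalIntegral.integral_add (intervalIntegrable_of_integrableOn_Icc hψc.integrableOn_Icc
      ⟨ha, hab.le.trans hb⟩ ⟨ha.trans hab.le, hb⟩) intervalIntegrable_const,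
    intervalIntegral.integral_const, intervalIntegral.integral_const] at hmono
  simp only [smul_eq_mul, sub_zero] at hmono
  have hVT2 : C * ‖y S.T - x S.T‖ ^ 2 ≤ C * (D * (b - a)) ^ 2 := by
    have := hδ S.T hTm
    gcongr
  simp only [cost] at hcost
  nlinarith

/-- Pontryagin's principle for the central problem. -/
theorem ham_le_ham (hxk : xk ∈ S.K) {v : P.C} (hv : v ∈ P.ctrl) {τ : ℝ} (hτ : τ ∈ Ico 0 S.T) :
    P.ham (S.xs xk τ) (S.us xk τ) (S.lams xk τ) ≤ P.ham (S.xs xk τ) v (S.lams xk τ) := by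
  obtain ⟨B, hB⟩ := exists_needle_bound hxk hv
  by_contra! hlt
  set ψ : ℝ → ℝ := fun s => P.ham (S.xs xk s) v (S.lams xk s) -
        P.ham (S.xs xk s) (S.us xk s) (S.lams xk s) with hψ
  have hψc : ContinuousOn ψ (Icc 0 S.T) := by
    have hxc := S.continuousOn_xs hxk
    have hlamc := continuousOn_lams hxk
    have hcomp : ∀ H : (P.X × P.X) × P.C → ℝ, Continuous H →
        ContinuousOn (fun s => H ((S.xs xk s, S.lams xk s), v) -
          H ((S.xs xk s, S.lams xk s), S.us xk s)) (Icc 0 S.T) :=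
      fun H hH => (hH.comp_continuousOn ((hxc.prodMk hlamc).prodMk continuousOn_const)).sub
        (hH.comp_continuousOn ((hxc.prodMk hlamc).prodMk (S.continuousOn_us hxk)))
    have := hcomp _ (continuous_ham S.regular)
    exact this
  set m := - ψ τ / 2 with hm
  have hm0 : 0 < m := by simp only [hm, hψ]; linarith
  have hev : ∀ᶠ s in nhdsWithin τ (Ici τ), ψ s < -m := by
    have h1 : nhdsWithin τ (Ici τ) ≤ nhdsWithin τ (Icc 0 S.T) :=
      nhdsWithin_le_of_mem (Icc_mem_nhdsGE_of_mem hτ)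
    refine ((hψc τ ⟨hτ.1, hτ.2.le⟩).tendsto.mono_left h1).eventually (gt_mem_nhds ?_)
    linarith
  obtain ⟨b₀, hb₀, hsub⟩ := (mem_nhdsGE_iff_exists_Ico_subset).1 hev
  -- On a needle of length `ε` to the right of `τ` the gain is at least `m * ε`; the last bound
  -- makes the loss `B * ε ^ 2` at most half of it.
  set ε := min (min ((b₀ - τ) / 2) (S.T - τ)) (m / (2 * (|B| + 1))) with hε
  have hε0 : 0 < ε := by
    refine lt_min (lt_min (half_pos (sub_pos.2 hb₀)) (sub_pos.2 hτ.2)) ?_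
    positivity
  have hε1 : ε ≤ (b₀ - τ) / 2 := (min_le_left _ _).trans (min_le_left _ _)
  have hε2 : ε ≤ S.T - τ := (min_le_left _ _).trans (min_le_right _ _)
  have hε3 : ε ≤ m / (2 * (|B| + 1)) := min_le_right _ _
  have hb := hB τ (τ + ε) hτ.1 (by linarith) (by linarith)
  have hb₀' : τ < b₀ := hb₀
  have hint : ∫ s in τ..(τ + ε), ψ s ≤ ∫ s in τ..(τ + ε), -m :=
    intervalIntegral.integral_mono_on (by linarith)
      (intervalIntegrable_of_integrableOn_Icc hψc.integrableOn_Icc ⟨hτ.1, hτ.2.le⟩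
        ⟨by linarith [hτ.1], by linarith⟩) intervalIntegrable_const
      fun s hs => le_of_lt (hsub ⟨hs.1, by linarith [hs.2]⟩)
  rw [intervalIntegral.integral_const, smul_eq_mul, add_sub_cancel_left] at hint
  rw [add_sub_cancel_left] at hb
  rw [le_div_iff₀ (by positivity)] at hε3
  have h3 : B * ε ^ 2 ≤ |B| * ε ^ 2 := by gcongr; exact le_abs_self B
  have h4 : 0 < m * ε := mul_pos hm0 hε0
  have h5 : |B| * ε ^ 2 * 2 ≤ m * ε := by nlinarith [abs_nonneg B]
  nlinarith

theorem localHam_sub (x lam : P.X) (i : Fin N) (ξ μ : E (P.n i)) (v v' : E (P.m i)) :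
    P.localHam x lam i ξ v μ - P.localHam x lam i ξ v' μ =
      (P.l₀ i ξ v + inner ℝ μ (P.f₀ i ξ v)) - (P.l₀ i ξ v' + inner ℝ μ (P.f₀ i ξ v')) := by
  simp only [localHam, agentCost, agentDyn, inner_add_right]
  ring

/-- Controls occur only in the uncoupled terms, so the Hamiltonian is a sum of functions of single
controls. Minimizing it over the product set is the same as minimizing agent by agent. -/
theorem ham_eq_sum (x lam : P.X) (u : P.C) :
    P.ham x u lam = ∑ i, (P.l₀ i (x i) (u i) + inner ℝ (lam i) (P.f₀ i (x i) (u i)) +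
      (∑ j ∈ P.sending i, P.lc i j (x i) (x j) +
        inner ℝ (lam i) (∑ j ∈ P.sending i, P.fc i j (x i) (x j)))) := by
  simp only [ham, stageCost]
  rw [PiLp.inner_apply, ← Finset.sum_add_distrib]
  refine Finset.sum_congr rfl fun i _ => ?_
  simp only [agentCost, dyn, dynHat, agentDyn, inner_add_right]
  ring

/-- The optimal trajectories are a fixed point of the algorithm. -/
theorem isLocalSol_optimal (hxk : xk ∈ S.K) :
    P.IsLocalSol S.T xk (S.xs xk) (S.lams xk) (S.xs xk) (S.us xk) (S.lams xk) where
  adm := (S.isOptimal hxk).1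
  x_cont := S.continuousOn_xs hxk
  x_eq := (S.isOptimal hxk).2.1.2
  lam_cont := continuousOn_lams hxk
  lam_eq := lams_eq hxk
  ham_min := by
    classical
    rw [ae_restrict_iff' measurableSet_Icc]
    have hne : ∀ᵐ s ∂(volume : Measure ℝ), s ≠ S.T := Measure.ae_ne volume S.T
    filter_upwards [hne] with τ hτT hτ i v hv
    have hτ' : τ ∈ Ico 0 S.T := ⟨hτ.1, lt_of_le_of_ne hτ.2 hτT⟩
    set u := S.us xk τ
    -- Only the control of agent `i` is replaced, so all other summands cancel in the central
    -- inequality. The final time, where it is not available, is a null set.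
    set w : P.C := WithLp.toLp 2 (Function.update (WithLp.ofLp u) i v) with hw
    have hwi : w i = v := by simp [hw]
    have hwj : ∀ j, j ≠ i → w j = u j := fun j hj => by simp [hw, hj]
    have hwc : w ∈ P.ctrl := by
      intro j
      by_cases hj : j = i
      · subst hj; rw [hwi]; exact hv
      · rw [hwj j hj]; exact S.us_mem hxk hτ j
    have h1 := ham_le_ham hxk hwc hτ'
    rw [← sub_nonneg, ham_eq_sum, ham_eq_sum, ← Finset.sum_sub_distrib,
      Finset.sum_eq_single i (fun j _ hj => by rw [hwj j hj, sub_self]) (by simp), hwi] at h1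
    have h2 := localHam_sub (P := P) (S.xs xk τ) (S.lams xk τ) i (S.xs xk τ i) (S.lams xk τ i)
      (u i) v
    linarith

end Setting

end Network

/-! ### Contraction of the algorithm and the error of the actual trajectory. -/

namespace Network

namespace Setting

variable {N : ℕ} {P : Network N} {S : P.Setting} {xk : P.X}

theorem norm_adjoint_le_of_mem_thickening (hxk : xk ∈ S.K) {μ : P.X}
    (hμ : μ ∈ Metric.cthickening S.ρ (gradient P.termCost '' Metric.cthickening S.ρ S.K)) :
    ‖μ‖ ≤ S.Q := by
  have hb : ∀ y ∈ Metric.cthickening S.ρ S.K, ‖gradient P.termCost y‖ ≤ S.Q - S.ρ := fun y hy => by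
    have := S.short.adjoint y (S.norm_le_of_mem_thickening hy)
    linarith
  have hQ : 0 ≤ S.Q - S.ρ :=
    (norm_nonneg _).trans (hb xk (Metric.self_subset_cthickening _ hxk))
  have h1 : gradient P.termCost '' Metric.cthickening S.ρ S.K ⊆
      Metric.closedBall 0 (S.Q - S.ρ) := by
    rintro _ ⟨y, hy, rfl⟩
    exact mem_closedBall_zero_iff.2 (hb y hy)
  have h2 := Metric.cthickening_subset_of_subset S.ρ h1 hμ
  rw [cthickening_closedBall S.short.ρ_pos.le hQ, mem_closedBall_zero_iff] at h2
  linarith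

variable {x' lam' x lam : ℝ → P.X} {u : ℝ → P.C}

theorem localSol_near (hxk : xk ∈ S.K) (hI : P.Iterates S.T S.ρ S.K x' lam')
    (hs : P.IsLocalSol S.T xk x' lam' x u lam) : ∀ τ ∈ Icc 0 S.T, ‖x τ - xk‖ < S.ρ :=
  norm_sub_lt_of_eq_integral hs.x_cont S.short.ρ_pos S.short.bounds.pos.le S.short.lt_ρ hs.x_eq
    fun s hsI hxs => S.short.bounds.dyn_le _ _ _ (norm_le_of_near (S.norm_le hxk) S.short.radius hxs)
      (hs.adm.2 s hsI) (S.norm_le_of_mem_thickening (hI.x_mem s hsI))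

/-- The barrier argument, forward from `xk` for the state and backward from `∂_x V(x(T))` for the
adjoint; previous iterates in the admissible set keep both integrands below `C`. -/
theorem iterates_localSol (hxk : xk ∈ S.K) (hI : P.Iterates S.T S.ρ S.K x' lam')
    (hs : P.IsLocalSol S.T xk x' lam' x u lam) : P.Iterates S.T S.ρ S.K x lam := by
  have hTm : S.T ∈ Icc 0 S.T := ⟨S.T_nonneg, le_rfl⟩
  have hx : ∀ τ ∈ Icc 0 S.T, x τ ∈ Metric.cthickening S.ρ S.K := fun τ hτ =>
    S.mem_thickening hxk (localSol_near hxk hI hs τ hτ).le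
  refine ⟨hs.x_cont, hs.lam_cont, hx, fun τ hτ => ?_⟩
  refine Metric.closedBall_subset_cthickening (mem_image_of_mem _ (hx _ hTm)) S.ρ
    (mem_closedBall_iff_norm.2 (le_of_lt ?_))
  refine norm_sub_lt_of_eq_integral_backward hs.lam_cont S.short.ρ_pos S.short.bounds.pos.le
    S.short.lt_ρ hs.lam_eq (fun s hsI hls => ?_) τ hτ
  exact S.short.bounds.grad_le _ _ _ _ _ (S.norm_le_of_mem_thickening (hI.x_mem s hsI))
    (norm_adjoint_le_of_mem_thickening hxk (hI.lam_mem s hsI))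
    (S.norm_le_of_mem_thickening (hx s hsI)) (hs.adm.2 s hsI)
    (norm_le_of_near le_rfl (S.short.adjoint _ (S.norm_le_of_mem_thickening (hx _ hTm))) hls)

/-- The error of a pair of trajectories with respect to the optimal ones. -/
abbrev err (S : P.Setting) (xk : P.X) (x lam : ℝ → P.X) : ℝ :=
  pairDist S.T (S.xs xk) (S.lams xk) x lam

/-- As part of a fixed point, `u*` satisfies the law `κ` with the optimal pair in place of the
previous iterates, so the Lipschitz bound on `κ` compares it with `u`. The factor `2` counts the
state and the adjoint trajectory. -/
theorem control_sub_le (hxk : xk ∈ S.K) (hI : P.Iterates S.T S.ρ S.K x' lam')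
    (hs : P.IsLocalSol S.T xk x' lam' x u lam) :
    ∀ᵐ τ ∂(volume.restrict (Icc 0 S.T)),
      ‖S.us xk τ - u τ‖ ≤ S.L * (‖S.xs xk τ - x τ‖ + 2 * S.err xk x' lam') := by
  have hL := S.short.L_pos
  have hF := S.standing.feedback
  have hIs := iterates_optimal hxk
  filter_upwards [hF.law xk hxk _ _ hI _ _ _ hs,
    hF.law xk hxk _ _ hIs _ _ _ (isLocalSol_optimal hxk),
    ae_restrict_mem measurableSet_Icc] with τ h1 h2 hτ
  rw [h1, h2]
  refine (hF.lip xk hxk τ hτ _ (S.xs_mem_thickening hxk hτ) _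
    ((iterates_localSol hxk hI hs).x_mem τ hτ) _ _ _ _ hIs hI).trans ?_
  have e1 : supNorm S.T (fun s => S.xs xk s - x' s) ≤ S.err xk x' lam' :=
    supNorm_le S.T_nonneg fun s hs => norm_left_le_pairDist hIs.x_cont hIs.lam_cont hI.x_cont
      hI.lam_cont hs
  have e2 : supNorm S.T (fun s => S.lams xk s - lam' s) ≤ S.err xk x' lam' :=
    supNorm_le S.T_nonneg fun s hs => norm_right_le_pairDist hIs.x_cont hIs.lam_cont hI.x_cont
      hI.lam_cont hs
  refine mul_le_mul_of_nonneg_left ?_ hL.le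
  linarith

theorem state_sub_le (hxk : xk ∈ S.K) (hI : P.Iterates S.T S.ρ S.K x' lam')
    (hs : P.IsLocalSol S.T xk x' lam' x u lam) : ∀ τ ∈ Icc 0 S.T,
      ‖S.xs xk τ - x τ‖ ≤ 4 * (S.C * S.T * (1 + S.L)) * S.err xk x' lam' := by
  intro τ hτ
  have hL := S.short.L_pos
  have hC := S.short.bounds.pos
  have hT := S.T_nonneg
  have hIs := iterates_optimal hxk
  have hIq := iterates_localSol hxk hI hs
  have hopt := S.isOptimal hxk
  have hE : 0 ≤ S.err xk x' lam' := pairDist_nonneg _ _ _ _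
  have hk : S.C * (1 + S.L) * S.T ≤ 1 / 2 := by
    have := S.short.le_one
    nlinarith
  -- The perturbation collects the previous iterates: `C` from the coupling and `2 * C * L` from the
  -- feedback law.
  have := norm_sub_le_of_eq_integral (T := S.T) (k := S.C * (1 + S.L))
    (φ := fun _ => S.C * (1 + 2 * S.L) * S.err xk x' lam') hT (by positivity) hk
    hIs.x_cont hs.x_cont hopt.2.1.2 hs.x_eq
    (S.regular.integrableOn_dyn hopt.2.1.1 hopt.1)
    (S.regular.integrableOn_dynHat hs.x_cont hs.adm hI.x_cont)
    continuousOn_const.integrableOn_Icc (fun _ => by positivity) (by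
      filter_upwards [control_sub_le hxk hI hs, ae_restrict_mem measurableSet_Icc] with s hus hsI
      have e1 := S.short.bounds.dyn_lip (S.xs xk s) (S.us xk s) (S.xs xk s) (x s) (u s) (x' s)
        (S.xs_norm_le_R hxk hsI) (S.us_mem hxk hsI) (S.xs_norm_le_R hxk hsI)
        (S.norm_le_of_mem_thickening (hIq.x_mem s hsI)) (hs.adm.2 s hsI)
        (S.norm_le_of_mem_thickening (hI.x_mem s hsI))
      have e2 : ‖S.xs xk s - x' s‖ ≤ S.err xk x' lam' := norm_left_le_pairDist hIs.x_cont
        hIs.lam_cont hI.x_cont hI.lam_cont hsI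
      refine e1.trans ?_
      have e3 : S.C * (‖S.xs xk s - x s‖ + ‖S.us xk s - u s‖ + ‖S.xs xk s - x' s‖) ≤
          S.C * (‖S.xs xk s - x s‖ + S.L * (‖S.xs xk s - x s‖ + 2 * S.err xk x' lam') +
            S.err xk x' lam') := by gcongr
      refine e3.trans (le_of_eq ?_)
      ring) τ hτ
  rw [sub_self, norm_zero, zero_add, intervalIntegral.integral_const, smul_eq_mul, sub_zero] at this
  refine this.trans ?_
  have e4 : 0 ≤ S.C * S.T * S.err xk x' lam' := by positivity
  nlinarith

theorem state_sub_le' (hxk : xk ∈ S.K) (hI : P.Iterates S.T S.ρ S.K x' lam')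
    (hs : P.IsLocalSol S.T xk x' lam' x u lam) : ∀ τ ∈ Icc 0 S.T,
      ‖S.xs xk τ - x τ‖ ≤ S.err xk x' lam' := by
  intro τ hτ
  have hE : 0 ≤ S.err xk x' lam' := pairDist_nonneg _ _ _ _
  have := S.short.le_one
  refine (state_sub_le hxk hI hs τ hτ).trans ?_
  nlinarith

/-- The algorithm contracts the error by one half. -/
theorem err_le (hxk : xk ∈ S.K) (hI : P.Iterates S.T S.ρ S.K x' lam')
    (hs : P.IsLocalSol S.T xk x' lam' x u lam) :
    S.err xk x lam ≤ 1 / 2 * S.err xk x' lam' := by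
  have hL := S.short.L_pos
  have hC := S.short.bounds.pos
  have hT := S.T_nonneg
  have hTm : S.T ∈ Icc 0 S.T := ⟨hT, le_rfl⟩
  have hIs := iterates_optimal hxk
  have hIq := iterates_localSol hxk hI hs
  have hopt := S.isOptimal hxk
  have hsopt := isLocalSol_optimal hxk
  set E := S.err xk x' lam' with hEdef
  have hE : 0 ≤ E := pairDist_nonneg _ _ _ _
  have hx := state_sub_le hxk hI hs
  set κ := S.C * S.T * (1 + S.L) with hκ
  have hκ0 : 0 ≤ κ := by positivity
  set a := 4 * κ * E with ha
  have ha0 : 0 ≤ a := by positivity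
  have hk : S.C * S.T ≤ 1 / 2 := by
    have := S.short.CT_le
    linarith
  have hlam : ∀ τ ∈ Icc 0 S.T, ‖S.lams xk τ - lam τ‖ ≤
      2 * (S.C * a + S.T * (S.C * ((2 + 2 * S.L) * E + (1 + S.L) * a))) := by
    intro τ hτ
    have := norm_sub_le_of_eq_integral_backward (T := S.T) (k := S.C)
      (φ := fun _ => S.C * ((2 + 2 * S.L) * E + (1 + S.L) * a)) hT hC.le hk
      hIs.lam_cont hs.lam_cont hsopt.lam_eq hs.lam_eq
      (S.regular.integrableOn_localGrad hIs.x_cont hIs.lam_cont hIs.x_cont hopt.1 hIs.lam_cont)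
      (S.regular.integrableOn_localGrad hI.x_cont hI.lam_cont hs.x_cont hs.adm hs.lam_cont)
      continuousOn_const.integrableOn_Icc (fun _ => by positivity) (by
        filter_upwards [control_sub_le hxk hI hs, ae_restrict_mem measurableSet_Icc] with s hus hsI
        refine (S.short.bounds.grad_lip _ _ _ _ _ _ _ _ _ _ (S.xs_norm_le_R hxk hsI)
          (norm_lams_le hxk hsI) (S.xs_norm_le_R hxk hsI) (S.us_mem hxk hsI)
          (norm_lams_le hxk hsI) (S.norm_le_of_mem_thickening (hI.x_mem s hsI))
          (norm_adjoint_le_of_mem_thickening hxk (hI.lam_mem s hsI))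
          (S.norm_le_of_mem_thickening (hIq.x_mem s hsI)) (hs.adm.2 s hsI)
          (norm_adjoint_le_of_mem_thickening hxk (hIq.lam_mem s hsI))).trans ?_
        have e1 : ‖S.xs xk s - x' s‖ ≤ E := norm_left_le_pairDist hIs.x_cont
          hIs.lam_cont hI.x_cont hI.lam_cont hsI
        have e2 : ‖S.lams xk s - lam' s‖ ≤ E := norm_right_le_pairDist hIs.x_cont
          hIs.lam_cont hI.x_cont hI.lam_cont hsI
        have e3 := hx s hsI
        have e4 : ‖S.us xk s - u s‖ ≤ S.L * (a + 2 * E) := hus.trans (by gcongr)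
        have e5 : S.C * (‖S.xs xk s - x' s‖ + ‖S.lams xk s - lam' s‖ + ‖S.xs xk s - x s‖ +
            ‖S.us xk s - u s‖ + ‖S.lams xk s - lam s‖) ≤
            S.C * (E + E + a + S.L * (a + 2 * E) + ‖S.lams xk s - lam s‖) := by gcongr
        refine e5.trans (le_of_eq ?_)
        ring) τ hτ
    rw [intervalIntegral.integral_const, smul_eq_mul, sub_zero] at this
    refine this.trans ?_
    have e6 : ‖gradient P.termCost (S.xs xk S.T) - gradient P.termCost (x S.T)‖ ≤ S.C * a :=
      (S.short.bounds.term_lip _ _ (S.xs_norm_le_R hxk hTm)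
        (S.norm_le_of_mem_thickening (hIq.x_mem _ hTm))).trans (by gcongr; exact hx _ hTm)
    linarith
  refine (pairDist_le hT hx hlam).trans ?_
  -- State and adjoint errors add up to at most `κ * (10 + 8 * C) * E`, which is below half of `κ *
  -- (24 + 16 * C) * E`.
  have hsmall : κ * (24 + 16 * S.C) ≤ 1 := S.short.small
  have e7 : S.T * (S.C * ((2 + 2 * S.L) * E + (1 + S.L) * a)) = κ * (2 * E) + κ * a := by
    rw [hκ]; ring
  rw [e7]
  have e8 : κ * E ≤ E / 24 := by
    have : 0 ≤ κ * S.C := by positivity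
    nlinarith
  have e9 : κ * a ≤ κ * E := by
    have : a ≤ E := by rw [ha]; linarith
    gcongr
  have e10 : κ * (24 + 16 * S.C) * E ≤ E := by nlinarith
  rw [ha] at e9 ⊢
  nlinarith

/-- The old error is at most the step plus the new error, and the latter is half the old one: the
computable step controls the unknown error. -/
theorem err_le_step (hxk : xk ∈ S.K) (hI : P.Iterates S.T S.ρ S.K x' lam')
    (hs : P.IsLocalSol S.T xk x' lam' x u lam) :
    S.err xk x' lam' ≤ 2 * pairDist S.T x lam x' lam' := by
  have hIs := iterates_optimal hxk
  have h1 := err_le hxk hI hs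
  have h2 := pairDist_triangle S.T_nonneg hIs.x_cont hIs.lam_cont hs.x_cont hs.lam_cont hI.x_cont
    hI.lam_cont
  simp only [err] at *
  linarith

theorem step_le_err (hxk : xk ∈ S.K) (hI : P.Iterates S.T S.ρ S.K x' lam')
    (hs : P.IsLocalSol S.T xk x' lam' x u lam) :
    pairDist S.T x lam x' lam' ≤ 3 / 2 * S.err xk x' lam' := by
  have hIs := iterates_optimal hxk
  have h1 := err_le hxk hI hs
  have h2 := pairDist_triangle S.T_nonneg hs.x_cont hs.lam_cont hIs.x_cont hIs.lam_cont hI.x_cont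
    hI.lam_cont
  rw [pairDist_comm x lam (S.xs xk) (S.lams xk)] at h2
  simp only [err] at *
  linarith

/-- The actual trajectory differs from the optimal one at most by the error of the previous
iterates. -/
theorem actual_sub_le (hxk : xk ∈ S.K) (hI : P.Iterates S.T S.ρ S.K x' lam')
    (hs : P.IsLocalSol S.T xk x' lam' x u lam) {xc : ℝ → P.X} (hxc : P.IsTraj S.T xk u xc) :
    ∀ τ ∈ Icc 0 S.T, ‖xc τ - S.xs xk τ‖ ≤ S.err xk x' lam' := by
  intro τ hτ
  have hL := S.short.L_pos
  have hC := S.short.bounds.pos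
  have hT := S.T_nonneg
  have hopt := S.isOptimal hxk
  set E := S.err xk x' lam' with hEdef
  have hE : 0 ≤ E := pairDist_nonneg _ _ _ _
  have := S.short.traj_sub_le S.regular (S.norm_le hxk) hs.adm hopt.1 hxc hopt.2.1
    -- The control difference is `L` times the state difference, at most `E`, plus `2 * E`.
    (t := S.T) ⟨hT, le_rfl⟩ (φ := fun _ => S.C * (S.L * (3 * E)))
    continuousOn_const.integrableOn_Icc (fun _ => by positivity) (by
      filter_upwards [control_sub_le hxk hI hs, ae_restrict_mem measurableSet_Icc] with s hus hsI
      rw [norm_sub_rev]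
      have := state_sub_le' hxk hI hs s hsI
      gcongr
      refine hus.trans ?_
      gcongr
      linarith) τ hτ
  rw [intervalIntegral.integral_const, smul_eq_mul, sub_zero] at this
  refine this.trans ?_
  have h1 := S.short.le_one
  have h2 : 0 ≤ S.C * S.T := by positivity
  nlinarith

theorem linearConvergence : P.LinearConvergence S.T S.ρ (1 / 2) S.K S.xs S.us := fun xk hxk =>
  ⟨S.lams xk, isAdjoint_lams hxk, fun _ _ hI _ _ _ hs =>
    ⟨iterates_localSol hxk hI hs, err_le hxk hI hs⟩⟩

theorem errorBound {D : ℝ} (hD : 2 ≤ D) : P.ErrorBound S.T S.ρ D S.K S.xs := by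
  intro d hd xk hxk x' lam' hI x u lam xc hs hxc hcrit
  refine supNorm_le S.T_nonneg fun τ hτ => (actual_sub_le hxk hI hs hxc τ hτ).trans ?_
  have := err_le_step hxk hI hs
  have h1 : 0 ≤ d * ‖xk‖ := by positivity
  nlinarith

end Setting

end Network

/-! ### Optimal quantities relative to the initial state; quadratic bounds on the optimal cost. -/

namespace Network

variable {N : ℕ} {P : Network N}

theorem Regular.dynHat_zero (hP : P.Regular) : P.dynHat 0 0 0 = 0 := by
  ext i
  have := hP.equilibrium i
  simp [dynHat, this]

theorem QuadBounds.stageCost_zero {ml Ml mV MV : ℝ} (hQ : P.QuadBounds ml Ml mV MV) :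
    P.stageCost 0 0 = 0 :=
  le_antisymm (by simpa using hQ.stage_upper 0 0) (hQ.stageCost_nonneg 0 0)

theorem QuadBounds.termCost_zero {ml Ml mV MV : ℝ} (hQ : P.QuadBounds ml Ml mV MV) :
    P.termCost 0 = 0 :=
  le_antisymm (by simpa using hQ.term_upper 0) (hQ.termCost_nonneg 0)

theorem QuadBounds.gradient_termCost_zero {ml Ml mV MV : ℝ} (hQ : P.QuadBounds ml Ml mV MV) :
    gradient P.termCost 0 = 0 := by
  have : IsLocalMin P.termCost 0 := Filter.Eventually.of_forall fun x => by
    rw [hQ.termCost_zero]; exact hQ.termCost_nonneg x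
  simp [gradient, this.fderiv_eq_zero]

/-- At zero control and adjoint the Hamiltonian reduces to the stage cost, which is minimal at the
origin. -/
theorem QuadBounds.localGrad_zero {ml Ml mV MV : ℝ} (hQ : P.QuadBounds ml Ml mV MV)
    (hP : P.Regular) : P.localGrad 0 0 0 0 0 = 0 := by
  rw [← hP.gradient_ham]
  have : IsLocalMin (fun ξ => P.ham ξ 0 0) 0 := Filter.Eventually.of_forall fun x => by
    simp only [ham, inner_zero_left, add_zero, hQ.stageCost_zero]
    exact hQ.stageCost_nonneg x 0
  simp [gradient, this.fderiv_eq_zero]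

namespace Setting

variable {S : P.Setting} {xk : P.X}

theorem J_nonneg (S : P.Setting) (x : P.X) : 0 ≤ S.J x :=
  (S.quad.termCost_nonneg _).trans (S.quad.termCost_le_cost S.T_nonneg _ _)

theorem isTraj_zero (S : P.Setting) : P.IsTraj S.T 0 (fun _ => 0) (fun _ => 0) :=
  ⟨continuousOn_const, fun τ _ => by simp [dyn, S.regular.dynHat_zero]⟩

theorem J_zero (S : P.Setting) : S.J 0 = 0 := by
  refine le_antisymm ?_ (S.J_nonneg 0)
  have := (S.standing.optimalOn.optimal 0 S.standing.optimalOn.zero_mem).2.2 _ _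
    ⟨aestronglyMeasurable_const, fun _ _ => S.regular.zero_mem_ctrl⟩ S.isTraj_zero
  refine this.trans (le_of_eq ?_)
  simp [cost, S.quad.stageCost_zero, S.quad.termCost_zero]

theorem zero_mem (S : P.Setting) : (0 : P.X) ∈ S.K :=
  ⟨S.standing.optimalOn.zero_mem, by
    have := S.J_zero
    simp only [J] at this
    rw [this]; exact S.α_pos.le⟩

theorem R₁_nonneg (S : P.Setting) : 0 ≤ S.R₁ := (norm_nonneg _).trans (S.norm_le S.zero_mem)

theorem R_nonneg (S : P.Setting) : 0 ≤ S.R := by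
  linarith [S.R₁_nonneg, S.short.radius, S.short.ρ_pos]

theorem Q_nonneg (S : P.Setting) : 0 ≤ S.Q := by
  have := S.short.adjoint 0 (by simpa using S.R_nonneg)
  linarith [norm_nonneg (gradient P.termCost 0), S.short.ρ_pos]

/-- The optimal trajectories are bounded by the initial state, which is in turn bounded by the
optimal state at any time. -/
theorem exists_optimal_bound (S : P.Setting) : ∃ A : ℝ, 1 ≤ A ∧ ∀ xk ∈ S.K, ∀ τ ∈ Icc 0 S.T,
    ‖S.xs xk τ‖ ≤ A * ‖xk‖ ∧ ‖xk‖ ≤ A * ‖S.xs xk τ‖ ∧ ‖S.us xk τ‖ ≤ A * ‖xk‖ ∧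
      ‖S.lams xk τ‖ ≤ A * ‖xk‖ := by
  obtain ⟨Ls', hLs'⟩ := S.standing.feedback.opt_lip
  set Ls := max Ls' 0 with hLs
  have hLs0 : 0 ≤ Ls := le_max_right _ _
  have hC := S.short.bounds.pos
  have hT := S.T_nonneg
  have hTm : S.T ∈ Icc 0 S.T := ⟨hT, le_rfl⟩
  have h0R : ‖(0 : P.X)‖ ≤ S.R := by simpa using S.R_nonneg
  have h0Q : ‖(0 : P.X)‖ ≤ S.Q := by simpa using S.Q_nonneg
  have h0c := S.regular.zero_mem_ctrl
  set G := S.C * (2 + Ls) with hG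
  have hG0 : 0 ≤ G := by positivity
  set A₀ := Real.exp (G * S.T) with hA₀
  have hA1 : 1 ≤ A₀ := Real.one_le_exp (by positivity)
  have hus : ∀ xk ∈ S.K, ∀ τ ∈ Icc 0 S.T, ‖S.us xk τ‖ ≤ Ls * ‖S.xs xk τ‖ := by
    intro xk hxk τ hτ
    -- Comparison with the zero state, where `κ*` vanishes, makes the control proportional to the
    -- state; the origin lies in the level set since `J*(0) = 0`.
    have h1 := hLs' τ hτ _ (S.xs_mem_thickening hxk hτ) 0
      (Metric.self_subset_cthickening _ S.zero_mem) xk hxk xk hxk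
    rw [S.standing.feedback.opt_zero xk hxk.1 τ hτ, ← S.standing.feedback.opt_law xk hxk.1 τ hτ,
      sub_zero, sub_zero, sub_self, norm_zero, add_zero] at h1
    exact h1.trans (by gcongr; exact le_max_left _ _)
  have hder : ∀ xk ∈ S.K, ∀ τ ∈ Icc 0 S.T,
      HasDerivWithinAt (S.xs xk) (P.dyn (S.xs xk τ) (S.us xk τ)) (Icc 0 S.T) τ := by
    intro xk hxk
    refine hasDerivWithinAt_of_eq_integral ?_ (S.isOptimal hxk).2.1.2
    have hcomp : ∀ H : (P.X × P.X) × P.C → P.X, Continuous H →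
        ContinuousOn (fun s => H ((S.xs xk s, S.xs xk s), S.us xk s)) (Icc 0 S.T) :=
      fun H hH => hH.comp_continuousOn
        (((S.continuousOn_xs hxk).prodMk (S.continuousOn_xs hxk)).prodMk (S.continuousOn_us hxk))
    have := hcomp _ S.regular.continuous_dynHat
    exact this
  have hdyn : ∀ xk ∈ S.K, ∀ τ ∈ Icc 0 S.T,
      ‖P.dyn (S.xs xk τ) (S.us xk τ)‖ ≤ G * ‖S.xs xk τ‖ := by
    intro xk hxk τ hτ
    have h1 := S.short.bounds.dyn_lip (S.xs xk τ) (S.us xk τ) (S.xs xk τ) 0 0 0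
      (S.xs_norm_le_R hxk hτ) (S.us_mem hxk hτ) (S.xs_norm_le_R hxk hτ) h0R h0c h0R
    rw [S.regular.dynHat_zero, sub_zero, sub_zero, sub_zero] at h1
    refine h1.trans ?_
    have h2 : S.C * (‖S.xs xk τ‖ + ‖S.us xk τ‖ + ‖S.xs xk τ‖) ≤
        S.C * (‖S.xs xk τ‖ + Ls * ‖S.xs xk τ‖ + ‖S.xs xk τ‖) := by
      gcongr; exact hus xk hxk τ hτ
    refine h2.trans (le_of_eq ?_)
    rw [hG]; ring
  have hup : ∀ xk ∈ S.K, ∀ τ ∈ Icc 0 S.T, ‖S.xs xk τ‖ ≤ A₀ * ‖xk‖ := by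
    intro xk hxk τ hτ
    have := norm_le_exp_mul_of_norm_deriv_le hG0 (hder xk hxk) (hdyn xk hxk) τ hτ
    rwa [S.xs_zero hxk] at this
  have hlow : ∀ xk ∈ S.K, ∀ τ ∈ Icc 0 S.T, ‖xk‖ ≤ A₀ * ‖S.xs xk τ‖ := by
    intro xk hxk τ hτ
    have := norm_zero_le_exp_mul_of_norm_deriv_le hG0 (hder xk hxk) (hdyn xk hxk) τ hτ
    rwa [S.xs_zero hxk] at this
  have hlam : ∀ xk ∈ S.K, ∀ τ ∈ Icc 0 S.T, ‖S.lams xk τ‖ ≤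
      2 * (S.C * A₀ + S.T * (S.C * (2 * A₀ + Ls * A₀))) * ‖xk‖ := by
    intro xk hxk τ hτ
    have hIs := iterates_optimal hxk
    -- The adjoint is compared with the zero solution belonging to the origin. The constant is `2 *
    -- C` because the adjoint occupies two slots of `localGrad`.
    have := norm_sub_le_of_eq_integral_backward (T := S.T) (k := 2 * S.C) (y := fun _ => 0)
      (h := fun _ => 0) (yT := 0) (φ := fun _ => S.C * (2 * A₀ + Ls * A₀) * ‖xk‖)
      hT (by positivity) (by have := S.short.CT_le; linarith)
      hIs.lam_cont continuousOn_const (lams_eq hxk) (fun _ _ => by simp)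
      (S.regular.integrableOn_localGrad hIs.x_cont hIs.lam_cont hIs.x_cont (S.isOptimal hxk).1
        hIs.lam_cont) integrableOn_zero continuousOn_const.integrableOn_Icc
      (fun _ => by positivity) (by
        filter_upwards [ae_restrict_mem measurableSet_Icc] with s hs
        have h1 := S.short.bounds.grad_lip (S.xs xk s) (S.lams xk s) (S.xs xk s) (S.us xk s)
          (S.lams xk s) 0 0 0 0 0 (S.xs_norm_le_R hxk hs) (norm_lams_le hxk hs)
          (S.xs_norm_le_R hxk hs) (S.us_mem hxk hs) (norm_lams_le hxk hs) h0R h0Q h0R h0c h0Q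
        rw [S.quad.localGrad_zero S.regular] at h1
        simp only [sub_zero] at h1 ⊢
        refine h1.trans ?_
        have e1 := hup xk hxk s hs
        have e2 : ‖S.us xk s‖ ≤ Ls * (A₀ * ‖xk‖) := (hus xk hxk s hs).trans (by gcongr)
        have e3 : S.C * (‖S.xs xk s‖ + ‖S.lams xk s‖ + ‖S.xs xk s‖ + ‖S.us xk s‖ +
            ‖S.lams xk s‖) ≤ S.C * (A₀ * ‖xk‖ + ‖S.lams xk s‖ + A₀ * ‖xk‖ + Ls * (A₀ * ‖xk‖) +
            ‖S.lams xk s‖) := by gcongr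
        refine e3.trans (le_of_eq ?_)
        ring) τ hτ
    rw [intervalIntegral.integral_const, smul_eq_mul, sub_zero, sub_zero] at this
    simp only [sub_zero] at this
    have e4 : ‖gradient P.termCost (S.xs xk S.T)‖ ≤ S.C * (A₀ * ‖xk‖) := by
      have := S.short.bounds.term_lip (S.xs xk S.T) 0 (S.xs_norm_le_R hxk hTm) h0R
      rw [S.quad.gradient_termCost_zero, sub_zero, sub_zero] at this
      exact this.trans (by gcongr; exact hup xk hxk _ hTm)
    refine this.trans ?_
    linarith
  set B := 2 * (S.C * A₀ + S.T * (S.C * (2 * A₀ + Ls * A₀))) with hB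
  have hB0 : 0 ≤ B := by positivity
  have hLA : 0 ≤ Ls * A₀ := by positivity
  refine ⟨A₀ + Ls * A₀ + B, by linarith, fun xk hxk τ hτ => ⟨?_, ?_, ?_, ?_⟩⟩
  · exact (hup xk hxk τ hτ).trans (by gcongr; linarith)
  · exact (hlow xk hxk τ hτ).trans (by gcongr; linarith)
  · refine ((hus xk hxk τ hτ).trans (mul_le_mul_of_nonneg_left (hup xk hxk τ hτ) hLs0)).trans ?_
    rw [← mul_assoc]
    gcongr
    linarith
  · exact (hlam xk hxk τ hτ).trans (by gcongr; linarith)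

/-- The optimal state never falls below `‖xk‖ / A`. The bound is used at `t = T` for `mJ` and at `t
= Δ` for the decrease constant `a`. -/
theorem integral_stageCost_ge (hxk : xk ∈ S.K) {A : ℝ} (hA : 1 ≤ A)
    (hlow : ∀ τ ∈ Icc 0 S.T, ‖xk‖ ≤ A * ‖S.xs xk τ‖) {t : ℝ} (ht : t ∈ Icc 0 S.T) :
    S.ml * t / A ^ 2 * ‖xk‖ ^ 2 ≤ ∫ s in (0 : ℝ)..t, P.stageCost (S.xs xk s) (S.us xk s) := by
  have hml := S.quad.ml_pos
  have h0m : (0 : ℝ) ∈ Icc 0 S.T := ⟨le_rfl, S.T_nonneg⟩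
  have := intervalIntegral.integral_mono_on (a := 0) (b := t)
    (f := fun _ => S.ml * (‖xk‖ / A) ^ 2) ht.1
    intervalIntegrable_const (intervalIntegrable_of_integrableOn_Icc
      (S.regular.integrableOn_stageCost (S.continuousOn_xs hxk) (S.isOptimal hxk).1) h0m ht)
    (fun s hs => by
      refine le_trans ?_ (S.quad.stage_lower _ _)
      have h1 : ‖xk‖ / A ≤ ‖S.xs xk s‖ := by
        rw [div_le_iff₀ (by linarith), mul_comm]
        exact hlow s ⟨hs.1, hs.2.trans ht.2⟩
      have h2 : (‖xk‖ / A) ^ 2 ≤ ‖S.xs xk s‖ ^ 2 := by gcongr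
      have h3 := sq_nonneg ‖S.us xk s‖
      gcongr
      linarith)
  rw [intervalIntegral.integral_const, smul_eq_mul, sub_zero] at this
  refine le_trans (le_of_eq ?_) this
  rw [div_pow]; ring

theorem J_lower (hxk : xk ∈ S.K) {A : ℝ} (hA : 1 ≤ A)
    (hlow : ∀ τ ∈ Icc 0 S.T, ‖xk‖ ≤ A * ‖S.xs xk τ‖) :
    S.ml * S.T / A ^ 2 * ‖xk‖ ^ 2 ≤ S.J xk :=
  (integral_stageCost_ge hxk hA hlow ⟨S.T_nonneg, le_rfl⟩).trans
    (le_add_of_nonneg_left (S.quad.termCost_nonneg _))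

theorem J_upper (hxk : xk ∈ S.K) {A : ℝ}
    (hup : ∀ τ ∈ Icc 0 S.T, ‖S.xs xk τ‖ ≤ A * ‖xk‖)
    (hus : ∀ τ ∈ Icc 0 S.T, ‖S.us xk τ‖ ≤ A * ‖xk‖) :
    S.J xk ≤ (S.MV * A ^ 2 + S.T * (S.Ml * (2 * A ^ 2))) * ‖xk‖ ^ 2 := by
  have hT := S.T_nonneg
  have hMl : 0 < S.Ml := S.quad.ml_pos.trans_le S.quad.ml_le
  have hMV : 0 < S.MV := S.quad.mV_pos.trans_le S.quad.mV_le
  have h0m : (0 : ℝ) ∈ Icc 0 S.T := ⟨le_rfl, hT⟩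
  have hTm : S.T ∈ Icc 0 S.T := ⟨hT, le_rfl⟩
  have h1 := intervalIntegral.integral_mono_on (a := 0) (b := S.T)
    (g := fun _ => S.Ml * (2 * (A * ‖xk‖) ^ 2)) hT (intervalIntegrable_of_integrableOn_Icc
      (S.regular.integrableOn_stageCost (S.continuousOn_xs hxk) (S.isOptimal hxk).1) h0m hTm)
    intervalIntegrable_const
    (fun s hs => by
      refine (S.quad.stage_upper _ _).trans ?_
      have h1 : ‖S.xs xk s‖ ^ 2 ≤ (A * ‖xk‖) ^ 2 := by gcongr; exact hup s hs
      have h2 : ‖S.us xk s‖ ^ 2 ≤ (A * ‖xk‖) ^ 2 := by gcongr; exact hus s hs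
      gcongr
      linarith)
  rw [intervalIntegral.integral_const, smul_eq_mul, sub_zero] at h1
  have h2 : P.termCost (S.xs xk S.T) ≤ S.MV * (A * ‖xk‖) ^ 2 :=
    (S.quad.term_upper _).trans (by gcongr; exact hup _ hTm)
  refine (add_le_add h2 h1).trans (le_of_eq ?_)
  ring

end Setting

end Network

/-! ### Decrease of the optimal cost by sampled control-Lyapunov feedback. -/

namespace Network

variable {N : ℕ} {P : Network N}

theorem ShortHorizon.mono {T T' ρ L R₁ R Q C : ℝ} (h : P.ShortHorizon T ρ L R₁ R Q C)
    (hT' : 0 < T') (hle : T' ≤ T) : P.ShortHorizon T' ρ L R₁ R Q C where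
  bounds := h.bounds
  T_pos := hT'
  ρ_pos := h.ρ_pos
  L_pos := h.L_pos
  radius := h.radius
  lt_ρ := lt_of_le_of_lt (mul_le_mul_of_nonneg_left hle h.bounds.pos.le) h.lt_ρ
  small := by
    have hC := h.bounds.pos
    have hL := h.L_pos
    refine le_trans ?_ h.small
    gcongr
  adjoint := h.adjoint

theorem Admissible.mono {T T' : ℝ} {u : ℝ → P.C} (h : P.Admissible T u) (hle : T' ≤ T) :
    P.Admissible T' u :=
  ⟨h.1.mono_measure (Measure.restrict_mono_set _ (Icc_subset_Icc_right hle)),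
    fun τ hτ => h.2 τ ⟨hτ.1, hτ.2.trans hle⟩⟩

theorem IsTraj.mono {T T' : ℝ} {x₀ : P.X} {u : ℝ → P.C} {x : ℝ → P.X} (h : P.IsTraj T x₀ u x)
    (hle : T' ≤ T) : P.IsTraj T' x₀ u x :=
  ⟨h.1.mono (Icc_subset_Icc_right hle), fun τ hτ => h.2 τ ⟨hτ.1, hτ.2.trans hle⟩⟩

theorem Admissible.piecewise {T t : ℝ} {u v : ℝ → P.C} (hu : P.Admissible (min t T) u)
    (hv : P.Admissible T v) : P.Admissible T ((Iic t).piecewise u v) := by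
  classical
  refine ⟨AEStronglyMeasurable.piecewise measurableSet_Iic ?_
    (hv.1.mono_measure Measure.restrict_le_self), fun τ hτ => ?_⟩
  · have h : Iic t ∩ Icc 0 T = Icc 0 (min t T) := by
      ext s
      simp only [mem_inter_iff, mem_Iic, mem_Icc, le_min_iff]
      tauto
    rw [Measure.restrict_restrict measurableSet_Iic, h]
    exact hu.1
  · by_cases h : τ ∈ Iic t
    · rw [piecewise_eq_of_mem _ _ _ h]
      exact hu.2 τ ⟨hτ.1, le_min h hτ.2⟩
    · rw [piecewise_eq_of_notMem _ _ _ h]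
      exact hv.2 τ hτ

theorem Admissible.const {T : ℝ} {v : P.C} (hv : v ∈ P.ctrl) : P.Admissible T (fun _ => v) :=
  ⟨aestronglyMeasurable_const, fun _ _ => hv⟩

theorem IsTraj.shift {T t : ℝ} (hP : P.Regular) {x₀ : P.X} {u : ℝ → P.C} {x : ℝ → P.X}
    (hu : P.Admissible T u) (hx : P.IsTraj T x₀ u x) (ht : t ∈ Icc 0 T) :
    P.IsTraj (T - t) (x t) (fun s => u (s + t)) (fun s => x (s + t)) := by
  have hmem : ∀ s ∈ Icc 0 (T - t), s + t ∈ Icc 0 T := fun s hs =>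
    ⟨by linarith [hs.1, ht.1], by linarith [hs.2]⟩
  refine ⟨hx.1.comp (by fun_prop) hmem, fun τ hτ => ?_⟩
  have h1 := intervalIntegral.integral_comp_add_right (a := 0) (b := τ)
    (fun s => P.dyn (x s) (u s)) t
  rw [h1, zero_add]
  exact eq_add_integral_sub (hP.integrableOn_dyn hx.1 hu) hx.2 ht (hmem τ hτ)

namespace Setting

variable {S : P.Setting} {xk : P.X}

/-- Holding the control `v` constant on a short interval changes `V` plus the integral cost at
most by the value of `V̇ + l` at its beginning, up to an error of second order. -/
theorem termCost_add_integral_le {x₀ : P.X} (hx₀ : ‖x₀‖ ≤ S.R₁) {w : ℝ → P.C} {z : ℝ → P.X}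
    (hw : P.Admissible S.T w) (hz : P.IsTraj S.T x₀ w z) {t₁ t₂ : ℝ} (h1 : 0 ≤ t₁) (h12 : t₁ ≤ t₂)
    (h2 : t₂ ≤ S.T) {v : P.C} (hv : v ∈ P.ctrl) (hwv : ∀ s ∈ Ioc t₁ t₂, w s = v)
    (hdec : fderiv ℝ P.termCost (z t₁) (P.dyn (z t₁) v) + P.stageCost (z t₁) v ≤ 0) :
    P.termCost (z t₂) + ∫ s in t₁..t₂, P.stageCost (z s) (w s) ≤
      P.termCost (z t₁) + S.C * (S.C * (t₂ - t₁)) * (t₂ - t₁) := by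
  have hC := S.short.bounds.pos
  have ht₁ : t₁ ∈ Icc 0 S.T := ⟨h1, h12.trans h2⟩
  have ht₂ : t₂ ∈ Icc 0 S.T := ⟨h1.trans h12, h2⟩
  have hsub : Icc t₁ t₂ ⊆ Icc 0 S.T := Icc_subset_Icc h1 h2
  have hzR := S.short.traj_norm_le hx₀ hw hz
  have hzc : ContinuousOn z (Icc t₁ t₂) := hz.1.mono hsub
  have hder : ∀ s ∈ Ioo t₁ t₂, HasDerivAt (fun s => P.termCost (z s))
      (inner ℝ (gradient P.termCost (z s)) (P.dyn (z s) v)) s := by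
    intro s hs
    have hws : w s = v := hwv s ⟨hs.1, hs.2.le⟩
    have hc : ContinuousAt w s := by
      refine (continuousAt_const (y := v)).congr ?_
      filter_upwards [Ioo_mem_nhds hs.1 hs.2] with r hr
      exact (hwv r ⟨hr.1, hr.2.le⟩).symm
    have e1 := S.hasDerivAt_traj hw hz ⟨h1.trans_lt hs.1, hs.2.trans_le h2⟩ hc
    have e2 := (S.regular.contDiff_termCost.differentiable two_ne_zero (z s)).hasFDerivAt
    have e3 := e2.comp_hasDerivAt s e1
    rwa [hws, ← inner_gradient] at e3
  have hcg : ContinuousOn (fun s => inner ℝ (gradient P.termCost (z s)) (P.dyn (z s) v))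
      (Icc t₁ t₂) := by
    have hcomp : ∀ H : (P.X × P.X) × P.C → P.X, Continuous H →
        ContinuousOn (fun s => H ((z s, z s), v)) (Icc t₁ t₂) :=
      fun H hH => hH.comp_continuousOn ((hzc.prodMk hzc).prodMk continuousOn_const)
    exact (S.regular.contDiff_gradient_termCost.continuous.comp_continuousOn hzc).inner
      (hcomp _ S.regular.continuous_dynHat)
  have hcl : ContinuousOn (fun s => P.stageCost (z s) v) (Icc t₁ t₂) := by
    have hcomp : ∀ H : P.X × P.C → ℝ, Continuous H →
        ContinuousOn (fun s => H (z s, v)) (Icc t₁ t₂) :=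
      fun H hH => hH.comp_continuousOn (hzc.prodMk continuousOn_const)
    exact hcomp _ S.regular.continuous_stageCost
  have hig : IntervalIntegrable (fun s => inner ℝ (gradient P.termCost (z s)) (P.dyn (z s) v))
      volume t₁ t₂ := hcg.intervalIntegrable_of_Icc h12
  have hil : IntervalIntegrable (fun s => P.stageCost (z s) v) volume t₁ t₂ :=
    hcl.intervalIntegrable_of_Icc h12
  have hV := intervalIntegral.integral_eq_sub_of_hasDerivAt_of_le h12
    (S.regular.contDiff_termCost.continuous.comp_continuousOn hzc) hder hig
  have hl : ∫ s in t₁..t₂, P.stageCost (z s) (w s) = ∫ s in t₁..t₂, P.stageCost (z s) v := by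
    refine intervalIntegral.integral_congr_ae (Filter.Eventually.of_forall fun s hs => ?_)
    rw [uIoc_of_le h12] at hs
    simp only [hwv s hs]
  -- The state moves by at most `C * (t₂ - t₁)` and `V̇ + l` is `C`-Lipschitz in the state, so it
  -- exceeds its nonpositive initial value by at most `C * (C * (t₂ - t₁))`.
  have hbd := intervalIntegral.integral_mono_on (a := t₁) (b := t₂)
    (g := fun _ => S.C * (S.C * (t₂ - t₁))) h12 (hig.add hil) intervalIntegrable_const
    (fun s hs => by
      have e1 := (le_abs_self _).trans (S.short.bounds.decay_lip (z s) v (z t₁) (hzR s (hsub hs)) hv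
        (hzR t₁ ht₁))
      rw [inner_gradient (f := P.termCost) (x := z t₁)] at e1
      have e2 : ‖z s - z t₁‖ ≤ S.C * (t₂ - t₁) := by
        rw [eq_add_integral_sub (S.regular.integrableOn_dyn hz.1 hw) hz.2 ht₁ (hsub hs),
          add_sub_cancel_left]
        refine (norm_integral_le_of_ae_Icc (T := S.T) (C := S.C) ?_ ht₁ (hsub hs) hs.1).trans ?_
        · filter_upwards [ae_restrict_mem measurableSet_Icc] with r hr
          exact S.short.bounds.dyn_le _ _ _ (hzR r hr) (hw.2 r hr) (hzR r hr)
        · gcongr; exact hs.2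
      have e3 : S.C * ‖z s - z t₁‖ ≤ S.C * (S.C * (t₂ - t₁)) := by gcongr
      linarith)
  rw [intervalIntegral.integral_add hig hil, hV, intervalIntegral.integral_const, smul_eq_mul]
    at hbd
  rw [hl]
  simp only [Function.comp_apply] at hbd
  linarith

/-- Sample-and-hold application of the control-Lyapunov feedback after the time `t₀`. -/
theorem exists_sample_and_hold {η : ℝ}
    (hη : ∀ x, P.termCost x ≤ η → x ∈ S.Γ ∧ P.termCost x ≤ S.β)
    {x₀ : P.X} (hx₀ : ‖x₀‖ ≤ S.R₁) {w₀ : ℝ → P.C} {z₀ : ℝ → P.X} (hw₀ : P.Admissible S.T w₀)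
    (hz₀ : P.IsTraj S.T x₀ w₀ z₀) {t₀ h : ℝ} (ht₀ : 0 ≤ t₀) (hh : 0 ≤ h) (k : ℕ)
    (hk : t₀ + k * h ≤ S.T)
    (hV : P.termCost (z₀ t₀) + S.C * (S.C * h) * (k * h) ≤ η) :
    ∃ w z, P.Admissible S.T w ∧ P.IsTraj S.T x₀ w z ∧ (∀ s ≤ t₀, w s = w₀ s) ∧
      P.termCost (z (t₀ + k * h)) + ∫ s in t₀..(t₀ + k * h), P.stageCost (z s) (w s) ≤
        P.termCost (z₀ t₀) + S.C * (S.C * h) * (k * h) := by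
  classical
  have hC := S.short.bounds.pos
  induction k with
  | zero => exact ⟨w₀, z₀, hw₀, hz₀, fun _ _ => rfl, by simp⟩
  | succ k ih =>
    have hcast : ((k + 1 : ℕ) : ℝ) * h = k * h + h := by push_cast; ring
    have hkh : 0 ≤ (k : ℝ) * h := by positivity
    have hle : S.C * (S.C * h) * (k * h) ≤ S.C * (S.C * h) * ((k + 1 : ℕ) * h) := by
      gcongr; linarith
    obtain ⟨w, z, hw, hz, hww, hVz⟩ := ih (by rw [hcast] at hk; linarith) (by linarith)
    set t₁ := t₀ + k * h with ht₁
    have ht₁0 : 0 ≤ t₁ := by positivity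
    have ht₀₁ : t₀ ≤ t₁ := by linarith
    have ht₂ : t₀ + (k + 1 : ℕ) * h = t₁ + h := by rw [hcast, ht₁]; ring
    have ht₁T : t₁ + h ≤ S.T := by rw [← ht₂]; exact hk
    have hint0 : 0 ≤ ∫ s in t₀..t₁, P.stageCost (z s) (w s) :=
      intervalIntegral.integral_nonneg ht₀₁ fun _ _ => S.quad.stageCost_nonneg _ _
    -- The running cost is nonnegative, so the bound obtained so far keeps `V(z t₁) ≤ η` and the
    -- feedback is available at `z t₁`. It is not assumed continuous, hence its value is held over
    -- the next interval instead of solving the closed-loop equation.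
    obtain ⟨hΓ, hβ⟩ := hη (z t₁) (by linarith)
    obtain ⟨-, r, -, hr⟩ := S.standing.clf
    obtain ⟨hrc, hrdec⟩ := hr (z t₁) hΓ hβ
    have hrc' : r (z t₁) ∈ P.ctrl := hrc
    set w' := (Iic t₁).piecewise w (fun _ => r (z t₁)) with hw'
    have hw'adm : P.Admissible S.T w' :=
      Admissible.piecewise (hw.mono (min_le_right _ _)) (Admissible.const hrc')
    have hw'in : ∀ s ≤ t₁, w' s = w s := fun s hs => piecewise_eq_of_mem _ _ _ hs
    have hw'out : ∀ s, t₁ < s → w' s = r (z t₁) := fun s hs =>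
      piecewise_eq_of_notMem _ _ _ (by simpa using hs)
    obtain ⟨z', hz'⟩ := S.standing.wellPosed x₀ w' hw'adm
    have ht₁m : t₁ ∈ Icc 0 S.T := ⟨ht₁0, by linarith⟩
    have heq : EqOn z' z (Icc 0 t₁) := S.short.traj_eqOn S.regular hx₀ hw'adm hw hz' hz ht₁m (by
      filter_upwards [ae_restrict_mem measurableSet_Icc] with s hs using hw'in s hs.2)
    have hzt : z' t₁ = z t₁ := heq ⟨ht₁0, le_rfl⟩
    refine ⟨w', z', hw'adm, hz', fun s hs => (hw'in s (hs.trans ht₀₁)).trans (hww s hs), ?_⟩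
    have hstep := S.termCost_add_integral_le hx₀ hw'adm hz' ht₁0 (le_add_of_nonneg_right hh) ht₁T
      hrc' (fun s hs => hw'out s hs.1) (by rw [hzt]; exact hrdec)
    rw [add_sub_cancel_left, hzt] at hstep
    have hi := S.regular.integrableOn_stageCost hz'.1 hw'adm
    have hi1 : ∫ s in t₀..t₁, P.stageCost (z' s) (w' s) = ∫ s in t₀..t₁, P.stageCost (z s) (w s) :=
      intervalIntegral.integral_congr fun s hs => by
        rw [uIcc_of_le ht₀₁] at hs
        simp only [heq ⟨ht₀.trans hs.1, hs.2⟩, hw'in s hs.2]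
    rw [ht₂, ← intervalIntegral.integral_add_adjacent_intervals (b := t₁)
      (intervalIntegrable_of_integrableOn_Icc hi ⟨ht₀, by linarith⟩ ht₁m)
      (intervalIntegrable_of_integrableOn_Icc hi ht₁m ⟨by linarith, ht₁T⟩), hi1, hcast]
    have e : S.C * (S.C * h) * (k * h + h) =
      S.C * (S.C * h) * (k * h) + S.C * (S.C * h) * h := by ring
    linarith

/-- Decrease of the optimal cost along the optimal trajectory, close to the origin. -/
theorem exists_J_decrease (S : P.Setting) : ∃ η : ℝ, 0 < η ∧ ∀ xk ∈ S.K, S.J xk ≤ η →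
    S.xs xk S.Δ ∈ S.Γ →
    S.J (S.xs xk S.Δ) ≤ S.J xk - ∫ s in (0 : ℝ)..S.Δ, P.stageCost (S.xs xk s) (S.us xk s) := by
  classical
  have hC := S.short.bounds.pos
  have hT := S.T_nonneg
  have hΔ0 := S.standing.sampling_pos
  have hΔT := S.standing.sampling_lt
  have hmV := S.quad.mV_pos
  obtain ⟨r, hr, hrΓ⟩ := Metric.isOpen_iff.1 S.standing.optimalOn.isOpen 0
    S.standing.optimalOn.zero_mem
  -- A bound on `V` alone must guarantee membership in `Γ`; this holds when the sublevel set fits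
  -- into a ball inside `Γ`.
  set η := min S.β (S.mV * (r / 2) ^ 2) with hη
  have hη0 : 0 < η := lt_min S.β_pos (by positivity)
  have hηp : ∀ x, P.termCost x ≤ η → x ∈ S.Γ ∧ P.termCost x ≤ S.β := by
    intro x hx
    refine ⟨hrΓ ?_, hx.trans (min_le_left _ _)⟩
    have h1 : S.mV * ‖x‖ ^ 2 ≤ S.mV * (r / 2) ^ 2 :=
      (S.quad.term_lower x).trans (hx.trans (min_le_right _ _))
    have h2 : ‖x‖ ≤ r / 2 := abs_le_of_sq_le_sq' (le_of_mul_le_mul_left h1 hmV) (by positivity) |>.2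
    rw [mem_ball_zero_iff]
    linarith
  -- Half of `η` is for `V(x*(T)) ≤ J*`, the other half for the accumulated sampling error.
  refine ⟨η / 2, by positivity, fun xk hxk hJ hΓ => ?_⟩
  have h0m : (0 : ℝ) ∈ Icc 0 S.T := ⟨le_rfl, hT⟩
  have hTm : S.T ∈ Icc 0 S.T := ⟨hT, le_rfl⟩
  have hΔm : S.Δ ∈ Icc 0 S.T := ⟨hΔ0.le, hΔT.le⟩
  set t₀ := S.T - S.Δ with ht₀
  have ht₀0 : 0 < t₀ := sub_pos.2 hΔT
  have ht₀m : t₀ ∈ Icc 0 S.T := ⟨ht₀0.le, by linarith⟩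
  set y := S.xs xk S.Δ with hy
  have hyR : ‖y‖ ≤ S.R₁ := S.norm_xs_le hxk _ hΔm
  obtain ⟨hu, hx, -⟩ := S.isOptimal hxk
  have hshift := hx.shift S.regular hu hΔm
  have hushift : P.Admissible t₀ (fun s => S.us xk (s + S.Δ)) := by
    have hmem : ∀ s ∈ Icc 0 t₀, s + S.Δ ∈ Icc 0 S.T := fun s hs =>
      ⟨by linarith [hs.1], by linarith [hs.2]⟩
    exact ⟨((S.continuousOn_us hxk).comp (by fun_prop) hmem).aestronglyMeasurable measurableSet_Icc,
      fun τ hτ => hu.2 _ (hmem τ hτ)⟩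
  set w₀ := (Iic t₀).piecewise (fun s => S.us xk (s + S.Δ)) (fun _ => 0) with hw₀
  have hw₀adm : P.Admissible S.T w₀ := Admissible.piecewise
    (by rw [min_eq_left ht₀m.2]; exact hushift) (Admissible.const S.regular.zero_mem_ctrl)
  have hw₀in : ∀ s ≤ t₀, w₀ s = S.us xk (s + S.Δ) := fun s hs => piecewise_eq_of_mem _ _ _ hs
  obtain ⟨z₀, hz₀⟩ := S.standing.wellPosed y w₀ hw₀adm
  have hsame : ∀ {w : ℝ → P.C} {z : ℝ → P.X}, P.Admissible S.T w → P.IsTraj S.T y w z →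
      (∀ s ≤ t₀, w s = w₀ s) → EqOn z (fun s => S.xs xk (s + S.Δ)) (Icc 0 t₀) := by
    intro w z hw hz hww
    refine (S.short.mono ht₀0 ht₀m.2).traj_eqOn S.regular hyR (hw.mono ht₀m.2) hushift
      (hz.mono ht₀m.2) hshift ⟨ht₀0.le, le_rfl⟩ ?_
    filter_upwards [ae_restrict_mem measurableSet_Icc] with s hs
    rw [hww s hs.2, hw₀in s hs.2]
  have hz₀t : z₀ t₀ = S.xs xk S.T := by
    have := hsame hw₀adm hz₀ (fun _ _ => rfl) ⟨ht₀0.le, le_rfl⟩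
    simpa [ht₀] using this
  have hVT : P.termCost (S.xs xk S.T) ≤ η / 2 := (S.quad.termCost_le_cost hT _ _).trans hJ
  refine le_of_forall_pos_le_add fun ε hε => ?_
  -- With `n` samples the total error is `C² Δ² / n`; it must be below `ε` for the limit and below
  -- `η / 2` for invariance.
  obtain ⟨n, hn⟩ := exists_nat_gt (S.C ^ 2 * S.Δ ^ 2 / min ε (η / 2))
  have hmin : 0 < min ε (η / 2) := lt_min hε (by positivity)
  have hnpos : (0 : ℝ) < n := lt_of_le_of_lt (by positivity) hn
  set h := S.Δ / n with hh
  have hnh : n * h = S.Δ := by rw [hh]; field_simp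
  have hsmall : S.C * (S.C * h) * (n * h) ≤ min ε (η / 2) := by
    rw [hnh, hh]
    rw [div_lt_iff₀ hmin] at hn
    have : S.C * (S.C * (S.Δ / n)) * S.Δ = S.C ^ 2 * S.Δ ^ 2 / n := by ring
    rw [this, div_le_iff₀ hnpos]
    linarith
  obtain ⟨w, z, hw, hz, hww, hVz⟩ := S.exists_sample_and_hold hηp hyR hw₀adm hz₀ ht₀0.le
    (h := h) (by positivity) n (by rw [hnh]; linarith) (by
      rw [hz₀t]
      have := hsmall.trans (min_le_right _ _)
      linarith)
  have hfin : t₀ + n * h = S.T := by rw [hnh, ht₀]; ring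
  rw [hfin, hz₀t] at hVz
  have hopt := (S.standing.optimalOn.optimal y hΓ).2.2 z w hw hz
  have hzeq := hsame hw hz hww
  have hi := S.regular.integrableOn_stageCost hz.1 hw
  have hix := S.regular.integrableOn_stageCost hx.1 hu
  have hI1 : ∫ s in (0 : ℝ)..t₀, P.stageCost (z s) (w s) =
      ∫ s in S.Δ..S.T, P.stageCost (S.xs xk s) (S.us xk s) := by
    have e1 := intervalIntegral.integral_comp_add_right (a := 0) (b := t₀)
      (fun s => P.stageCost (S.xs xk s) (S.us xk s)) S.Δ
    rw [zero_add, ht₀, sub_add_cancel] at e1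
    rw [← e1]
    refine intervalIntegral.integral_congr fun s hs => ?_
    rw [uIcc_of_le ht₀0.le] at hs
    simp only [hzeq hs, hww s hs.2, hw₀in s hs.2]
  have hI2 := intervalIntegral.integral_add_adjacent_intervals
    (intervalIntegrable_of_integrableOn_Icc hi h0m ht₀m)
    (intervalIntegrable_of_integrableOn_Icc hi ht₀m hTm)
  have hI3 := intervalIntegral.integral_add_adjacent_intervals
    (intervalIntegrable_of_integrableOn_Icc hix h0m hΔm)
    (intervalIntegrable_of_integrableOn_Icc hix hΔm hTm)
  have hJy : S.J y ≤ P.cost S.T z w := hopt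
  have hJx : S.J xk = P.termCost (S.xs xk S.T) +
    ∫ s in (0 : ℝ)..S.T, P.stageCost (S.xs xk s) (S.us xk s) := rfl
  have hcost : P.cost S.T z w = P.termCost (z S.T) +
    ∫ s in (0 : ℝ)..S.T, P.stageCost (z s) (w s) := rfl
  have := hsmall.trans (min_le_left _ _)
  linarith

end Setting

end Network

/-- In terms of `θ = D d / √mJ` the bound on `d` says that `θ` is below the positive root of `c θ² +
b θ - a`. -/
theorem rate_lt {mJ a b c D d : ℝ} (hmJ : 0 < mJ) (ha : 0 < a) (hb : 0 < b) (hc : 0 < c)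
    (hD : 0 < D) (hd : 0 < d) (hdB : d < dBound mJ a b c D) :
    b * (D * d / Real.sqrt mJ) + c * (D * d / Real.sqrt mJ) ^ 2 < a := by
  have hm := Real.sqrt_pos.2 hmJ
  set θ := D * d / Real.sqrt mJ with hθ
  have hθ0 : 0 < θ := by positivity
  have hR := Real.sq_sqrt (show 0 ≤ b ^ 2 + 4 * a * c by positivity)
  set R := Real.sqrt (b ^ 2 + 4 * a * c) with hRdef
  have hR0 : 0 ≤ R := Real.sqrt_nonneg _
  have h1 : θ < (R - b) / (2 * c) := by
    have : (R - b) / (2 * c) = D * dBound mJ a b c D / Real.sqrt mJ := by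
      rw [dBound, ← hRdef]; field_simp
    rw [this, hθ]
    gcongr
  rw [lt_div_iff₀ (by positivity)] at h1
  have h2 : (2 * c * θ + b) ^ 2 < R ^ 2 := by
    have : 2 * c * θ + b < R := by linarith
    exact pow_lt_pow_left₀ this (by positivity) two_ne_zero
  rw [hR] at h2
  nlinarith

theorem rateJ_eq {mJ a b c D d : ℝ} (hmJ : 0 < mJ) :
    rateJ mJ a b c D d =
      (1 - a) + b * (D * d / Real.sqrt mJ) + c * (D * d / Real.sqrt mJ) ^ 2 := by
  rw [rateJ, div_pow, Real.sq_sqrt hmJ.le]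
  ring

/-- Rounding `t / Δ` down loses less than one step, at the price of the factor `1 / √σ`. -/
theorem sqrt_pow_floor_le {σ Δ t : ℝ} (hσ : 0 < σ) (hσ1 : σ < 1) (hΔ : 0 < Δ) :
    Real.sqrt (σ ^ ⌊t / Δ⌋₊) ≤
      1 / Real.sqrt σ * Real.exp (-(-Real.log σ / (2 * Δ)) * t) := by
  have hlog : Real.log σ < 0 := Real.log_neg hσ hσ1
  have hs : Real.sqrt σ = Real.exp (Real.log σ / 2) := by
    rw [Real.sqrt_eq_rpow, Real.rpow_def_of_pos hσ]
    ring_nf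
  have hs2 : Real.sqrt (σ ^ ⌊t / Δ⌋₊) = Real.exp (⌊t / Δ⌋₊ * (Real.log σ / 2)) := by
    rw [Real.sqrt_eq_rpow, Real.rpow_def_of_pos (by positivity), Real.log_pow]
    ring_nf
  rw [hs2, hs, one_div, ← Real.exp_neg, ← Real.exp_add, Real.exp_le_exp]
  have h1 : t / Δ < ⌊t / Δ⌋₊ + 1 := Nat.lt_floor_add_one _
  have h2 : -(-Real.log σ / (2 * Δ)) * t = (t / Δ) * (Real.log σ / 2) := by
    field_simp
  rw [h2]
  nlinarith

/-! ### Expansion of the optimal cost and the choice of constants. -/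

namespace Network

variable {N : ℕ} {P : Network N}

namespace Setting

/-- Second-order expansion of the optimal cost close to the origin. -/
theorem exists_J_taylor (S : P.Setting) : ∃ r K : ℝ, 0 < r ∧ 0 < K ∧
    (∀ z : P.X, ‖z‖ < r → z ∈ S.Γ) ∧ ∀ z y : P.X, ‖z‖ < r → ‖y‖ < r →
      S.J y ≤ S.J z + K * ‖z‖ * ‖y - z‖ + K * ‖y - z‖ ^ 2 := by
  have hΓ := S.standing.optimalOn.isOpen
  have h0 := S.standing.optimalOn.zero_mem
  have hsm := S.standing.feedback.cost_smooth
  have hat : ∀ z ∈ S.Γ, ContDiffAt ℝ 2 S.J z := fun z hz => hsm.contDiffAt (hΓ.mem_nhds hz)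
  have hder : ContDiffAt ℝ 1 (fderiv ℝ S.J) 0 := (hat 0 h0).fderiv_right (by norm_num)
  obtain ⟨K, t, ht, hK⟩ := hder.exists_lipschitzOnWith
  obtain ⟨r, hr, hrt⟩ := Metric.mem_nhds_iff.1 (Filter.inter_mem ht (hΓ.mem_nhds h0))
  have hball : ∀ z : P.X, ‖z‖ < r → z ∈ t ∧ z ∈ S.Γ := fun z hz =>
    hrt (mem_ball_zero_iff.2 hz)
  -- The derivative of `J*` vanishes at the origin and is Lipschitz nearby, so its norm at `z` is at
  -- most a multiple of `‖z‖`.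
  have hmin : IsLocalMin S.J 0 := Filter.Eventually.of_forall fun x => by
    rw [S.J_zero]; exact S.J_nonneg x
  refine ⟨r, K + 1, hr, by positivity, fun z hz => (hball z hz).2, fun z y hz hy => ?_⟩
  have hL : ∀ u v : P.X, ‖u‖ < r → ‖v‖ < r →
      ‖fderiv ℝ S.J u - fderiv ℝ S.J v‖ ≤ (K + 1) * ‖u - v‖ := fun u v hu hv => by
    have := hK.dist_le_mul u (hball u hu).1 v (hball v hv).1
    rw [dist_eq_norm, dist_eq_norm] at this
    exact this.trans (by gcongr; linarith)
  have h1 := norm_sub_sub_fderiv_le (f := S.J) (S := Metric.ball 0 r) (C := K + 1) (x := z) (y := y)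
    (fun w hw => (hat w (hball w (mem_ball_zero_iff.1 hw)).2).differentiableAt two_ne_zero)
    (convex_ball _ _) (fun w hw => hL w z (mem_ball_zero_iff.1 hw) hz) (by positivity)
    (mem_ball_zero_iff.2 hz) (mem_ball_zero_iff.2 hy)
  have h2 := hL z 0 hz (by simpa using hr)
  rw [hmin.fderiv_eq_zero, sub_zero, sub_zero] at h2
  have h3 := (fderiv ℝ S.J z).le_opNorm (y - z)
  have h4 := (Real.le_norm_self _).trans h1
  have h5 := (Real.le_norm_self _).trans h3
  have h6 : ‖fderiv ℝ S.J z‖ * ‖y - z‖ ≤ (K + 1) * ‖z‖ * ‖y - z‖ := by gcongr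
  linarith

/-- Constants for the optimal trajectories and the optimal cost. -/
structure Constants (S : P.Setting) where
  (A mJ MJ a b c αbar : ℝ)
  A_ge : 1 ≤ A
  mJ_pos : 0 < mJ
  MJ_pos : 0 < MJ
  a_pos : 0 < a
  a_le : a ≤ 1
  b_pos : 0 < b
  c_pos : 0 < c
  αbar_pos : 0 < αbar
  αbar_lt : αbar < S.α
  optimal : ∀ xk ∈ S.K, ∀ τ ∈ Icc 0 S.T, ‖S.xs xk τ‖ ≤ A * ‖xk‖ ∧ ‖xk‖ ≤ A * ‖S.xs xk τ‖ ∧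
    ‖S.us xk τ‖ ≤ A * ‖xk‖ ∧ ‖S.lams xk τ‖ ≤ A * ‖xk‖
  lower : ∀ xk ∈ S.K, mJ * ‖xk‖ ^ 2 ≤ S.J xk
  upper : ∀ xk ∈ S.K, S.J xk ≤ MJ * ‖xk‖ ^ 2
  b_ge : 2 * A * Real.sqrt mJ * a ≤ b
  next : ∀ xk ∈ S.K, S.J xk ≤ αbar → ∀ (e : ℝ) (z : P.X), e ≤ Real.sqrt (αbar / mJ) / 2 →
    ‖z - S.xs xk S.Δ‖ ≤ e → z ∈ S.Γ ∧
      S.J z ≤ (1 - a) * S.J xk + b * Real.sqrt (S.J xk) * e + c * e ^ 2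

theorem norm_le_sqrt_div {mJ : ℝ} (hmJ : 0 < mJ) {x : P.X} {J : ℝ} (h : mJ * ‖x‖ ^ 2 ≤ J) :
    ‖x‖ ≤ Real.sqrt J / Real.sqrt mJ := by
  rw [← Real.sqrt_div' _ hmJ.le]
  refine Real.le_sqrt_of_sq_le ?_
  rw [le_div_iff₀ hmJ]
  linarith

theorem nonempty_constants (S : P.Setting) : Nonempty S.Constants := by
  obtain ⟨A, hA, hopt⟩ := S.exists_optimal_bound
  obtain ⟨r, K, hr, hK, hrΓ, htaylor⟩ := S.exists_J_taylor
  obtain ⟨η, hη, hdec⟩ := S.exists_J_decrease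
  have hA0 : 0 < A := by linarith
  have hT := S.short.T_pos
  have hΔ0 := S.standing.sampling_pos
  have hΔT := S.standing.sampling_lt
  have hml := S.quad.ml_pos
  have hMl : 0 < S.Ml := S.quad.ml_pos.trans_le S.quad.ml_le
  have hMV : 0 < S.MV := S.quad.mV_pos.trans_le S.quad.mV_le
  have hΔm : S.Δ ∈ Icc 0 S.T := ⟨hΔ0.le, hΔT.le⟩
  have hα := S.α_pos
  set mJ := S.ml * S.T / A ^ 2 with hmJ
  have hmJ0 : 0 < mJ := by positivity
  set MJ := S.MV * A ^ 2 + S.T * (S.Ml * (2 * A ^ 2)) with hMJ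
  have hMJ0 : 0 < MJ := by positivity
  -- The cost spent on `[0, Δ]` relative to the upper bound on `J*`. The cap at `1` keeps `1 - a`
  -- nonnegative.
  set a := min (S.ml * S.Δ / A ^ 2 / MJ) 1 with ha
  have ha0 : 0 < a := lt_min (by positivity) one_pos
  have hsq := Real.sqrt_pos.2 hmJ0
  -- The first summand comes from the expansion of `J*`. The second only enlarges `b`, so that `b θ
  -- < a` also forces `2 A θ √mJ ≤ 1`.
  set b := K * A / Real.sqrt mJ + 2 * A * Real.sqrt mJ * a with hb
  -- `η` is for the decrease, `α / 2` for strict inclusion, and the last term keeps `‖x*(Δ)‖ ≤ r /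
  -- 2`, leaving room for the error inside the ball of the expansion.
  set αbar := min η (min (S.α / 2) (mJ * (r / (2 * A)) ^ 2)) with hαbar
  have hαbar0 : 0 < αbar := lt_min hη (lt_min (by positivity) (by positivity))
  have hαr : Real.sqrt (αbar / mJ) ≤ r / (2 * A) := by
    refine Real.sqrt_le_iff.2 ⟨by positivity, ?_⟩
    rw [div_le_iff₀ hmJ0, mul_comm]
    exact (min_le_right _ _).trans (min_le_right _ _)
  have hlower : ∀ xk ∈ S.K, mJ * ‖xk‖ ^ 2 ≤ S.J xk := fun xk hxk =>
    J_lower hxk hA fun τ hτ => (hopt xk hxk τ hτ).2.1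
  have hupper : ∀ xk ∈ S.K, S.J xk ≤ MJ * ‖xk‖ ^ 2 := fun xk hxk =>
    J_upper hxk (fun τ hτ => (hopt xk hxk τ hτ).1) fun τ hτ => (hopt xk hxk τ hτ).2.2.1
  refine ⟨{
    A := A, mJ := mJ, MJ := MJ, a := a, b := b, c := K, αbar := αbar
    A_ge := hA
    mJ_pos := hmJ0
    MJ_pos := hMJ0
    a_pos := ha0
    a_le := min_le_right _ _
    b_pos := by positivity
    c_pos := hK
    αbar_pos := hαbar0
    αbar_lt := ?_
    optimal := hopt
    lower := hlower
    upper := hupper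
    b_ge := by
      have : 0 ≤ K * A / Real.sqrt mJ := by positivity
      linarith
    next := ?_ }⟩
  · have : αbar ≤ S.α / 2 := (min_le_right _ _).trans (min_le_left _ _)
    linarith
  · intro xk hxk hJ e z he hz
    have hJ0 := S.J_nonneg xk
    have he0 : 0 ≤ e := (norm_nonneg _).trans hz
    have hn := norm_le_sqrt_div hmJ0 (hlower xk hxk)
    have hsJ : Real.sqrt (S.J xk) / Real.sqrt mJ ≤ r / (2 * A) := by
      rw [← Real.sqrt_div' _ hmJ0.le]
      exact (Real.sqrt_le_sqrt (by gcongr)).trans hαr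
    set y := S.xs xk S.Δ with hy
    have hyA : ‖y‖ ≤ A * ‖xk‖ := (hopt xk hxk _ hΔm).1
    have hyr : ‖y‖ ≤ r / 2 := by
      refine (hyA.trans (mul_le_mul_of_nonneg_left (hn.trans hsJ) hA0.le)).trans (le_of_eq ?_)
      field_simp
    have her : e ≤ r / 4 := by
      have h1 : r / (2 * A) ≤ r / 2 := by gcongr; linarith
      linarith
    have hzr : ‖z‖ < r := by
      have := norm_add_le y (z - y)
      rw [add_sub_cancel] at this
      linarith
    refine ⟨hrΓ z hzr, ?_⟩
    have h1 := htaylor y z (by linarith) hzr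
    have h2 := hdec xk hxk (hJ.trans (min_le_left _ _)) (hrΓ y (by linarith))
    have h3 := integral_stageCost_ge hxk hA (fun τ hτ => (hopt xk hxk τ hτ).2.1) hΔm
    have h4 : a * S.J xk ≤ S.ml * S.Δ / A ^ 2 * ‖xk‖ ^ 2 := by
      have e1 : a * S.J xk ≤ S.ml * S.Δ / A ^ 2 / MJ * (MJ * ‖xk‖ ^ 2) := by
        gcongr
        · exact min_le_left _ _
        · exact hupper xk hxk
      refine e1.trans (le_of_eq ?_)
      field_simp
    have h5 : K * ‖y‖ * ‖z - y‖ ≤ b * Real.sqrt (S.J xk) * e := by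
      have e1 : K * ‖y‖ * ‖z - y‖ ≤ K * (A * (Real.sqrt (S.J xk) / Real.sqrt mJ)) * e := by
        gcongr
        exact hyA.trans (by gcongr)
      refine e1.trans ?_
      have e2 : K * (A * (Real.sqrt (S.J xk) / Real.sqrt mJ)) * e =
        K * A / Real.sqrt mJ * Real.sqrt (S.J xk) * e := by ring
      rw [e2]
      have : 0 ≤ 2 * A * Real.sqrt mJ * a := by positivity
      gcongr
      linarith
    have h6 : K * ‖z - y‖ ^ 2 ≤ K * e ^ 2 := by gcongr
    linarith

end Setting

end Network

/-! ### Induction along the closed loop. -/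

namespace Network

variable {N : ℕ} {P : Network N}

namespace Setting

variable {S : P.Setting}

theorem levelSet_mono {s : ℝ} (hs : s ≤ S.α) {y : P.X}
    (hy : y ∈ P.levelSet S.T S.Γ S.xs S.us s) : y ∈ S.K := ⟨hy.1, hy.2.trans hs⟩

namespace Constants

variable (c : S.Constants) {θ : ℝ}

/-- The contraction rate of the optimal cost for errors relative to the initial state of at most
`θ √mJ`. -/
def rate (θ : ℝ) : ℝ := 1 - c.a + c.b * θ + c.c * θ ^ 2

theorem rate_pos (hθ : 0 < θ) : 0 < c.rate θ := by
  have h1 := mul_pos c.b_pos hθ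
  have h2 := mul_nonneg c.c_pos.le (sq_nonneg θ)
  have h3 := c.a_le
  rw [rate]; linarith

theorem rate_lt_one (h : c.b * θ + c.c * θ ^ 2 < c.a) : c.rate θ < 1 := by
  rw [rate]; linarith

/-- This is the purpose of `b_ge`. It keeps the error in the range where the expansion of `J*`
applies and later prevents the next state from collapsing relative to the current one. -/
theorem theta_small (hθ : 0 < θ) (h : c.b * θ + c.c * θ ^ 2 < c.a) :
    2 * c.A * (θ * Real.sqrt c.mJ) ≤ 1 := by
  have h1 := mul_nonneg c.c_pos.le (sq_nonneg θ)
  have h2 : 2 * c.A * Real.sqrt c.mJ * c.a * θ ≤ c.b * θ :=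
    mul_le_mul_of_nonneg_right c.b_ge hθ.le
  have ha := c.a_pos
  by_contra! hcon
  nlinarith

theorem sqrt_mJ_pos : 0 < Real.sqrt c.mJ := Real.sqrt_pos.2 c.mJ_pos

theorem theta_mul_le (hθ : 0 < θ) (h : c.b * θ + c.c * θ ^ 2 < c.a) {s : ℝ}
    (hs : s ≤ c.αbar) : θ * Real.sqrt s ≤ Real.sqrt (c.αbar / c.mJ) / 2 := by
  have h1 := c.theta_small hθ h
  have hm := c.sqrt_mJ_pos
  have hA := c.A_ge
  have h2 : θ * Real.sqrt c.mJ ≤ 1 / 2 := by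
    have : 0 ≤ θ * Real.sqrt c.mJ := by positivity
    nlinarith
  rw [Real.sqrt_div' _ c.mJ_pos.le]
  have h3 : Real.sqrt s ≤ Real.sqrt c.αbar := Real.sqrt_le_sqrt hs
  have h4 : θ ≤ 1 / 2 / Real.sqrt c.mJ := by rwa [le_div_iff₀ hm]
  calc θ * Real.sqrt s ≤ 1 / 2 / Real.sqrt c.mJ * Real.sqrt c.αbar := by gcongr
    _ = Real.sqrt c.αbar / Real.sqrt c.mJ / 2 := by ring

theorem norm_le_sqrt {xk : P.X} (hxk : xk ∈ S.K) {s : ℝ} (h : S.J xk ≤ s) :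
    ‖xk‖ ≤ Real.sqrt s / Real.sqrt c.mJ :=
  norm_le_sqrt_div c.mJ_pos ((c.lower xk hxk).trans h)

/-- The bound on the next cost is increasing in `J*` because `a ≤ 1`, so any upper bound `s` can
replace `J*`. It serves both the absolute and the relative decay estimate. -/
theorem J_next_le (hθ : 0 < θ) (h : c.b * θ + c.c * θ ^ 2 < c.a) {xk z : P.X} (hxk : xk ∈ S.K)
    {s : ℝ} (hJ : S.J xk ≤ s) (hs : s ≤ c.αbar)
    (hz : ‖z - S.xs xk S.Δ‖ ≤ θ * Real.sqrt s) : z ∈ S.Γ ∧ S.J z ≤ c.rate θ * s := by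
  have hJ0 := S.J_nonneg xk
  have hs0 : 0 ≤ s := hJ0.trans hJ
  obtain ⟨h1, h2⟩ := c.next xk hxk (hJ.trans hs) _ z (c.theta_mul_le hθ h hs) hz
  refine ⟨h1, h2.trans ?_⟩
  have hss := Real.sq_sqrt hs0
  have h3 : Real.sqrt (S.J xk) ≤ Real.sqrt s := Real.sqrt_le_sqrt hJ
  have h4 : c.b * Real.sqrt (S.J xk) * (θ * Real.sqrt s) ≤
      c.b * Real.sqrt s * (θ * Real.sqrt s) := by
    have := c.b_pos
    gcongr
  have h5 : (1 - c.a) * S.J xk ≤ (1 - c.a) * s :=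
    mul_le_mul_of_nonneg_left hJ (sub_nonneg.2 c.a_le)
  have h6 : (1 - c.a) * s + c.b * Real.sqrt s * (θ * Real.sqrt s) +
      c.c * (θ * Real.sqrt s) ^ 2 = c.rate θ * s := by
    rw [rate]; linear_combination (c.b * θ + c.c * θ ^ 2) * hss
  linarith

theorem costBound {D d : ℝ} (hD : 2 ≤ D) (hd : 0 < d) (hθ : θ = D * d / Real.sqrt c.mJ)
    (h : c.b * θ + c.c * θ ^ 2 < c.a) :
    P.CostBound S.T S.Δ S.ρ c.a c.b c.c d S.K (P.levelSet S.T S.Γ S.xs S.us c.αbar) S.xs S.us := by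
  intro xk hxk' x' lam' hI x u lam xc hs hxc hcrit
  have hxk := levelSet_mono c.αbar_lt.le hxk'
  have hJ : S.J xk ≤ c.αbar := hxk'.2
  have hm := c.sqrt_mJ_pos
  have hθ0 : 0 < θ := by rw [hθ]; positivity
  have hΔm : S.Δ ∈ Icc 0 S.T := ⟨S.standing.sampling_pos.le, S.standing.sampling_lt.le⟩
  set e := supNorm S.T (fun τ => xc τ - S.xs xk τ) with he
  have he1 : e ≤ D * d * ‖xk‖ :=
    errorBound hD d hd xk hxk x' lam' hI x u lam xc hs hxc hcrit
  have he2 : D * d * ‖xk‖ ≤ θ * Real.sqrt (S.J xk) := by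
    have := c.norm_le_sqrt hxk le_rfl
    calc D * d * ‖xk‖ ≤ D * d * (Real.sqrt (S.J xk) / Real.sqrt c.mJ) := by gcongr
      _ = θ * Real.sqrt (S.J xk) := by rw [hθ]; ring
  have hz : ‖xc S.Δ - S.xs xk S.Δ‖ ≤ e :=
    norm_le_supNorm (w := fun τ => xc τ - S.xs xk τ) (hxc.1.sub (S.continuousOn_xs hxk)) hΔm
  have h1 := c.J_next_le hθ0 h hxk le_rfl hJ (hz.trans (he1.trans he2))
  have h2 := c.next xk hxk hJ e _
    ((he1.trans he2).trans (c.theta_mul_le hθ0 h hJ)) hz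
  refine ⟨⟨h1.1, ?_⟩, h2.2⟩
  have h3 : c.rate θ * S.J xk ≤ 1 * S.J xk :=
    mul_le_mul_of_nonneg_right (c.rate_lt_one h).le (S.J_nonneg xk)
  have := c.αbar_lt
  exact h1.2.trans (by linarith)

/-- Changing the reference solution costs at most the sizes of the two optimal pairs. Continuity of
the optimal solution in the initial state is not needed. -/
theorem err_warm {xk y : P.X} (hxk : xk ∈ S.K) (hy : y ∈ S.K) {x lam : ℝ → P.X}
    (hI : P.Iterates S.T S.ρ S.K x lam) :
    S.err y x lam ≤ 2 * c.A * (‖xk‖ + ‖y‖) + S.err xk x lam := by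
  have hIx := iterates_optimal hxk
  have hIy := iterates_optimal hy
  have h1 := pairDist_triangle S.T_nonneg hIy.x_cont hIy.lam_cont hIx.x_cont hIx.lam_cont
    hI.x_cont hI.lam_cont
  have h2 := pairDist_le S.T_nonneg (x := S.xs y) (lam := S.lams y) (x' := S.xs xk)
    (lam' := S.lams xk) (A := c.A * (‖xk‖ + ‖y‖)) (B := c.A * (‖xk‖ + ‖y‖))
    (fun τ hτ => (norm_sub_le _ _).trans (by
      linarith [(c.optimal xk hxk τ hτ).1, (c.optimal y hy τ hτ).1]))
    (fun τ hτ => (norm_sub_le _ _).trans (by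
      linarith [(c.optimal xk hxk τ hτ).2.2.2, (c.optimal y hy τ hτ).2.2.2]))
  simp only [err]
  linarith

end Constants

section Run

variable {xb : ℕ → P.X} {x : ℕ → ℕ → ℝ → P.X} {u : ℕ → ℕ → ℝ → P.C}
  {lam : ℕ → ℕ → ℝ → P.X} {xc : ℕ → ℝ → P.X} {q m : ℕ}

theorem run_iterates (hrun : P.IsRun S.T S.Δ q xb x u lam xc) {k : ℕ} (hxk : xb k ∈ S.K)
    (hI : P.Iterates S.T S.ρ S.K (x k 0) (lam k 0)) (j : ℕ) (hj : j ≤ q) :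
    P.Iterates S.T S.ρ S.K (x k j) (lam k j) ∧
      S.err (xb k) (x k j) (lam k j) ≤ (1 / 2) ^ j * S.err (xb k) (x k 0) (lam k 0) := by
  induction j with
  | zero => exact ⟨hI, by simp⟩
  | succ j ih =>
    obtain ⟨h1, h2⟩ := ih (by omega)
    have hs := hrun.iterate k j (by omega)
    refine ⟨iterates_localSol hxk h1 hs, (err_le hxk h1 hs).trans ?_⟩
    rw [pow_succ]
    linarith

namespace Constants

variable (c : S.Constants) {θ : ℝ}

/-- Invariance of the small level set and decay of the optimal cost in the closed loop. -/
theorem run_decay (hθ : 0 < θ) (h : c.b * θ + c.c * θ ^ 2 < c.a)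
    (hm : (1 / 2) ^ m * ((θ + 4 * c.A / Real.sqrt c.mJ) / Real.sqrt (c.rate θ)) ≤ θ)
    (hrun : P.IsRun S.T S.Δ (m + 1) xb x u lam xc)
    (hx0 : xb 0 ∈ P.levelSet S.T S.Γ S.xs S.us c.αbar)
    (hI : P.Iterates S.T S.ρ S.K (x 0 0) (lam 0 0))
    (herr : S.err (xb 0) (x 0 m) (lam 0 m) ≤ θ * Real.sqrt c.αbar) (k : ℕ) :
    xb k ∈ S.K ∧ S.J (xb k) ≤ c.rate θ ^ k * c.αbar ∧
      P.Iterates S.T S.ρ S.K (x k 0) (lam k 0) ∧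
      S.err (xb k) (x k m) (lam k m) ≤ θ * Real.sqrt (c.rate θ ^ k * c.αbar) := by
  have hσ := c.rate_pos hθ
  have hσ1 := c.rate_lt_one h
  have hα := c.αbar_pos
  have hA := c.A_ge
  have hmJ := c.sqrt_mJ_pos
  have hΔm : S.Δ ∈ Icc 0 S.T := ⟨S.standing.sampling_pos.le, S.standing.sampling_lt.le⟩
  induction k with
  | zero =>
    refine ⟨levelSet_mono c.αbar_lt.le hx0, ?_, hI, by simpa using herr⟩
    rw [pow_zero, one_mul]
    exact hx0.2
  | succ k ih =>
    obtain ⟨hxk, hJ, hIk, hek⟩ := ih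
    have hle : c.rate θ ^ k * c.αbar ≤ c.αbar :=
      mul_le_of_le_one_left hα.le (pow_le_one₀ hσ.le hσ1.le)
    obtain ⟨hIm, -⟩ := run_iterates hrun hxk hIk m (by omega)
    obtain ⟨hIq, -⟩ := run_iterates hrun hxk hIk (m + 1) le_rfl
    have hs := hrun.iterate k m (by omega)
    -- With `q = m + 1`, the applied control comes from iterate `m + 1`, and its trajectory error is
    -- bounded by the error of iterate `m`. This is why the induction carries the latter.
    have hact := actual_sub_le hxk hIm hs (hrun.actual k) S.Δ hΔm
    have hnext := c.J_next_le hθ h hxk hJ hle (hact.trans hek)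
    rw [← hrun.next k, ← mul_assoc, ← pow_succ'] at hnext
    have hle' : c.rate θ ^ (k + 1) * c.αbar ≤ c.αbar :=
      mul_le_of_le_one_left hα.le (pow_le_one₀ hσ.le hσ1.le)
    have hmem : xb (k + 1) ∈ S.K := ⟨hnext.1, hnext.2.trans (hle'.trans c.αbar_lt.le)⟩
    have hIn : P.Iterates S.T S.ρ S.K (x (k + 1) 0) (lam (k + 1) 0) := by
      rw [hrun.warm_x, hrun.warm_lam]; exact hIq
    refine ⟨hmem, hnext.2, hIn, ?_⟩
    obtain ⟨-, hem⟩ := run_iterates hrun hmem hIn m (by omega)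
    set s := Real.sqrt (c.rate θ ^ k * c.αbar) with hs_def
    have hs0 : 0 ≤ s := Real.sqrt_nonneg _
    have hsucc : Real.sqrt (c.rate θ ^ (k + 1) * c.αbar) = Real.sqrt (c.rate θ) * s := by
      rw [hs_def, ← Real.sqrt_mul hσ.le, pow_succ']
      ring_nf
    have hσs := Real.sqrt_pos.2 hσ
    have hσs1 : Real.sqrt (c.rate θ) ≤ 1 := Real.sqrt_le_one.2 hσ1.le
    have hn1 : ‖xb k‖ ≤ s / Real.sqrt c.mJ := c.norm_le_sqrt hxk hJ
    have hn2 : ‖xb (k + 1)‖ ≤ s / Real.sqrt c.mJ := by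
      refine (c.norm_le_sqrt hmem hnext.2).trans ?_
      rw [hsucc]
      gcongr
      nlinarith
    have hw : S.err (xb (k + 1)) (x (k + 1) 0) (lam (k + 1) 0) ≤
        (θ + 4 * c.A / Real.sqrt c.mJ) * s := by
      have e1 := c.err_warm hxk hmem hIn
      have e2 : S.err (xb k) (x (k + 1) 0) (lam (k + 1) 0) ≤ θ * s := by
        rw [hrun.warm_x, hrun.warm_lam]
        have := err_le hxk hIm hs
        have : 0 ≤ S.err (xb k) (x k m) (lam k m) := pairDist_nonneg _ _ _ _
        linarith
      have e3 : 2 * c.A * (‖xb k‖ + ‖xb (k + 1)‖) ≤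
          2 * c.A * (s / Real.sqrt c.mJ + s / Real.sqrt c.mJ) := by gcongr
      have e4 : 2 * c.A * (s / Real.sqrt c.mJ + s / Real.sqrt c.mJ) =
        4 * c.A / Real.sqrt c.mJ * s := by ring
      linarith
    rw [hsucc]
    -- The `m` contractions must beat both the warm-start error and the factor `√rate` by which the
    -- target shrinks.
    calc S.err (xb (k + 1)) (x (k + 1) m) (lam (k + 1) m)
        ≤ (1 / 2) ^ m * ((θ + 4 * c.A / Real.sqrt c.mJ) * s) := hem.trans (by gcongr)
      _ = (1 / 2) ^ m * ((θ + 4 * c.A / Real.sqrt c.mJ) / Real.sqrt (c.rate θ)) *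
          (Real.sqrt (c.rate θ) * s) := by field_simp
      _ ≤ θ * (Real.sqrt (c.rate θ) * s) := by gcongr

/-- The stopping criterion holds in every step of the closed loop, and the optimal cost decays
relative to its initial value. -/
theorem run_stopping {D d : ℝ} (hD : 2 ≤ D) (hd : 0 < d) (hθd : θ = D * d / Real.sqrt c.mJ)
    (h : c.b * θ + c.c * θ ^ 2 < c.a) {M : ℝ}
    (hM : (1 / 2) ^ m * (3 / 2) * (2 * M) ≤ d)
    (hY : (1 / 2) ^ m * (3 / 2) * (2 * c.A * (2 * c.A + d) + 2 * c.A) ≤ d)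
    (hrun : P.IsRun S.T S.Δ (m + 1) xb x u lam xc)
    (hxb : ∀ k, xb k ∈ S.K ∧ S.J (xb k) ≤ c.αbar)
    (hI : ∀ k, P.Iterates S.T S.ρ S.K (x k 0) (lam k 0))
    (hinit : pairDist S.T (x 0 1) (lam 0 1) (x 0 0) (lam 0 0) ≤ M * ‖xb 0‖) (k : ℕ) :
    pairDist S.T (x k (m + 1)) (lam k (m + 1)) (x k m) (lam k m) ≤ d * ‖xb k‖ ∧
      S.J (xb k) ≤ c.rate θ ^ k * S.J (xb 0) := by
  have hA := c.A_ge
  have hmJ := c.sqrt_mJ_pos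
  have hθ : 0 < θ := by rw [hθd]; positivity
  have hσ := c.rate_pos hθ
  have hDd : D * d = θ * Real.sqrt c.mJ := by rw [hθd]; field_simp
  have hsmall := c.theta_small hθ h
  rw [← hDd] at hsmall
  have hΔm : S.Δ ∈ Icc 0 S.T := ⟨S.standing.sampling_pos.le, S.standing.sampling_lt.le⟩
  -- An initial error `B * ‖xb k‖` shrinks by `(1 / 2) ^ m`, and the last step is at most `3 / 2` of
  -- the remaining error.
  have hstep : ∀ k {B : ℝ}, (1 / 2) ^ m * (3 / 2) * B ≤ d →
      S.err (xb k) (x k 0) (lam k 0) ≤ B * ‖xb k‖ →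
      pairDist S.T (x k (m + 1)) (lam k (m + 1)) (x k m) (lam k m) ≤ d * ‖xb k‖ := by
    intro k B hB he
    obtain ⟨hIm, hem⟩ := run_iterates hrun (hxb k).1 (hI k) m (by omega)
    have e1 := step_le_err (hxb k).1 hIm (hrun.iterate k m (by omega))
    calc _ ≤ 3 / 2 * S.err (xb k) (x k m) (lam k m) := e1
      _ ≤ 3 / 2 * ((1 / 2) ^ m * (B * ‖xb k‖)) := by
        gcongr
        exact hem.trans (by gcongr)
      _ = (1 / 2) ^ m * (3 / 2) * B * ‖xb k‖ := by ring
      _ ≤ d * ‖xb k‖ := by gcongr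
  induction k with
  | zero =>
    refine ⟨hstep 0 hM ?_, by simp⟩
    have := err_le_step (hxb 0).1 (hI 0) (hrun.iterate 0 0 (by omega))
    simp only [zero_add] at this
    linarith
  | succ k ih =>
    obtain ⟨hst, hJk⟩ := ih
    obtain ⟨hxk, hJα⟩ := hxb k
    obtain ⟨hIm, -⟩ := run_iterates hrun hxk (hI k) m (by omega)
    have hs := hrun.iterate k m (by omega)
    have hact := actual_sub_le hxk hIm hs (hrun.actual k) S.Δ hΔm
    rw [← hrun.next k] at hact
    have herr := err_le_step hxk hIm hs
    have herr2 : S.err (xb k) (x k m) (lam k m) ≤ 2 * (d * ‖xb k‖) := by linarith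
    have herr3 : S.err (xb k) (x k m) (lam k m) ≤ D * d * ‖xb k‖ := by
      have : 0 ≤ d * ‖xb k‖ := by positivity
      nlinarith
    constructor
    · refine hstep (k + 1) hY ?_
      have e1 := c.err_warm hxk (hxb (k + 1)).1 (hI (k + 1))
      have e2 : S.err (xb k) (x (k + 1) 0) (lam (k + 1) 0) ≤ d * ‖xb k‖ := by
        rw [hrun.warm_x, hrun.warm_lam]
        have := err_le hxk hIm hs
        linarith
      have e3 := (c.optimal _ hxk _ hΔm).2.1
      have e4 : ‖S.xs (xb k) S.Δ‖ ≤ ‖xb (k + 1)‖ + D * d * ‖xb k‖ := by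
        have := norm_sub_norm_le (S.xs (xb k) S.Δ) (xb (k + 1))
        rw [norm_sub_rev] at this
        linarith
      -- The optimal state at `Δ` is at least `‖xb k‖ / A`, and the deviation `D d ‖xb k‖` removes
      -- at most half of it. Errors relative to the old state thus become errors relative to the new
      -- one.
      have e5 : ‖xb k‖ ≤ 2 * c.A * ‖xb (k + 1)‖ := by
        have e6 : c.A * ‖S.xs (xb k) S.Δ‖ ≤ c.A * (‖xb (k + 1)‖ + D * d * ‖xb k‖) := by gcongr
        have e7 : 2 * c.A * (D * d) * ‖xb k‖ ≤ 1 * ‖xb k‖ := by gcongr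
        linarith
      have e8 : (2 * c.A + d) * ‖xb k‖ ≤ (2 * c.A + d) * (2 * c.A * ‖xb (k + 1)‖) := by gcongr
      linarith
    · have hn := c.norm_le_sqrt hxk le_rfl
      have e1 : ‖xb (k + 1) - S.xs (xb k) S.Δ‖ ≤ θ * Real.sqrt (S.J (xb k)) := by
        refine (hact.trans herr3).trans ?_
        rw [hDd]
        calc θ * Real.sqrt c.mJ * ‖xb k‖
            ≤ θ * Real.sqrt c.mJ * (Real.sqrt (S.J (xb k)) / Real.sqrt c.mJ) := by gcongr
          _ = θ * Real.sqrt (S.J (xb k)) := by field_simp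
      refine (c.J_next_le hθ h hxk le_rfl hJα e1).2.trans ?_
      rw [pow_succ', mul_assoc]
      gcongr

theorem norm_actual_le {k : ℕ} (hrun : P.IsRun S.T S.Δ (m + 1) xb x u lam xc) (hxk : xb k ∈ S.K)
    (hI : P.Iterates S.T S.ρ S.K (x k 0) (lam k 0)) {τ : ℝ} (hτ : τ ∈ Icc 0 S.T) :
    ‖xc k τ - S.xs (xb k) τ‖ ≤ S.err (xb k) (x k m) (lam k m) ∧
      ‖xc k τ‖ ≤ c.A * ‖xb k‖ + S.err (xb k) (x k m) (lam k m) := by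
  obtain ⟨hIm, -⟩ := run_iterates hrun hxk hI m (by omega)
  have h1 := actual_sub_le hxk hIm (hrun.iterate k m (by omega)) (hrun.actual k) τ hτ
  have h2 := (c.optimal _ hxk τ hτ).1
  have h3 := norm_add_le (xc k τ - S.xs (xb k) τ) (S.xs (xb k) τ)
  rw [sub_add_cancel] at h3
  exact ⟨h1, by linarith⟩

theorem closedLoop_time_mem (S : P.Setting) {t : ℝ} (ht : 0 ≤ t) :
    t - ⌊t / S.Δ⌋₊ * S.Δ ∈ Icc 0 S.T := by
  have hΔ := S.standing.sampling_pos
  have h1 := Nat.floor_le (show 0 ≤ t / S.Δ by positivity)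
  have h2 := Nat.lt_floor_add_one (t / S.Δ)
  rw [le_div_iff₀ hΔ] at h1
  rw [div_lt_iff₀ hΔ] at h2
  have := S.standing.sampling_lt
  exact ⟨by linarith, by linarith⟩

end Constants

end Run

end Setting

end Network

/-- The condition on `q = m + 1` unfolded for `p = 1 / 2`; the inequality turns around since the
base is below one. -/
theorem half_pow_mul_le {m : ℕ} {d e : ℝ} (hd : 0 < d) (he : 0 < e)
    (h : ((m + 1 : ℕ) : ℝ) > 1 + Real.logb (1 / 2) (d / (e * (1 + 1 / 2)))) :
    (1 / 2 : ℝ) ^ m * (3 / 2) * e ≤ d := by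
  push_cast at h
  have h1 : Real.logb (1 / 2) (d / (e * (1 + 1 / 2))) < m := by linarith
  rw [Real.logb_lt_iff_lt_rpow_of_base_lt_one (by norm_num) (by norm_num) (by positivity),
    Real.rpow_natCast, lt_div_iff₀ (by positivity)] at h1
  linarith

theorem norm_closedLoop_le {F : Type*} [NormedAddCommGroup F] {σ Δ B t : ℝ} {xc : ℕ → ℝ → F}
    (hσ : 0 < σ) (hσ1 : σ < 1) (hΔ : 0 < Δ) (hB : 0 ≤ B)
    (h : ‖closedLoop Δ xc t‖ ≤ B * Real.sqrt (σ ^ ⌊t / Δ⌋₊)) :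
    ‖closedLoop Δ xc t‖ ≤ B / Real.sqrt σ * Real.exp (-(-Real.log σ / (2 * Δ)) * t) := by
  refine h.trans ((mul_le_mul_of_nonneg_left (sqrt_pow_floor_le hσ hσ1 hΔ) hB).trans (le_of_eq ?_))
  ring

/-! ### Exponential stability and the conclusion. -/

namespace Network

variable {N : ℕ} {P : Network N}

namespace Setting

namespace Constants

variable {S : P.Setting} (c : S.Constants)

/-- Exponential stability of the closed loop. -/
theorem closedLoop_stable {D d θ : ℝ} (hD : D = 2 * (N + 1)) (hd : 0 < d)
    (hθd : θ = D * d / Real.sqrt c.mJ) (h : c.b * θ + c.c * θ ^ 2 < c.a) {M : ℝ} (hM : 0 < M) :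
    ∃ e γ₁ γ₂ : ℝ, 0 < e ∧ 0 < γ₁ ∧ 0 < γ₂ ∧
      ∀ q : ℕ, 1 ≤ q → (q : ℝ) > 1 + Real.logb (1 / 2) (d / (e * (1 + 1 / 2))) →
      ∀ (xb : ℕ → P.X) (x : ℕ → ℕ → ℝ → P.X) (u : ℕ → ℕ → ℝ → P.C)
        (lam : ℕ → ℕ → ℝ → P.X) (xc : ℕ → ℝ → P.X),
        P.IsRun S.T S.Δ q xb x u lam xc →
        xb 0 ∈ P.levelSet S.T S.Γ S.xs S.us c.αbar →
        P.Iterates S.T S.ρ S.K (x 0 0) (lam 0 0) →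
        pairDist S.T (x 0 1) (lam 0 1) (x 0 0) (lam 0 0) ≤
          d * N * Real.sqrt (c.αbar / c.mJ) * (1 / 2) ^ (1 - (q : ℤ)) →
        (∀ k, xb k ∈ P.levelSet S.T S.Γ S.xs S.us c.αbar ∧
          S.J (xb k) ≤ c.rate θ ^ k * c.αbar ∧
          supNorm S.T (fun τ => xc k τ - S.xs (xb k) τ) ≤
            θ * Real.sqrt (c.rate θ ^ k * c.αbar)) ∧
        (∀ t, 0 ≤ t → ‖closedLoop S.Δ xc t‖ ≤ γ₁ * Real.exp (-γ₂ * t)) ∧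
        (pairDist S.T (x 0 1) (lam 0 1) (x 0 0) (lam 0 0) ≤ M * ‖xb 0‖ →
          (∀ k, pairDist S.T (x k q) (lam k q) (x k (q - 1)) (lam k (q - 1)) ≤ d * ‖xb k‖) ∧
          ∀ t, 0 ≤ t → ‖closedLoop S.Δ xc t‖ ≤ γ₁ * ‖xb 0‖ * Real.exp (-γ₂ * t)) := by
  have hmJ := c.sqrt_mJ_pos
  have hMJ := Real.sqrt_pos.2 c.MJ_pos
  have hα := c.αbar_pos
  have hD2 : 2 ≤ D := by rw [hD]; linarith [(Nat.cast_nonneg N : (0 : ℝ) ≤ N)]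
  have hA0 : 0 < c.A := one_pos.trans_le c.A_ge
  have hθ : 0 < θ := by rw [hθd]; positivity
  have hσ := c.rate_pos hθ
  have hσ1 := c.rate_lt_one h
  have hσs := Real.sqrt_pos.2 hσ
  have hΔ := S.standing.sampling_pos
  set X := (θ + 4 * c.A / Real.sqrt c.mJ) / Real.sqrt (c.rate θ) with hX
  have hX0 : 0 < X := by positivity
  set Y := 2 * c.A * (2 * c.A + d) + 2 * c.A with hY
  have hY0 : 0 < Y := by positivity
  set B₁ := (c.A / Real.sqrt c.mJ + θ) * Real.sqrt c.αbar with hB₁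
  have hB₁0 : 0 < B₁ := by have := Real.sqrt_pos.2 hα; positivity
  set B₂ := (c.A + 2 * d) * (Real.sqrt c.MJ / Real.sqrt c.mJ) with hB₂
  have hB₂0 : 0 < B₂ := by positivity
  -- Each summand of `e` covers one demand on `m`: contraction of the warm-start error for the
  -- decay, the stopping criterion in step `0`, and the criterion in later steps. `B₁` and `B₂`
  -- serve the absolute and the relative bound.
  refine ⟨X * d / θ + 2 * M + Y, (B₁ + B₂) / Real.sqrt (c.rate θ),
    -Real.log (c.rate θ) / (2 * S.Δ), by positivity, by positivity,
    div_pos (neg_pos.2 (Real.log_neg hσ hσ1)) (by positivity), ?_⟩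
  intro q hq hlog xb x u lam xc hrun hx0 hI hinit
  obtain ⟨m, rfl⟩ : ∃ m, q = m + 1 := ⟨q - 1, by omega⟩
  have hpow := half_pow_mul_le hd (by positivity) hlog
  have hp : (0 : ℝ) < (1 / 2) ^ m := by positivity
  have hsmall : ∀ B, B ≤ X * d / θ + 2 * M + Y → (1 / 2) ^ m * (3 / 2) * B ≤ d := fun B hB =>
    (mul_le_mul_of_nonneg_left hB (by positivity)).trans hpow
  have hXθ : 0 < X * d / θ := by positivity
  have hm : (1 / 2) ^ m * X ≤ θ := by
    have h1 := hsmall (X * d / θ) (by linarith)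
    have h2 : (1 / 2) ^ m * (3 / 2) * (X * d / θ) = (1 / 2) ^ m * X * (3 / 2) / θ * d := by ring
    rw [h2] at h1
    have h3 := le_of_mul_le_mul_right (h1.trans_eq (one_mul d).symm) hd
    rw [div_le_iff₀ hθ] at h3
    have : 0 < (1 / 2) ^ m * X := by positivity
    linarith
  have hx0K := levelSet_mono c.αbar_lt.le hx0
  have herr : S.err (xb 0) (x 0 m) (lam 0 m) ≤ θ * Real.sqrt c.αbar := by
    have h1 := (run_iterates hrun hx0K hI m (by omega)).2
    have h2 := err_le_step hx0K hI (hrun.iterate 0 0 (by omega))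
    rw [zero_add] at h2
    -- The allowance `p ^ (1 - q)` for the initial step is exactly what `m = q - 1` iterations
    -- contract.
    have h3 : (1 / 2 : ℝ) ^ m * (1 / 2) ^ (1 - ((m + 1 : ℕ) : ℤ)) = 1 := by
      rw [← zpow_natCast, ← zpow_add₀ (by norm_num)]
      push_cast
      ring_nf
      norm_num
    calc S.err (xb 0) (x 0 m) (lam 0 m)
        ≤ (1 / 2) ^ m * (2 * (d * N * Real.sqrt (c.αbar / c.mJ) *
          (1 / 2) ^ (1 - ((m + 1 : ℕ) : ℤ)))) := by
          refine h1.trans ?_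
          gcongr
          linarith
      _ = 2 * N * d * Real.sqrt (c.αbar / c.mJ) *
          ((1 / 2) ^ m * (1 / 2) ^ (1 - ((m + 1 : ℕ) : ℤ))) := by ring
      _ ≤ D * d * Real.sqrt (c.αbar / c.mJ) := by
          -- The factor `N` in the allowance is absorbed by `D = 2 * (N + 1)`.
          rw [h3, mul_one, hD]
          gcongr
          linarith
      _ = θ * Real.sqrt c.αbar := by
          rw [hθd, Real.sqrt_div' _ c.mJ_pos.le]; ring
  have hdec := c.run_decay hθ h hm hrun hx0 hI herr
  have hxb : ∀ k, xb k ∈ S.K ∧ S.J (xb k) ≤ c.αbar := fun k => ⟨(hdec k).1,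
    (hdec k).2.1.trans (mul_le_of_le_one_left hα.le (pow_le_one₀ hσ.le hσ1.le))⟩
  have hact := fun k {τ : ℝ} (hτ : τ ∈ Icc 0 S.T) =>
    c.norm_actual_le hrun (hxb k).1 (hdec k).2.2.1 hτ
  refine ⟨fun k => ⟨⟨(hxb k).1.1, (hxb k).2⟩, (hdec k).2.1,
    supNorm_le S.T_nonneg fun τ hτ => ((hact k hτ).1).trans (hdec k).2.2.2⟩, ?_, ?_⟩
  · intro t ht
    refine (norm_closedLoop_le hσ hσ1 hΔ hB₁0.le ?_).trans (by gcongr; linarith)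
    set k := ⌊t / S.Δ⌋₊ with hk
    have h1 := (hact k (closedLoop_time_mem S ht)).2
    have h2 := c.norm_le_sqrt (hxb k).1 (hdec k).2.1
    have h3 := (hdec k).2.2.2
    rw [Real.sqrt_mul (by positivity)] at h2 h3
    refine h1.trans ((add_le_add (mul_le_mul_of_nonneg_left h2 hA0.le) h3).trans (le_of_eq ?_))
    rw [hB₁]
    ring
  · intro hinitM
    have hcrit := c.run_stopping hD2 hd hθd h (hsmall (2 * M) (by linarith))
      (hsmall Y (by linarith)) hrun hxb (fun k => (hdec k).2.2.1) hinitM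
    refine ⟨fun k => (hcrit k).1, fun t ht => ?_⟩
    have hB : ‖closedLoop S.Δ xc t‖ ≤
        B₂ * ‖xb 0‖ * Real.sqrt (c.rate θ ^ ⌊t / S.Δ⌋₊) := by
      set k := ⌊t / S.Δ⌋₊ with hk
      have h1 := (hact k (closedLoop_time_mem S ht)).2
      have h2 := c.norm_le_sqrt (hxb k).1 (hcrit k).2
      rw [Real.sqrt_mul (by positivity)] at h2
      have h3 := err_le_step (hxb k).1 (run_iterates hrun (hxb k).1 (hdec k).2.2.1 m (by omega)).1
        (hrun.iterate k m (by omega))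
      have h4 := (hcrit k).1
      have h5 : Real.sqrt (S.J (xb 0)) ≤ Real.sqrt c.MJ * ‖xb 0‖ := by
        refine Real.sqrt_le_iff.2 ⟨by positivity, ?_⟩
        rw [mul_pow, Real.sq_sqrt c.MJ_pos.le]
        exact c.upper _ hx0K
      calc ‖closedLoop S.Δ xc t‖ ≤ (c.A + 2 * d) * ‖xb k‖ := h1.trans (by linarith)
        _ ≤ (c.A + 2 * d) * (Real.sqrt (c.rate θ ^ k) * (Real.sqrt c.MJ * ‖xb 0‖) /
            Real.sqrt c.mJ) := by
          gcongr
          exact h2.trans (by gcongr)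
        _ = _ := by rw [hB₂]; ring
    refine (norm_closedLoop_le hσ hσ1 hΔ (by positivity) hB).trans ?_
    gcongr
    rw [div_mul_eq_mul_div]
    gcongr
    linarith

end Constants

end Setting

/-- The horizon is short compared with the bounds of the network on a ball that contains all
relevant trajectories. -/
theorem Regular.exists_shortHorizon (hP : P.Regular) {ρ L : ℝ} (hρ : 0 < ρ) (hL : 0 < L)
    (R₁ : ℝ) : ∃ R Q C Tmax, 0 < Tmax ∧ ∀ T, 0 < T → T < Tmax →
      P.ShortHorizon T ρ L R₁ R Q C := by
  obtain ⟨G, hG⟩ := (isCompact_closedBall (0 : P.X) (R₁ + ρ)).exists_bound_of_continuousOn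
    (f := gradient P.termCost) hP.contDiff_gradient_termCost.continuous.continuousOn
  obtain ⟨C, hC⟩ := hP.exists_bounds (R₁ + ρ) (G + ρ)
  have hC0 := hC.pos
  refine ⟨R₁ + ρ, G + ρ, C, min (ρ / C) (1 / (C * (1 + L) * (24 + 16 * C))),
    lt_min (by positivity) (by positivity), fun T hT hT' => ?_⟩
  obtain ⟨h1, h2⟩ := lt_min_iff.1 hT'
  rw [lt_div_iff₀ hC0] at h1
  rw [lt_div_iff₀ (by positivity)] at h2
  exact ⟨hC, hT, hρ, hL, le_rfl, by linarith, by linarith, fun x hx => by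
    linarith [hG x (mem_closedBall_zero_iff.2 hx)]⟩

end Network

end DMPC

end

theorem theorem3 {N : ℕ} (P : DMPC.Network N) (hP : P.Regular)
    (ml Ml mV MV : ℝ) (hQ : P.QuadBounds ml Ml mV MV)
    (β ρ L : ℝ) (hβ : 0 < β) (hρ : 0 < ρ) (hL : 0 < L) :
    ∃ Tmax : ℝ, 0 < Tmax ∧
    ∀ (T Δ α : ℝ) (Γ : Set P.X) (xs : P.X → ℝ → P.X) (us : P.X → ℝ → P.C)
      (κs : ℝ → P.X → P.X → P.C) (κ : ℝ → P.X → (ℝ → P.X) → (ℝ → P.X) → P.X → P.C),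
      T < Tmax → α = β * (1 + ml / mV * T) →
      P.Standing T Δ ρ L β α Γ xs us κs κ →
      ∃ p mJ MJ D a b c αbar : ℝ,
        0 < p ∧ p < 1 ∧ 0 < mJ ∧ 0 < MJ ∧ 0 < D ∧ 0 < a ∧ a ≤ 1 ∧ 0 < b ∧ 0 < c ∧
        0 < αbar ∧ αbar < α ∧
        -- the constants are those of linear convergence, of the quadratic bounds on the
        -- optimal cost, of the error bound and of the bound on the cost decrease
        P.LinearConvergence T ρ p (P.levelSet T Γ xs us α) xs us ∧
        (∀ x ∈ P.levelSet T Γ xs us α,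
          mJ * ‖x‖ ^ 2 ≤ P.optCost T xs us x ∧ P.optCost T xs us x ≤ MJ * ‖x‖ ^ 2) ∧
        P.ErrorBound T ρ D (P.levelSet T Γ xs us α) xs ∧
        (∀ d, 0 < d → d < DMPC.dBound mJ a b c D →
          P.CostBound T Δ ρ a b c d (P.levelSet T Γ xs us α) (P.levelSet T Γ xs us αbar) xs us) ∧
        -- the theorem for any admissible `d`
        ∀ d, 0 < d → d < DMPC.dBound mJ a b c D →
          DMPC.rateJ mJ a b c D d < 1 ∧
          ∀ M : ℝ, 0 < M → ∃ e γ₁ γ₂ : ℝ, 0 < e ∧ 0 < γ₁ ∧ 0 < γ₂ ∧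
            ∀ q : ℕ, 1 ≤ q → (q : ℝ) > 1 + Real.logb p (d / (e * (1 + p))) →
            ∀ (xb : ℕ → P.X) (x : ℕ → ℕ → ℝ → P.X) (u : ℕ → ℕ → ℝ → P.C)
              (lam : ℕ → ℕ → ℝ → P.X) (xc : ℕ → ℝ → P.X),
              P.IsRun T Δ q xb x u lam xc →
              xb 0 ∈ P.levelSet T Γ xs us αbar →
              P.Iterates T ρ (P.levelSet T Γ xs us α) (x 0 0) (lam 0 0) →
              DMPC.pairDist T (x 0 1) (lam 0 1) (x 0 0) (lam 0 0) ≤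
                d * N * Real.sqrt (αbar / mJ) * p ^ (1 - (q : ℤ)) →
              -- exponential decay of the optimal cost and of the error
              (∀ k, xb k ∈ P.levelSet T Γ xs us αbar ∧
                P.optCost T xs us (xb k) ≤ DMPC.rateJ mJ a b c D d ^ k * αbar ∧
                DMPC.supNorm T (fun τ => xc k τ - xs (xb k) τ) ≤
                  D * d / Real.sqrt mJ * Real.sqrt (DMPC.rateJ mJ a b c D d ^ k * αbar)) ∧
              -- exponential convergence of the closed loop
              (∀ t, 0 ≤ t → ‖DMPC.closedLoop Δ xc t‖ ≤ γ₁ * Real.exp (-γ₂ * t)) ∧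
              -- if the initial optimization error is also proportional to the initial state,
              -- the stopping criterion holds in every step and the origin is exponentially stable
              (DMPC.pairDist T (x 0 1) (lam 0 1) (x 0 0) (lam 0 0) ≤ M * ‖xb 0‖ →
                (∀ k, DMPC.pairDist T (x k q) (lam k q) (x k (q - 1)) (lam k (q - 1)) ≤
                  d * ‖xb k‖) ∧
                ∀ t, 0 ≤ t →
                  ‖DMPC.closedLoop Δ xc t‖ ≤ γ₁ * ‖xb 0‖ * Real.exp (-γ₂ * t)) := by
  have hml := hQ.ml_pos
  have hmV := hQ.mV_pos
  -- The level `α` depends on `T`. Restricting to `T < 1` bounds it by `β * (1 + ml / mV)`, so the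
  -- radius, and with it the maximal horizon, is fixed before `T`.
  set R₀ := Real.sqrt (β * (1 + ml / mV) / mV) with hR₀
  obtain ⟨R, Q, C, Tmax, hTmax, hshort⟩ := hP.exists_shortHorizon hρ hL (R₀ + ρ)
  refine ⟨min 1 Tmax, lt_min one_pos hTmax, fun T Δ α Γ xs us κs κ hT hα hS => ?_⟩
  have hT0 : 0 < T := hS.sampling_pos.trans hS.sampling_lt
  obtain ⟨hT1, hT2⟩ := lt_min_iff.1 hT
  have hα0 : 0 < α := by rw [hα]; positivity
  have hα1 : α ≤ β * (1 + ml / mV) := by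
    rw [hα]
    gcongr
    exact mul_le_of_le_one_right (by positivity) hT1.le
  let S : P.Setting :=
    { ml := ml, Ml := Ml, mV := mV, MV := MV, T := T, Δ := Δ, ρ := ρ, L := L, β := β, α := α
      R₁ := R₀ + ρ, R := R, Q := Q, C := C, Γ := Γ, xs := xs, us := us, κs := κs, κ := κ
      regular := hP
      quad := hQ
      short := hshort T hT0 hT2
      standing := hS
      β_pos := hβ
      α_pos := hα0
      level_radius := fun x hx => by
        gcongr
        refine Real.le_sqrt_of_sq_le ?_
        rw [le_div_iff₀ hmV]
        linarith }
  obtain ⟨c⟩ := S.nonempty_constants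
  have hD : (2 : ℝ) ≤ 2 * (N + 1) := by linarith [(Nat.cast_nonneg N : (0 : ℝ) ≤ N)]
  have hD0 : (0 : ℝ) < 2 * (N + 1) := by linarith
  have hrate : ∀ d, 0 < d → d < DMPC.dBound c.mJ c.a c.b c.c (2 * (N + 1)) → _ := fun d hd hdB =>
    DMPC.rate_lt c.mJ_pos c.a_pos c.b_pos c.c_pos hD0 hd hdB
  -- The choice of `D` meets two needs: at least `2` for the error bound and at least `2 * N` for
  -- the initialization.
  refine ⟨1 / 2, c.mJ, c.MJ, 2 * (N + 1), c.a, c.b, c.c, c.αbar, by norm_num, by norm_num,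
    c.mJ_pos, c.MJ_pos, hD0, c.a_pos, c.a_le, c.b_pos, c.c_pos, c.αbar_pos, c.αbar_lt,
    DMPC.Network.Setting.linearConvergence (S := S), fun x hx => ⟨c.lower x hx, c.upper x hx⟩,
    DMPC.Network.Setting.errorBound (S := S) hD,
    fun d hd hdB => c.costBound hD hd rfl (hrate d hd hdB), fun d hd hdB => ?_⟩
  have hrJ : DMPC.rateJ c.mJ c.a c.b c.c (2 * (N + 1)) d =
      c.rate (2 * (N + 1) * d / Real.sqrt c.mJ) := DMPC.rateJ_eq c.mJ_pos
  rw [hrJ]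
  exact ⟨c.rate_lt_one (hrate d hd hdB), fun M hM =>
    c.closedLoop_stable rfl hd rfl (hrate d hd hdB) hM⟩
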